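/- Let $M$ be a finite-dimensional smooth Hausdorff manifold without boundary, $\pi:TM\to M$ its tangent bundle and $TM\setminus 0$ the complement of the zero section. Let $F:TM\to[0,\infty)$ be a (not necessarily reversible) Finsler metric: $F$ is smooth on $TM\setminus 0$, $F(w)=0$ iff $w=0$, $F(\lambda w)=\lambda F(w)$ for $\lambda\ge 0$, and the fundamental tensor $g_F(w)=\tfrac12 d_f^2F^2(w)$ (second fibre derivative) is positive definite for every $w\neq 0$. *Geodesic flow.* Let $\mathscr L_F(w)=\tfrac12 d_fF^2(w)$ be the Legendre transformation, $(\alpha_F)_w(X)=\mathscr L_F(w)(d\pi(w)X)$ and $\omega_F=-d\alpha_F$ on $TM\setminus 0$. The geodesic spray $S=S_F$ is the vector field on $TM\setminus 0$ with $\omega_F(S,\cdot)=\tfrac12 dF^2$. Let $i_w(u)=\frac{d}{dt}\big|_{t=0}(w+tu)$ be the vertical lift of $u\in T_{\pi(w)}M$ at $w$, $\mathcal V_wTM=\ker d\pi(w)=i_w(T_{\pi(w)}M)$, $C_w=i_w(w)$ and $\mathcal J_w(X)=i_w(d\pi(w)X)$. *Flag curvature.* $\Gamma_S=-[S,\mathcal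 J]$ is a field of reflections of $T(TM\setminus 0)$ with $(-1)$-eigenspaces $\mathcal V_wTM$; its $1$-eigenspaces are the horizontal spaces. Let $\mathcal P_{\mathcal V}$ be the projection onto the vertical spaces along the horizontal ones and $u^{\mathfrak h}$ the horizontal lift at $w$ of $u\in T_{\pi(w)}M$. Let $\nabla$ be any smooth linear connection on the vector bundle $\mathcal VTM\to TM\setminus 0$ with $\nabla_XC=\mathcal P_{\mathcal V}(X)$ and $\nabla_S\mathcal J(X)-\nabla_X\mathcal J(S)-\mathcal J([S,X])=0$ for all vector fields $X$ on $TM\setminus 0$. With $\mathcal R(X,Y)Z=\nabla_{[X,Y]}Z-[\nabla_X,\nabla_Y]Z$, put $\mathbf R_w(u)=i_w^{-1}\,\mathcal R(w^{\mathfrak h},u^{\mathfrak h})C_w$ and, for a plane $\Pi=\mathrm{span}[w,u]\subset T_{\pi(w)}M$, $$K_F(w,\Pi)=\frac{g_F(w)(\mathbf R_w(u),u)}{g_F(w)(w,w)\,g_F(w)(u,u)-g_F(w)(w,u)^2},$$ the flag curvature of the flag $(w,\Pi)$. *Invariants of the Jacobi curve.* Let $v\in T_mM$, $v\ne0$, and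 let $\Phi_t$ be the local flow of $S$ near $v$. The Jacobi curve at $v$ is the curve of subspaces $\ell_v(t)=d\Phi_t(v)^{-1}\big(\mathcal V_{\Phi_t(v)}TM\big)$ of $T_vTM$, for $t$ near $0$. Near any time, choose a smooth frame $a_1(t),\dots,a_n(t)$ of $\ell_v(t)$; the curve is fanning at $t$ if $a_1,\dots,a_n,\dot a_1,\dots,\dot a_n$ is a basis of $T_vTM$ at $t$. The fundamental endomorphism $\mathbf F_v(t)$ is then given by $\mathbf F_v(t)a_i(t)=0$, $\mathbf F_v(t)\dot a_i(t)=a_i(t)$, the Jacobi endomorphism is $\mathbf K_v(t)=\tfrac14\ddot{\mathbf F}_v(t)^2$, and the Wronskian is the bilinear form $W_v(t)(x,y)=\omega_F(x,\dot b(t))$ on $\ell_v(t)$, for any smooth section $b$ of $\ell_v$ with $b(t)=y$. **Theorem.** Let $u\in T_mM$ be such that $v,u$ are linearly independent and $g_F(v)(v,u)=0$, let $\Pi=\mathrm{span}[v,u]$ and $a=i_v(u)\in\ell_v(0)=\mathcal V_vTM$. Then $\ell_v$ is fanning at $t=0$, $W_v(0)(a,a)\neq 0$, and $$K_F(v,\Pi)=\frac{1}{F(v)^2}\,\frac{W_v(0)\big(\mathbf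 K_v(0)a,a\big)}{W_v(0)(a,a)} .$$ -/

import Mathlib

open Bundle Set
open scoped Manifold ContDiff Topology

noncomputable section

namespace FinslerJacobi

section Curves

/-! Curves of subspaces of a finite-dimensional real vector space `V`, near a time `t`. -/

variable {V : Type*} [NormedAddCommGroup V] [NormedSpace ℝ V]

/-- `a` is a smooth section of the curve of subspaces `ℓ`, defined near the time `t`. -/
def IsSectionNear (ℓ : ℝ → Submodule ℝ V) (t : ℝ) (a : ℝ → V) : Prop :=
  ∃ J : Set ℝ, IsOpen J ∧ t ∈ J ∧ ContDiffOn ℝ ∞ a J ∧ ∀ s ∈ J, a s ∈ ℓ s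

/-- `(a₁, …, aₙ)` is a smooth frame of the curve of subspaces `ℓ`, defined near the time `t`. -/
def IsFrameNear {n : ℕ} (ℓ : ℝ → Submodule ℝ V) (t : ℝ) (a : Fin n → ℝ → V) : Prop :=
  ∃ J : Set ℝ, IsOpen J ∧ t ∈ J ∧ (∀ i, ContDiffOn ℝ ∞ (a i) J) ∧
    ∀ s ∈ J, LinearIndependent ℝ (fun i => a i s) ∧
      Submodule.span ℝ (Set.range fun i => a i s) = ℓ s

/-- `(a₁, …, aₙ, ȧ₁, …, ȧₙ)` is a basis of `V` at the time `t`. -/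
def IsFanningFrameAt {n : ℕ} (t : ℝ) (a : Fin n → ℝ → V) : Prop :=
  LinearIndependent ℝ (Sum.elim (fun i => a i t) (fun i => deriv (a i) t)) ∧
    Submodule.span ℝ (Set.range (Sum.elim (fun i => a i t) (fun i => deriv (a i) t))) = ⊤

/-- The curve of subspaces `ℓ` is smooth near `t` and fanning at `t`. -/
def IsFanningAt (ℓ : ℝ → Submodule ℝ V) (t : ℝ) : Prop :=
  ∃ (n : ℕ) (a : Fin n → ℝ → V), IsFrameNear ℓ t a ∧ IsFanningFrameAt t a

/-- `T` is the endomorphism with `T aᵢ(t) = 0` and `T ȧᵢ(t) = aᵢ(t)` for a frame `(aᵢ)` of the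
fanning curve `ℓ`. -/
def IsFundamentalEndomorphismAt (ℓ : ℝ → Submodule ℝ V) (t : ℝ) (T : V →L[ℝ] V) : Prop :=
  ∃ (n : ℕ) (a : Fin n → ℝ → V), IsFrameNear ℓ t a ∧ IsFanningFrameAt t a ∧
    ∀ i, T (a i t) = 0 ∧ T (deriv (a i) t) = a i t

/-- The fundamental endomorphism `𝐅(t)` of a fanning curve. -/
def fundamentalEndomorphism (ℓ : ℝ → Submodule ℝ V) (t : ℝ) : V →L[ℝ] V :=
  Classical.epsilon (IsFundamentalEndomorphismAt ℓ t)

/-- The Jacobi endomorphism `𝐊(t) = (1/4) 𝐅̈(t)²` of a fanning curve. -/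
def jacobiEndomorphism (ℓ : ℝ → Submodule ℝ V) (t : ℝ) : V →L[ℝ] V :=
  (1 / 4 : ℝ) • (deriv (deriv (fundamentalEndomorphism ℓ)) t ∘L
    deriv (deriv (fundamentalEndomorphism ℓ)) t)

/-- The Wronskian `W(t)(x, y) = Ω(x, ḃ(t))`, where `b` is any section of `ℓ` with `b(t) = y`, of a
curve `ℓ` of Lagrangian subspaces of `(V, Ω)`. -/
def wronskian (Ω : V → V → ℝ) (ℓ : ℝ → Submodule ℝ V) (t : ℝ) (x y : V) : ℝ :=
  Ω x (deriv (Classical.epsilon fun b : ℝ → V => IsSectionNear ℓ t b ∧ b t = y) t)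

end Curves

section TangentBundle

variable {E : Type*} [NormedAddCommGroup E] [NormedSpace ℝ E]
  {M : Type*} [TopologicalSpace M] [ChartedSpace E M] [IsManifold 𝓘(ℝ, E) ∞ M]

/-- The differential `dπ(w) : T_w TM → T_{π(w)} M` of the projection `π : TM → M`. -/
def dproj (w : TangentBundle 𝓘(ℝ, E) M) :
    TangentSpace 𝓘(ℝ, E).tangent w →L[ℝ] TangentSpace 𝓘(ℝ, E) w.proj :=
  mfderiv 𝓘(ℝ, E).tangent 𝓘(ℝ, E) (TotalSpace.proj : TangentBundle 𝓘(ℝ, E) M → M) w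

/-- The vertical space `𝒱_w TM`, the kernel of `dπ(w)`. -/
def verticalSpace (w : TangentBundle 𝓘(ℝ, E) M) :
    Submodule ℝ (TangentSpace 𝓘(ℝ, E).tangent w) :=
  LinearMap.ker (dproj w).toLinearMap

/-- The vertical lift `i_w(u) = d/dt|₀ (w + t u)`. -/
def verticalLift (w : TangentBundle 𝓘(ℝ, E) M) (u : TangentSpace 𝓘(ℝ, E) w.proj) :
    TangentSpace 𝓘(ℝ, E).tangent w :=
  mfderiv 𝓘(ℝ, ℝ) 𝓘(ℝ, E).tangent
    (fun t : ℝ => (⟨w.proj, w.2 + t • u⟩ : TangentBundle 𝓘(ℝ, E) M)) 0 (1 : ℝ)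

/-- The complement `TM \ 0` of the zero section. -/
def puncturedTangentBundle (E M : Type*) [NormedAddCommGroup E] [NormedSpace ℝ E]
    [TopologicalSpace M] [ChartedSpace E M] : Set (TangentBundle 𝓘(ℝ, E) M) :=
  {w | w.2 ≠ 0}

/-- The almost-tangent structure `𝒥_w(X) = i_w(dπ(w) X)`. -/
def almostTangent (w : TangentBundle 𝓘(ℝ, E) M) (X : TangentSpace 𝓘(ℝ, E).tangent w) :
    TangentSpace 𝓘(ℝ, E).tangent w :=
  verticalLift w (dproj w X)

end TangentBundle

section Finsler

variable {E : Type*} [NormedAddCommGroup E] [NormedSpace ℝ E]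
  {M : Type*} [TopologicalSpace M] [ChartedSpace E M] [IsManifold 𝓘(ℝ, E) ∞ M]

/-- The energy `(1/2) F²`. -/
def energy (F : TangentBundle 𝓘(ℝ, E) M → ℝ) (w : TangentBundle 𝓘(ℝ, E) M) : ℝ :=
  (1 / 2) * F w ^ 2

/-- The Legendre transformation `𝓛_F(w) = (1/2) d_f F²(w)`, the fibre derivative of `(1/2) F²`. -/
def legendre (F : TangentBundle 𝓘(ℝ, E) M → ℝ) (w : TangentBundle 𝓘(ℝ, E) M) :
    TangentSpace 𝓘(ℝ, E) w.proj →L[ℝ] ℝ :=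
  fderiv ℝ (fun y : TangentSpace 𝓘(ℝ, E) w.proj => energy F ⟨w.proj, y⟩) w.2

/-- The fundamental tensor `g_F(w) = (1/2) d_f² F²(w)`, the second fibre derivative of
`(1/2) F²`. -/
def fundamentalTensor (F : TangentBundle 𝓘(ℝ, E) M → ℝ) (w : TangentBundle 𝓘(ℝ, E) M) :
    TangentSpace 𝓘(ℝ, E) w.proj →L[ℝ] TangentSpace 𝓘(ℝ, E) w.proj →L[ℝ] ℝ :=
  fderiv ℝ (fderiv ℝ fun y : TangentSpace 𝓘(ℝ, E) w.proj => energy F ⟨w.proj, y⟩) w.2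

/-- Finsler metrics on `M` (positively homogeneous, not necessarily reversible). -/
structure IsFinslerMetric (F : TangentBundle 𝓘(ℝ, E) M → ℝ) : Prop where
  nonneg : ∀ w, 0 ≤ F w
  smooth : ContMDiffOn 𝓘(ℝ, E).tangent 𝓘(ℝ, ℝ) ∞ F (puncturedTangentBundle E M)
  eq_zero_iff : ∀ w, F w = 0 ↔ w.2 = 0
  homogeneous : ∀ (x : M) (y : TangentSpace 𝓘(ℝ, E) x) (c : ℝ), 0 ≤ c →
    F ⟨x, c • y⟩ = c * F ⟨x, y⟩
  posDef : ∀ w ∈ puncturedTangentBundle E M, ∀ u : TangentSpace 𝓘(ℝ, E) w.proj, u ≠ 0 →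
    0 < fundamentalTensor F w u u

/-- The pull-back `α_F` of the canonical 1-form of `T*M` by the Legendre transformation:
`(α_F)_w(X) = 𝓛_F(w)(dπ(w) X)`. -/
def alphaForm (F : TangentBundle 𝓘(ℝ, E) M → ℝ) (w : TangentBundle 𝓘(ℝ, E) M) :
    TangentSpace 𝓘(ℝ, E).tangent w →L[ℝ] ℝ :=
  (legendre F w).comp (dproj w)

/-- The 1-form `α` on `TM`, read in the preferred chart at `w`. -/
def formInChart (α : ∀ w : TangentBundle 𝓘(ℝ, E) M, TangentSpace 𝓘(ℝ, E).tangent w →L[ℝ] ℝ)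
    (w : TangentBundle 𝓘(ℝ, E) M) (p : E × E) : E × E →L[ℝ] ℝ :=
  (α ((extChartAt 𝓘(ℝ, E).tangent w).symm p)).comp
    (mfderiv 𝓘(ℝ, E × E) 𝓘(ℝ, E).tangent (extChartAt 𝓘(ℝ, E).tangent w).symm p)

/-- The exterior derivative `(dα)_w(X, Y)` of a 1-form on `TM`, computed in the preferred chart at
`w` by `dα(X, Y) = (D_X α)(Y) - (D_Y α)(X)`. -/
def extDerivForm (α : ∀ w : TangentBundle 𝓘(ℝ, E) M, TangentSpace 𝓘(ℝ, E).tangent w →L[ℝ] ℝ)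
    (w : TangentBundle 𝓘(ℝ, E) M) (X Y : TangentSpace 𝓘(ℝ, E).tangent w) : ℝ :=
  let φ := extChartAt 𝓘(ℝ, E).tangent w
  let X' : E × E := mfderiv 𝓘(ℝ, E).tangent 𝓘(ℝ, E × E) φ w X
  let Y' : E × E := mfderiv 𝓘(ℝ, E).tangent 𝓘(ℝ, E × E) φ w Y
  fderiv ℝ (formInChart α w) (φ w) X' Y' - fderiv ℝ (formInChart α w) (φ w) Y' X'

/-- The symplectic form `ω_F = -dα_F` on `TM \ 0`. -/
def omegaForm (F : TangentBundle 𝓘(ℝ, E) M → ℝ) (w : TangentBundle 𝓘(ℝ, E) M)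
    (X Y : TangentSpace 𝓘(ℝ, E).tangent w) : ℝ :=
  -extDerivForm (alphaForm F) w X Y

/-- The geodesic spray `S_F` of `F` on `TM \ 0`: the Hamiltonian vector field of `(1/2) F²` with
respect to `ω_F`, that is, the vector field with `ω_F(S_F, ·) = (1/2) dF²`. Its values on the zero
section are irrelevant. -/
def geodesicSpray (F : TangentBundle 𝓘(ℝ, E) M → ℝ) (w : TangentBundle 𝓘(ℝ, E) M) :
    TangentSpace 𝓘(ℝ, E).tangent w :=
  Classical.epsilon fun X => ∀ Y : TangentSpace 𝓘(ℝ, E).tangent w,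
    omegaForm F w X Y = mfderiv 𝓘(ℝ, E).tangent 𝓘(ℝ, ℝ) (energy F) w Y

end Finsler

section Flow

variable {E : Type*} [NormedAddCommGroup E] [NormedSpace ℝ E]
  {M : Type*} [TopologicalSpace M] [ChartedSpace E M] [IsManifold 𝓘(ℝ, E) ∞ M]

/-- `Φ` is a smooth local flow, near `v`, of the vector field `S` on `TM \ 0`. The values of `Φ`
outside of `(-ε, ε) × U` are irrelevant. -/
def IsLocalFlowNear (S : ∀ w : TangentBundle 𝓘(ℝ, E) M, TangentSpace 𝓘(ℝ, E).tangent w)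
    (v : TangentBundle 𝓘(ℝ, E) M)
    (Φ : ℝ → TangentBundle 𝓘(ℝ, E) M → TangentBundle 𝓘(ℝ, E) M) : Prop :=
  ∃ ε : ℝ, 0 < ε ∧ ∃ U : Set (TangentBundle 𝓘(ℝ, E) M), IsOpen U ∧ v ∈ U ∧
    ContMDiffOn (𝓘(ℝ, ℝ).prod 𝓘(ℝ, E).tangent) 𝓘(ℝ, E).tangent ∞
      (fun p : ℝ × TangentBundle 𝓘(ℝ, E) M => Φ p.1 p.2) (Ioo (-ε) ε ×ˢ U) ∧
    ∀ w ∈ U, Φ 0 w = w ∧ (∀ t ∈ Ioo (-ε) ε, Φ t w ∈ puncturedTangentBundle E M) ∧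
      IsMIntegralCurveOn (fun t => Φ t w) S (Ioo (-ε) ε)

/-- The Jacobi curve `ℓ_v(t) = (Φ_t^* 𝒱TM)(v) = dΦ_t(v)⁻¹ (𝒱_{Φ_t(v)} TM)` of the vertical
distribution, a curve of subspaces of `T_v TM` (in Mathlib `T_v TM` is the model space `E × E`). -/
def jacobiCurve (Φ : ℝ → TangentBundle 𝓘(ℝ, E) M → TangentBundle 𝓘(ℝ, E) M)
    (v : TangentBundle 𝓘(ℝ, E) M) (t : ℝ) : Submodule ℝ (E × E) :=
  Submodule.comap
    (mfderiv 𝓘(ℝ, E).tangent 𝓘(ℝ, E).tangent (Φ t) v).toLinearMap (verticalSpace (Φ t v))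

end Flow

section Connections

variable {E : Type*} [NormedAddCommGroup E] [NormedSpace ℝ E]
  {M : Type*} [TopologicalSpace M] [ChartedSpace E M] [IsManifold 𝓘(ℝ, E) ∞ M]

/-- The Lie derivative `[S, 𝒥](X) = [S, 𝒥 X] - 𝒥 [S, X]` at `w` of the almost-tangent structure,
computed with a local extension of `X ∈ T_w TM` to a smooth vector field. -/
def lieAlmostTangent (S : ∀ w : TangentBundle 𝓘(ℝ, E) M, TangentSpace 𝓘(ℝ, E).tangent w)
    (w : TangentBundle 𝓘(ℝ, E) M) (X : TangentSpace 𝓘(ℝ, E).tangent w) :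
    TangentSpace 𝓘(ℝ, E).tangent w :=
  VectorField.mlieBracket 𝓘(ℝ, E).tangent S
      (fun w' => almostTangent w' (FiberBundle.extend (E × E) X w')) w
    - almostTangent w
        (VectorField.mlieBracket 𝓘(ℝ, E).tangent S (FiberBundle.extend (E × E) X) w)

/-- The canonical connection `Γ_S = -[S, 𝒥]` of the spray `S`. -/
def canonicalConnection (S : ∀ w : TangentBundle 𝓘(ℝ, E) M, TangentSpace 𝓘(ℝ, E).tangent w)
    (w : TangentBundle 𝓘(ℝ, E) M) (X : TangentSpace 𝓘(ℝ, E).tangent w) :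
    TangentSpace 𝓘(ℝ, E).tangent w :=
  -lieAlmostTangent S w X

/-- The projection `P_𝒱` onto the vertical space (the `(-1)`-eigenspace of `Γ_S`) along the
horizontal space (the `1`-eigenspace of `Γ_S`). -/
def verticalProjection (S : ∀ w : TangentBundle 𝓘(ℝ, E) M, TangentSpace 𝓘(ℝ, E).tangent w)
    (w : TangentBundle 𝓘(ℝ, E) M) (X : TangentSpace 𝓘(ℝ, E).tangent w) :
    TangentSpace 𝓘(ℝ, E).tangent w :=
  (1 / 2 : ℝ) • (X - canonicalConnection S w X)

/-- The horizontal lift `u^𝔥` of `u` at `w`: the vector `X` in the horizontal space at `w` (the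
`1`-eigenspace of `Γ_S`) with `dπ(w) X = u`. -/
def horizontalLift (S : ∀ w : TangentBundle 𝓘(ℝ, E) M, TangentSpace 𝓘(ℝ, E).tangent w)
    (w : TangentBundle 𝓘(ℝ, E) M) (u : TangentSpace 𝓘(ℝ, E) w.proj) :
    TangentSpace 𝓘(ℝ, E).tangent w :=
  Classical.epsilon fun X => canonicalConnection S w X = X ∧ dproj w X = u

/-- The projection `π : TM → M` as a continuous map. -/
def projMap (E M : Type*) [NormedAddCommGroup E] [NormedSpace ℝ E]
    [TopologicalSpace M] [ChartedSpace E M] [IsManifold 𝓘(ℝ, E) ∞ M] :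
    C(TangentBundle 𝓘(ℝ, E) M, M) :=
  ⟨TotalSpace.proj, FiberBundle.continuous_proj E (TangentSpace 𝓘(ℝ, E) : M → Type _)⟩

/-- The vertical tangent bundle `𝒱TM → TM`, identified with the pull-back bundle `π^*TM` by means of
the vertical lifts `i_w : T_{π(w)} M → 𝒱_w TM`. -/
def VerticalBundle (E M : Type*) [NormedAddCommGroup E] [NormedSpace ℝ E]
    [TopologicalSpace M] [ChartedSpace E M] [IsManifold 𝓘(ℝ, E) ∞ M] :
    TangentBundle 𝓘(ℝ, E) M → Type _ :=
  (projMap E M : TangentBundle 𝓘(ℝ, E) M → M) *ᵖ (TangentSpace 𝓘(ℝ, E) : M → Type _)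

instance (w : TangentBundle 𝓘(ℝ, E) M) : AddCommGroup (VerticalBundle E M w) :=
  inferInstanceAs (AddCommGroup (TangentSpace 𝓘(ℝ, E) w.proj))

instance (w : TangentBundle 𝓘(ℝ, E) M) : Module ℝ (VerticalBundle E M w) :=
  inferInstanceAs (Module ℝ (TangentSpace 𝓘(ℝ, E) w.proj))

instance (w : TangentBundle 𝓘(ℝ, E) M) : TopologicalSpace (VerticalBundle E M w) :=
  inferInstanceAs (TopologicalSpace (TangentSpace 𝓘(ℝ, E) w.proj))

instance (w : TangentBundle 𝓘(ℝ, E) M) : IsTopologicalAddGroup (VerticalBundle E M w) :=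
  inferInstanceAs (IsTopologicalAddGroup (TangentSpace 𝓘(ℝ, E) w.proj))

instance (w : TangentBundle 𝓘(ℝ, E) M) : ContinuousSMul ℝ (VerticalBundle E M w) :=
  inferInstanceAs (ContinuousSMul ℝ (TangentSpace 𝓘(ℝ, E) w.proj))

instance : TopologicalSpace (TotalSpace E (VerticalBundle E M)) :=
  inferInstanceAs (TopologicalSpace (TotalSpace E
    ((projMap E M : TangentBundle 𝓘(ℝ, E) M → M) *ᵖ (TangentSpace 𝓘(ℝ, E) : M → Type _))))

instance : FiberBundle E (VerticalBundle E M) :=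
  inferInstanceAs (FiberBundle E
    ((projMap E M : TangentBundle 𝓘(ℝ, E) M → M) *ᵖ (TangentSpace 𝓘(ℝ, E) : M → Type _)))

instance : VectorBundle ℝ E (VerticalBundle E M) :=
  inferInstanceAs (VectorBundle ℝ E
    ((projMap E M : TangentBundle 𝓘(ℝ, E) M → M) *ᵖ (TangentSpace 𝓘(ℝ, E) : M → Type _)))

/-- The canonical vertical vector field `C_w = i_w(w)`, as a section of `π^*TM`. -/
def canonicalField (w : TangentBundle 𝓘(ℝ, E) M) : VerticalBundle E M w := w.2

/-- The section of the vertical bundle given by `𝒥(X)`, for a vector field `X` on `TM`. Since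
`𝒥(X) = i(dπ(X))`, as a section of `π^*TM` it is `dπ(X)`. -/
def almostTangentField (X : ∀ w : TangentBundle 𝓘(ℝ, E) M, TangentSpace 𝓘(ℝ, E).tangent w)
    (w : TangentBundle 𝓘(ℝ, E) M) : VerticalBundle E M w := dproj w (X w)

/-- `D` is a smooth linear connection on the restriction to `TM \ 0` of the vertical bundle
(`D Z w X` is `(∇_X Z)(w)`), satisfying, for the spray `S`,
* `lift`: `∇_X C = P_𝒱(X)`;
* `torsion`: `T(S, X) = ∇_S 𝒥(X) - ∇_X 𝒥(S) - 𝒥([S, X]) = 0`. -/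
structure IsSprayConnection
    (S : ∀ w : TangentBundle 𝓘(ℝ, E) M, TangentSpace 𝓘(ℝ, E).tangent w)
    (D : (∀ w : TangentBundle 𝓘(ℝ, E) M, VerticalBundle E M w) →
      ∀ w : TangentBundle 𝓘(ℝ, E) M,
        TangentSpace 𝓘(ℝ, E).tangent w →L[ℝ] VerticalBundle E M w) : Prop where
  isCovariantDerivativeOn :
    IsCovariantDerivativeOn (I := 𝓘(ℝ, E).tangent) E D (puncturedTangentBundle E M)
  smooth : ∀ U : Set (TangentBundle 𝓘(ℝ, E) M), IsOpen U → U ⊆ puncturedTangentBundle E M →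
    ContMDiffCovariantDerivativeOn (I := 𝓘(ℝ, E).tangent) E ∞ D U
  lift : ∀ w ∈ puncturedTangentBundle E M, ∀ X : TangentSpace 𝓘(ℝ, E).tangent w,
    verticalLift w (D canonicalField w X) = verticalProjection S w X
  torsion : ∀ X : (∀ w : TangentBundle 𝓘(ℝ, E) M, TangentSpace 𝓘(ℝ, E).tangent w),
    ContMDiffOn 𝓘(ℝ, E).tangent 𝓘(ℝ, E).tangent.tangent ∞
      (fun w => (⟨w, X w⟩ : TangentBundle 𝓘(ℝ, E).tangent (TangentBundle 𝓘(ℝ, E) M)))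
      (puncturedTangentBundle E M) →
    ∀ w ∈ puncturedTangentBundle E M,
      D (almostTangentField X) w (S w) - D (almostTangentField S) w (X w)
        - almostTangentField (VectorField.mlieBracket 𝓘(ℝ, E).tangent S X) w = 0

/-- The curvature `ℛ(X, Y)Z = ∇_{[X, Y]} Z - [∇_X, ∇_Y] Z` of `D` at `w`, for vector fields `X`, `Y`
on `TM` and a section `Z` of the vertical bundle. -/
def connectionCurvature
    (D : (∀ w : TangentBundle 𝓘(ℝ, E) M, VerticalBundle E M w) →
      ∀ w : TangentBundle 𝓘(ℝ, E) M,
        TangentSpace 𝓘(ℝ, E).tangent w →L[ℝ] VerticalBundle E M w)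
    (X Y : ∀ w : TangentBundle 𝓘(ℝ, E) M, TangentSpace 𝓘(ℝ, E).tangent w)
    (Z : ∀ w : TangentBundle 𝓘(ℝ, E) M, VerticalBundle E M w)
    (w : TangentBundle 𝓘(ℝ, E) M) : VerticalBundle E M w :=
  D Z w (VectorField.mlieBracket 𝓘(ℝ, E).tangent X Y w)
    - (D (fun w' => D Z w' (Y w')) w (X w) - D (fun w' => D Z w' (X w')) w (Y w))

/-- The curvature endomorphism `𝐑_w(u) = R_w(w, u)w`, where `R_w(u₁, u₂)z = ℛ(u₁^𝔥, u₂^𝔥)z^𝔳`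
with the horizontal and vertical lifts at `w`. The tensor `ℛ` is computed with local extensions of
these vectors to smooth fields. -/
def curvatureEndomorphism
    (S : ∀ w : TangentBundle 𝓘(ℝ, E) M, TangentSpace 𝓘(ℝ, E).tangent w)
    (D : (∀ w : TangentBundle 𝓘(ℝ, E) M, VerticalBundle E M w) →
      ∀ w : TangentBundle 𝓘(ℝ, E) M,
        TangentSpace 𝓘(ℝ, E).tangent w →L[ℝ] VerticalBundle E M w)
    (w : TangentBundle 𝓘(ℝ, E) M) (u : TangentSpace 𝓘(ℝ, E) w.proj) :
    TangentSpace 𝓘(ℝ, E) w.proj :=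
  connectionCurvature D
    (FiberBundle.extend (E × E) (horizontalLift S w w.2))
    (FiberBundle.extend (E × E) (horizontalLift S w u))
    (FiberBundle.extend E (canonicalField w)) w

/-- The flag curvature `K_F(w, Π)`, where `u` is any vector with `Π = span[w, u]`:
`K_F(w, Π) = g_F(w)(𝐑_w(u), u) / (g_F(w)(w, w) g_F(w)(u, u) - g_F(w)(w, u)²)`. -/
def flagCurvature (F : TangentBundle 𝓘(ℝ, E) M → ℝ)
    (D : (∀ w : TangentBundle 𝓘(ℝ, E) M, VerticalBundle E M w) →
      ∀ w : TangentBundle 𝓘(ℝ, E) M,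
        TangentSpace 𝓘(ℝ, E).tangent w →L[ℝ] VerticalBundle E M w)
    (w : TangentBundle 𝓘(ℝ, E) M) (P : Submodule ℝ (TangentSpace 𝓘(ℝ, E) w.proj)) : ℝ :=
  let u : TangentSpace 𝓘(ℝ, E) w.proj :=
    Classical.epsilon fun u => P = Submodule.span ℝ {w.2, u}
  fundamentalTensor F w (curvatureEndomorphism (geodesicSpray F) D w u) u /
    (fundamentalTensor F w w.2 w.2 * fundamentalTensor F w u u
      - fundamentalTensor F w w.2 u ^ 2)

end Connections

end FinslerJacobi

end

noncomputable section

namespace FinslerJacobi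

/-! In the preferred chart of `TM` at `v`, both sides of the formula reduce to one endomorphism R of
`E` and one inner product g.

The energy becomes a function L(x, y), positively 2-homogeneous in y, with g = ∂²L/∂y² positive
definite (`isCoordEnergy`). Since g is invertible, ω(S, ·) = dL has exactly one solution, and it has
the form S = (y, f(x, y)) (`coordOmega_eq_iff`); f inherits the 2-homogeneity of L. The endomorphism
is R(u) = ½ D²f(S, (0, u)) − ∂ₓf u − ¼ ∂ᵧf ∂ᵧf u (`coordCurvature`).

Jacobi curve. Let M(t) be the differential of the flow read in the chart. Then Ṁ = A M with A = DS
along the orbit, and ℓ(t) = M(t)⁻¹(0 × E). A section b of ℓ satisfies (M ḃ)₁ = −(M b)₂. This single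
relation gives fanning, the identity 𝐅 = −M⁻¹ J M with J(ξ, η) = (0, ξ), and the equality of the
Wronskian at 0 with g on vertical vectors (`wronskian_eq`). Differentiating 𝐅 twice at t = 0, where
M = id, expresses 𝐅̈(0) through A(0) and Ȧ(0), and ¼ 𝐅̈(0)² sends (0, e) to (0, R(e))
(`jacobiEndomorphism_apply`).

Connection. In the chart ∇ is D + Γ(p, z, X), linear in z. The condition ∇C = P_𝒱 prescribes Γ on
the section z = y alone: Γ(p, y, X) = −½ ∂ᵧf X₁. That is enough. Differentiating this identity along
Y trades the derivative of Γ at z = y for the unknown value Γ(p, Y₂, X), and on horizontal vectors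
these unknown values cancel against the quadratic terms of the curvature. What is left involves
second derivatives of f only, and Euler's relations for f turn it into R
(`curvatureEndomorphism_eq`).

Flag. Homogeneity gives R(y) = 0, and constancy of the energy in horizontal directions gives g(R(u),
y) = 0. Hence the quotient defining K_F depends on the plane alone, and for u orthogonal to v its
denominator is F(v)² g(u, u) (`flagCurvature_eq`). -/

lemma minSmoothness_two_le_infty : minSmoothness ℝ 2 ≤ (∞ : ℕ∞ω) := by
  simpa using WithTop.coe_le_coe.2 (le_top (a := (2 : ℕ∞)))

/-! ### Homogeneous Lagrangians on an open subset of `E × E` and their sprays. -/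

section CoordinateEnergy

variable {E : Type*} [NormedAddCommGroup E] [NormedSpace ℝ E]

/-- The almost-tangent structure `(ξ, η) ↦ (0, ξ)` of `E × E`. -/
def coordTangent (E : Type*) [NormedAddCommGroup E] [NormedSpace ℝ E] : E × E →L[ℝ] E × E :=
  (ContinuousLinearMap.inr ℝ E E).comp (ContinuousLinearMap.fst ℝ E E)

@[simp] lemma coordTangent_apply (X : E × E) : coordTangent E X = (0, X.1) := rfl

/-- `L` is, on the open subset `O` of `E × E`, the coordinate expression of the energy of a
Finsler metric. -/
structure IsCoordEnergy (O : Set (E × E)) (L : E × E → ℝ) : Prop where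
  isOpen : IsOpen O
  contDiffOn : ContDiffOn ℝ ∞ L O
  smul_mem : ∀ p ∈ O, ∀ c : ℝ, 0 < c → (p.1, c • p.2) ∈ O
  homogeneous : ∀ p ∈ O, ∀ c : ℝ, 0 < c → L (p.1, c • p.2) = c ^ 2 * L p
  posDef : ∀ p ∈ O, ∀ u : E, u ≠ 0 → 0 < fderiv ℝ (fderiv ℝ L) p (0, u) (0, u)

/-- The symplectic form `-d(∂_y L dx)`. -/
def coordOmega (L : E × E → ℝ) (p X Y : E × E) : ℝ :=
  fderiv ℝ (fderiv ℝ L) p Y (0, X.1) - fderiv ℝ (fderiv ℝ L) p X (0, Y.1)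

/-- The second fibre derivative of `L`. -/
def coordMetric (L : E × E → ℝ) (p : E × E) : E →L[ℝ] E →L[ℝ] ℝ :=
  ((ContinuousLinearMap.compL ℝ E (E × E) ℝ).flip (ContinuousLinearMap.inr ℝ E E)).comp
    ((fderiv ℝ (fderiv ℝ L) p).comp (ContinuousLinearMap.inr ℝ E E))

@[simp] lemma coordMetric_apply (L : E × E → ℝ) (p : E × E) (u e : E) :
    coordMetric L p u e = fderiv ℝ (fderiv ℝ L) p (0, u) (0, e) := rfl

/-- The second component of the geodesic spray of `L`. -/
def coordForce (L : E × E → ℝ) (p : E × E) : E :=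
  (coordMetric L p).inverse ((fderiv ℝ L p).comp (ContinuousLinearMap.inl ℝ E E)
    - (fderiv ℝ (fderiv ℝ L) p (p.2, 0)).comp (ContinuousLinearMap.inr ℝ E E))

/-- The Jacobi endomorphism of the spray `(x, y) ↦ (y, f (x, y))`. -/
def coordCurvature (f : E × E → E) (p : E × E) (u : E) : E :=
  (1 / 2 : ℝ) • fderiv ℝ (fderiv ℝ f) p (p.2, f p) (0, u) - fderiv ℝ f p (u, 0)
    - (1 / 4 : ℝ) • fderiv ℝ f p (0, fderiv ℝ f p (0, u))

namespace IsCoordEnergy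

variable {O : Set (E × E)} {L : E × E → ℝ} (h : IsCoordEnergy O L) {p : E × E} (hp : p ∈ O)
include h hp

lemma mem_nhds : O ∈ 𝓝 p := h.isOpen.mem_nhds hp

lemma contDiffAt : ContDiffAt ℝ ∞ L p := h.contDiffOn.contDiffAt (h.mem_nhds hp)

lemma contDiffAt_fderiv : ContDiffAt ℝ ∞ (fderiv ℝ L) p :=
  (h.contDiffAt hp).fderiv_right (by simp)

lemma contDiffAt_fderiv_fderiv : ContDiffAt ℝ ∞ (fderiv ℝ (fderiv ℝ L)) p :=
  (h.contDiffAt_fderiv hp).fderiv_right (by simp)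

lemma hasFDerivAt : HasFDerivAt L (fderiv ℝ L p) p :=
  ((h.contDiffAt hp).differentiableAt (by simp)).hasFDerivAt

lemma hasFDerivAt_fderiv : HasFDerivAt (fderiv ℝ L) (fderiv ℝ (fderiv ℝ L) p) p :=
  ((h.contDiffAt_fderiv hp).differentiableAt (by simp)).hasFDerivAt

lemma symm (X Y : E × E) :
    fderiv ℝ (fderiv ℝ L) p X Y = fderiv ℝ (fderiv ℝ L) p Y X :=
  ((h.contDiffAt hp).isSymmSndFDerivAt
    minSmoothness_two_le_infty).eq X Y

/-- Euler's relation for degree 2: differentiate the homogeneity of L in c at c = 1. -/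
lemma fderiv_vertical : fderiv ℝ L p (0, p.2) = 2 * L p := by
  have h1 : HasDerivAt (fun c : ℝ => L (p.1, c • p.2)) (fderiv ℝ L p (0, p.2)) 1 := by
    have hc : HasDerivAt (fun c : ℝ => (p.1, c • p.2)) ((0 : E), p.2) 1 := by
      simpa using (hasDerivAt_const (1 : ℝ) p.1).prodMk ((hasDerivAt_id (1 : ℝ)).smul_const p.2)
    have : HasFDerivAt L (fderiv ℝ L p) (p.1, (1 : ℝ) • p.2) := by
      simpa using h.hasFDerivAt hp
    exact this.comp_hasDerivAt 1 hc
  have h2 : HasDerivAt (fun c : ℝ => c ^ 2 * L p) (2 * L p) 1 := by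
    simpa using (hasDerivAt_pow 2 (1 : ℝ)).mul_const (L p)
  refine h1.unique (h2.congr_of_eventuallyEq ?_)
  filter_upwards [lt_mem_nhds one_pos] with c hc using h.homogeneous p hp c hc

/-- The derivative of Euler's relation; the correction term comes from the base vector (0, y) moving
with the point. -/
lemma fderiv_fderiv_vertical (X : E × E) :
    fderiv ℝ (fderiv ℝ L) p X (0, p.2) = 2 * fderiv ℝ L p X - fderiv ℝ L p (0, X.2) := by
  have h1 : HasFDerivAt (fun q : E × E => fderiv ℝ L q (0, q.2)) _ p :=
    (h.hasFDerivAt_fderiv hp).clm_apply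
      (((ContinuousLinearMap.inr ℝ E E).comp (ContinuousLinearMap.snd ℝ E E)).hasFDerivAt)
  have h2 := (h.hasFDerivAt hp).const_mul (2 : ℝ)
  have h3 := (h1.congr_of_eventuallyEq (f₁ := fun q => 2 * L q) ?_).unique h2
  · have := congrArg (fun T : E × E →L[ℝ] ℝ => T X) h3
    simp at this
    linarith
  · filter_upwards [h.mem_nhds hp] with q hq using (h.fderiv_vertical hq).symm

lemma fderiv_vertical_eq (u : E) :
    fderiv ℝ L p (0, u) = fderiv ℝ (fderiv ℝ L) p (0, p.2) (0, u) := by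
  have := h.fderiv_fderiv_vertical hp (0, u)
  rw [h.symm hp]; simp at this; linarith

lemma coordMetric_injective : Function.Injective (coordMetric L p) := by
  rw [injective_iff_map_eq_zero]
  intro u hu
  by_contra hne
  have := h.posDef p hp u hne
  rw [← coordMetric_apply, hu] at this
  simp at this

variable [FiniteDimensional ℝ E]

lemma exists_coordMetric_equiv : ∃ e : E ≃L[ℝ] (E →L[ℝ] ℝ), (e : E →L[ℝ] E →L[ℝ] ℝ) =
    coordMetric L p := by
  have hd : Module.finrank ℝ E = Module.finrank ℝ (E →L[ℝ] ℝ) := by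
    rw [← (LinearMap.toContinuousLinearMap (𝕜 := ℝ) (E := E) (F' := ℝ)).finrank_eq]
    exact (Subspace.dual_finrank_eq (K := ℝ) (V := E)).symm
  refine ⟨(LinearEquiv.ofInjectiveOfFinrankEq (coordMetric L p).toLinearMap
    (h.coordMetric_injective hp) hd).toContinuousLinearEquiv, ?_⟩
  ext; rfl

/-- The Euler–Lagrange equation d/dt(∂ᵧL) = ∂ₓL along the spray, tested on u. Positive definiteness
makes `coordMetric` invertible, so that `inverse` in `coordForce` is a true inverse. -/
lemma coordForce_spec (u : E) :
    fderiv ℝ (fderiv ℝ L) p (p.2, coordForce L p) (0, u) = fderiv ℝ L p (u, 0) := by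
  obtain ⟨e, he⟩ := h.exists_coordMetric_equiv hp
  have h1 : coordMetric L p (coordForce L p) =
      (fderiv ℝ L p).comp (ContinuousLinearMap.inl ℝ E E)
      - (fderiv ℝ (fderiv ℝ L) p (p.2, 0)).comp (ContinuousLinearMap.inr ℝ E E) := by
    rw [coordForce, ← he, ContinuousLinearMap.inverse_equiv]
    simp
  have h2 := congrArg (fun T : E →L[ℝ] ℝ => T u) h1
  simp only [coordMetric_apply, sub_apply, ContinuousLinearMap.comp_apply,
    ContinuousLinearMap.inl_apply, ContinuousLinearMap.inr_apply] at h2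
  have h3 : ((p.2, coordForce L p) : E × E) = (p.2, 0) + (0, coordForce L p) := by simp
  rw [h3, map_add, add_apply, h2]
  ring

lemma eq_coordForce {e : E}
    (he : ∀ u, fderiv ℝ (fderiv ℝ L) p (p.2, e) (0, u) = fderiv ℝ L p (u, 0)) :
    e = coordForce L p := by
  apply h.coordMetric_injective hp
  ext u
  have h1 := (he u).trans (h.coordForce_spec hp u).symm
  have h3 : ∀ e : E, ((p.2, e) : E × E) = (p.2, 0) + (0, e) := by simp
  rw [h3 e, h3 (coordForce L p), map_add, map_add] at h1
  simpa using h1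

/-- Testing on (0, u) forces the second order condition X₁ = y, and testing on (u, 0) then gives the
Euler–Lagrange equation. Existence together with uniqueness is what identifies the vector chosen in
`geodesicSpray`. -/
lemma coordOmega_eq_iff {X : E × E} :
    (∀ Y, coordOmega L p X Y = fderiv ℝ L p Y) ↔ X = (p.2, coordForce L p) := by
  constructor
  · intro hX
    have h1 : X.1 = p.2 := by
      apply h.coordMetric_injective hp
      ext u
      have := hX (0, u)
      have h0 : ((0 : E), (0 : E)) = 0 := rfl
      simp only [coordOmega, h0, map_zero, sub_zero] at this
      rw [coordMetric_apply, coordMetric_apply, h.symm hp, this, h.fderiv_vertical_eq hp]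
    have h2 : X.2 = coordForce L p := by
      refine h.eq_coordForce hp fun u => ?_
      have := hX (u, 0)
      simp only [coordOmega, h1] at this
      rw [h.fderiv_fderiv_vertical hp] at this
      have h0 : ((0 : E), (0 : E)) = 0 := rfl
      rw [← h1]
      simp only [h0, map_zero, sub_zero] at this
      change fderiv ℝ (fderiv ℝ L) p X (0, u) = _
      linarith
    exact Prod.ext h1 h2
  · rintro rfl Y
    have h3 : Y = (Y.1, 0) + (0, Y.2) := by simp
    simp only [coordOmega]
    rw [h.fderiv_fderiv_vertical hp, h.coordForce_spec hp]
    have := congrArg (fderiv ℝ L p) h3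
    rw [map_add] at this
    linarith

lemma contDiffAt_coordForce : ContDiffAt ℝ ∞ (coordForce L) p := by
  obtain ⟨e, he⟩ := h.exists_coordMetric_equiv hp
  have h1 := h.contDiffAt_fderiv hp
  have h2 := h.contDiffAt_fderiv_fderiv hp
  have hG : ContDiffAt ℝ ∞ (coordMetric L) p := by
    unfold coordMetric
    exact contDiffAt_const.clm_comp (h2.clm_comp contDiffAt_const)
  have hi : ContDiffAt ℝ ∞ (fun q => (coordMetric L q).inverse) p := by
    have : ContDiffAt ℝ ∞ ContinuousLinearMap.inverse (coordMetric L p) := by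
      rw [← he]; exact contDiffAt_map_inverse e
    exact this.comp p hG
  unfold coordForce
  refine hi.clm_apply (ContDiffAt.sub (h1.clm_comp contDiffAt_const) ?_)
  exact (h2.clm_apply (contDiffAt_snd.prodMk contDiffAt_const)).clm_comp contDiffAt_const

omit [FiniteDimensional ℝ E] in
lemma fderiv_smul {c : ℝ} (hc : 0 < c) (X : E × E) :
    fderiv ℝ L (p.1, c • p.2) (X.1, c • X.2) = c ^ 2 * fderiv ℝ L p X := by
  have hσ : HasFDerivAt (fun q : E × E => (q.1, c • q.2)) _ p :=
    ((ContinuousLinearMap.fst ℝ E E).prod (c • ContinuousLinearMap.snd ℝ E E)).hasFDerivAt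
  have h1 := (h.hasFDerivAt (h.smul_mem p hp c hc)).comp p hσ
  have h2 := (h.hasFDerivAt hp).const_mul (c ^ 2)
  have h3 := (h1.congr_of_eventuallyEq (f₁ := fun q => c ^ 2 * L q) ?_).unique h2
  · simpa using congrArg (fun T : E × E →L[ℝ] ℝ => T X) h3
  · filter_upwards [h.mem_nhds hp] with q hq using (h.homogeneous q hq c hc).symm

omit [FiniteDimensional ℝ E] in
lemma fderiv_fderiv_smul {c : ℝ} (hc : 0 < c) (X Y : E × E) :
    fderiv ℝ (fderiv ℝ L) (p.1, c • p.2) (X.1, c • X.2) (Y.1, c • Y.2) =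
      c ^ 2 * fderiv ℝ (fderiv ℝ L) p X Y := by
  have hσ : HasFDerivAt (fun q : E × E => (q.1, c • q.2)) _ p :=
    ((ContinuousLinearMap.fst ℝ E E).prod (c • ContinuousLinearMap.snd ℝ E E)).hasFDerivAt
  have h1 := ((h.hasFDerivAt_fderiv (h.smul_mem p hp c hc)).comp p hσ).clm_apply
    (hasFDerivAt_const ((Y.1, c • Y.2) : E × E) p)
  have h2 := ((h.hasFDerivAt_fderiv hp).clm_apply (hasFDerivAt_const Y p)).const_mul (c ^ 2)
  have h3 := (h1.congr_of_eventuallyEq (f₁ := fun q => c ^ 2 * fderiv ℝ L q Y) ?_).unique h2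
  · simpa using congrArg (fun T : E × E →L[ℝ] ℝ => T X) h3
  · filter_upwards [h.mem_nhds hp] with q hq using (h.fderiv_smul hq hc Y).symm

/-- Both sides solve the same Euler–Lagrange equation at (x, c y), whose solution is unique.
Rescaling the fibre multiplies the terms of the equation by powers of c. -/
lemma coordForce_smul {c : ℝ} (hc : 0 < c) :
    coordForce L (p.1, c • p.2) = c ^ 2 • coordForce L p := by
  refine (h.eq_coordForce (h.smul_mem p hp c hc) fun u => ?_).symm
  -- The field c • (y, f) becomes (c y, c² f) after fibre rescaling, the candidate spray at (x, c
  -- y); c⁻¹ • u compensates the rescaling of the test vector.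
  have h1 := h.fderiv_fderiv_smul hp hc (c • (p.2, coordForce L p)) (0, c⁻¹ • u)
  have h2 := h.fderiv_smul hp hc (u, 0)
  have h3 := h.coordForce_spec hp (c⁻¹ • u)
  have h4 : ((c⁻¹ • u, 0) : E × E) = c⁻¹ • (u, 0) := by simp
  rw [h4, map_smul] at h3
  rw [map_smul, smul_apply, h3] at h1
  simp only [Prod.smul_fst, Prod.smul_snd, smul_smul, mul_inv_cancel₀ hc.ne', one_smul,
    smul_zero, smul_eq_mul, ← pow_two] at h1 h2
  rw [h1, h2]
  field_simp

lemma differentiableAt_coordForce : DifferentiableAt ℝ (coordForce L) p :=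
  (h.contDiffAt_coordForce hp).differentiableAt (by simp)

lemma hasFDerivAt_coordForce : HasFDerivAt (coordForce L) (fderiv ℝ (coordForce L) p) p :=
  (h.differentiableAt_coordForce hp).hasFDerivAt

lemma hasFDerivAt_fderiv_coordForce :
    HasFDerivAt (fderiv ℝ (coordForce L)) (fderiv ℝ (fderiv ℝ (coordForce L)) p) p :=
  (((h.contDiffAt_coordForce hp).fderiv_right (m := 1)
    (by exact WithTop.coe_le_coe.2 le_top)).differentiableAt (by simp)).hasFDerivAt

lemma fderiv_coordForce_vertical :
    fderiv ℝ (coordForce L) p (0, p.2) = (2 : ℝ) • coordForce L p := by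
  have h1 : HasDerivAt (fun c : ℝ => coordForce L (p.1, c • p.2))
      (fderiv ℝ (coordForce L) p (0, p.2)) 1 := by
    have hc : HasDerivAt (fun c : ℝ => (p.1, c • p.2)) ((0 : E), p.2) 1 := by
      simpa using (hasDerivAt_const (1 : ℝ) p.1).prodMk ((hasDerivAt_id (1 : ℝ)).smul_const p.2)
    have : HasFDerivAt (coordForce L) (fderiv ℝ (coordForce L) p) (p.1, (1 : ℝ) • p.2) := by
      simpa using h.hasFDerivAt_coordForce hp
    exact this.comp_hasDerivAt 1 hc
  have h2 : HasDerivAt (fun c : ℝ => c ^ 2 • coordForce L p) ((2 : ℝ) • coordForce L p) 1 := by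
    simpa using (hasDerivAt_pow 2 (1 : ℝ)).smul_const (coordForce L p)
  refine h1.unique (h2.congr_of_eventuallyEq ?_)
  filter_upwards [lt_mem_nhds one_pos] with c hc using h.coordForce_smul hp hc

lemma fderiv_fderiv_coordForce_vertical (X : E × E) :
    fderiv ℝ (fderiv ℝ (coordForce L)) p X (0, p.2) =
      (2 : ℝ) • fderiv ℝ (coordForce L) p X - fderiv ℝ (coordForce L) p (0, X.2) := by
  have h1 : HasFDerivAt (fun q : E × E => fderiv ℝ (coordForce L) q (0, q.2)) _ p :=
    (h.hasFDerivAt_fderiv_coordForce hp).clm_apply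
      (((ContinuousLinearMap.inr ℝ E E).comp (ContinuousLinearMap.snd ℝ E E)).hasFDerivAt)
  have h2 := (h.hasFDerivAt_coordForce hp).const_smul (2 : ℝ)
  have h3 := (h1.congr_of_eventuallyEq (f₁ := fun q => (2 : ℝ) • coordForce L q) ?_).unique h2
  · have := congrArg (fun T : E × E →L[ℝ] E => T X) h3
    simp at this
    exact eq_sub_of_add_eq' this
  · filter_upwards [h.mem_nhds hp] with q hq using (h.fderiv_coordForce_vertical hq).symm

/-- The energy is constant along the spray. -/
lemma fderiv_spray : fderiv ℝ L p (p.2, coordForce L p) = 0 := by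
  have h1 := h.coordForce_spec hp p.2
  rw [h.fderiv_fderiv_vertical hp] at h1
  have h3 : ((p.2, coordForce L p) : E × E) = (p.2, 0) + (0, coordForce L p) := by simp
  have h4 := congrArg (fderiv ℝ L p) h3
  rw [map_add] at h4
  simp only at h1
  linarith

/-- Differentiate dL(S) = 0 in the direction X, remembering that S = (y, f) also varies. -/
lemma fderiv_fderiv_spray (X : E × E) :
    fderiv ℝ (fderiv ℝ L) p X (p.2, coordForce L p) =
      - fderiv ℝ L p (X.2, fderiv ℝ (coordForce L) p X) := by
  have h1 : HasFDerivAt (fun q : E × E => fderiv ℝ L q (q.2, coordForce L q)) _ p :=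
    (h.hasFDerivAt_fderiv hp).clm_apply
      (((ContinuousLinearMap.snd ℝ E E).hasFDerivAt).prodMk (h.hasFDerivAt_coordForce hp))
  have h3 := (h1.congr_of_eventuallyEq (f₁ := fun _ => (0 : ℝ)) ?_).unique
    (hasFDerivAt_const (0 : ℝ) p)
  · have := congrArg (fun T : E × E →L[ℝ] ℝ => T X) h3
    simp at this
    linarith
  · filter_upwards [h.mem_nhds hp] with q hq using (h.fderiv_spray hq).symm

/-- The energy is constant along the horizontal vectors. -/
lemma fderiv_horizontal (u : E) :
    2 * fderiv ℝ L p (u, 0) + fderiv ℝ L p (0, fderiv ℝ (coordForce L) p (0, u)) = 0 := by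
  -- For the vertical direction (0, u), symmetry and the Euler–Lagrange equation evaluate the left
  -- side as ∂ₓL u. Up to the factor 2 the result is dL on the horizontal vector (u, ½ ∂ᵧf u).
  have h1 := h.fderiv_fderiv_spray hp (0, u)
  rw [h.symm hp, h.coordForce_spec hp] at h1
  have h3 : ((u, fderiv ℝ (coordForce L) p (0, u)) : E × E) =
    (u, 0) + (0, fderiv ℝ (coordForce L) p (0, u)) := by simp
  simp only [h3, map_add] at h1
  linarith

/-- Differentiating `fderiv_horizontal` along S produces exactly twice ∂ᵧL applied to R(u). As ∂ᵧL =
g(y, ·), this says that R(u) is g-orthogonal to y. -/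
lemma fderiv_coordCurvature (u : E) :
    fderiv ℝ L p (0, coordCurvature (coordForce L) p u) = 0 := by
  set f := coordForce L with hf
  have h1 : HasFDerivAt (fun q : E × E => 2 * fderiv ℝ L q (u, 0)) _ p :=
    ((h.hasFDerivAt_fderiv hp).clm_apply (hasFDerivAt_const ((u, 0) : E × E) p)).const_mul 2
  have h2 : HasFDerivAt (fun q : E × E => fderiv ℝ L q (0, fderiv ℝ f q (0, u))) _ p :=
    (h.hasFDerivAt_fderiv hp).clm_apply ((hasFDerivAt_const (0 : E) p).prodMk
      ((h.hasFDerivAt_fderiv_coordForce hp).clm_apply (hasFDerivAt_const ((0, u) : E × E) p)))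
  have h3 := ((h1.add h2).congr_of_eventuallyEq (f₁ := fun _ => (0 : ℝ)) ?_).unique
    (hasFDerivAt_const (0 : ℝ) p)
  · have h4 := congrArg (fun T : E × E →L[ℝ] ℝ => T (p.2, f p)) h3
    simp at h4
    have h5 := h.fderiv_fderiv_spray hp (u, 0)
    have h6 := h.coordForce_spec hp (fderiv ℝ f p (0, u))
    have h7 := h.fderiv_horizontal hp (fderiv ℝ f p (0, u))
    rw [← hf] at h5 h6 h7
    rw [h.symm hp, h5, h6] at h4
    have h8 : ((0, coordCurvature f p u) : E × E) =
        (1 / 2 : ℝ) • (0, fderiv ℝ (fderiv ℝ f) p (p.2, f p) (0, u)) - (0, fderiv ℝ f p (u, 0))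
        - (1 / 4 : ℝ) • (0, fderiv ℝ f p (0, fderiv ℝ f p (0, u))) := by
      simp [coordCurvature]
    rw [h8, map_sub, map_sub, map_smul, map_smul, smul_eq_mul, smul_eq_mul]
    simp only at h4
    linarith
  · filter_upwards [h.mem_nhds hp] with q hq using (h.fderiv_horizontal hq u).symm

/-- By Euler's relations for f, the first term of R(y) is ∂ₓf y + ½ ∂ᵧf f, the last is −½ ∂ᵧf f, and
the three terms cancel. -/
lemma coordCurvature_self : coordCurvature (coordForce L) p p.2 = 0 := by
  have h1 := h.fderiv_fderiv_coordForce_vertical hp (p.2, coordForce L p)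
  have h2 := h.fderiv_coordForce_vertical hp
  have h3 : ((p.2, coordForce L p) : E × E) = (p.2, 0) + (0, coordForce L p) := by simp
  have h4 := congrArg (fderiv ℝ (coordForce L) p) h3
  rw [map_add] at h4
  have h5 : ((0, (2 : ℝ) • coordForce L p) : E × E) = (2 : ℝ) • (0, coordForce L p) := by simp
  rw [coordCurvature, h1, h2, h4, h5, map_smul]
  module

/-- The curvature in the horizontal direction over `u`, in terms of second derivatives only. -/
lemma fderiv_fderiv_coordForce_horizontal (u : E) :
    (1 / 2 : ℝ) • fderiv ℝ (fderiv ℝ (coordForce L)) p (p.2, coordForce L p) (0, u)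
      - (1 / 2 : ℝ) • fderiv ℝ (fderiv ℝ (coordForce L)) p
        (u, (1 / 2 : ℝ) • fderiv ℝ (coordForce L) p (0, u)) (0, p.2)
      = coordCurvature (coordForce L) p u := by
  rw [h.fderiv_fderiv_coordForce_vertical hp, coordCurvature]
  have h3 : ((u, (1 / 2 : ℝ) • fderiv ℝ (coordForce L) p (0, u)) : E × E) =
    (u, 0) + (1 / 2 : ℝ) • (0, fderiv ℝ (coordForce L) p (0, u)) := by simp
  have h5 : ((0, (1 / 2 : ℝ) • fderiv ℝ (coordForce L) p (0, u)) : E × E) =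
    (1 / 2 : ℝ) • (0, fderiv ℝ (coordForce L) p (0, u)) := by simp
  rw [h3]
  simp only [h5, map_add, map_smul, Prod.snd_add, Prod.smul_snd, zero_add]
  module

end IsCoordEnergy

end CoordinateEnergy

/-! ### The linearized flow and the invariants of its curve of vertical spaces. -/

section LinearizedFlow

variable {E : Type*} [NormedAddCommGroup E] [NormedSpace ℝ E]

/-- `M` solves, on the open set `T` of times, the linearization `Ṁ = A M`, `M 0 = id`, of a second
order differential equation. -/
structure IsLinearizedFlow (T : Set ℝ) (M A : ℝ → E × E →L[ℝ] E × E) : Prop where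
  isOpen : IsOpen T
  zero_mem : 0 ∈ T
  contDiffOn : ContDiffOn ℝ ∞ M T
  apply_zero : M 0 = ContinuousLinearMap.id ℝ (E × E)
  hasDerivAt : ∀ t ∈ T, HasDerivAt M ((A t).comp (M t)) t
  isInvertible : ∀ t ∈ T, (M t).IsInvertible
  fst_apply : ∀ t ∈ T, ∀ X, (A t X).1 = X.2

namespace IsLinearizedFlow

variable {T : Set ℝ} {M A : ℝ → E × E →L[ℝ] E × E} (h : IsLinearizedFlow T M A)
  {ℓ : ℝ → Submodule ℝ (E × E)} {t : ℝ}
include h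

lemma mem_nhds (ht : t ∈ T) : T ∈ 𝓝 t := h.isOpen.mem_nhds ht

lemma inverse_comp (ht : t ∈ T) :
    (M t).inverse.comp (M t) = ContinuousLinearMap.id ℝ (E × E) := by
  obtain ⟨e, he⟩ := h.isInvertible t ht
  rw [← he, ContinuousLinearMap.inverse_equiv]; ext <;> simp

lemma comp_inverse (ht : t ∈ T) :
    (M t).comp (M t).inverse = ContinuousLinearMap.id ℝ (E × E) := by
  obtain ⟨e, he⟩ := h.isInvertible t ht
  rw [← he, ContinuousLinearMap.inverse_equiv]; ext <;> simp

lemma inverse_apply (ht : t ∈ T) (X : E × E) : (M t).inverse (M t X) = X :=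
  congrArg (fun B : E × E →L[ℝ] E × E => B X) (h.inverse_comp ht)

lemma apply_inverse (ht : t ∈ T) (X : E × E) : M t ((M t).inverse X) = X :=
  congrArg (fun B : E × E →L[ℝ] E × E => B X) (h.comp_inverse ht)

lemma inverse_zero : (M 0).inverse = ContinuousLinearMap.id ℝ (E × E) := by
  rw [h.apply_zero, ContinuousLinearMap.inverse_id]

/-- The derivative of a section of a curve of subspaces whose image under `M` is vertical. -/
lemma fst_deriv_of_section (hℓ : ∀ s ∈ T, ∀ X, X ∈ ℓ s ↔ (M s X).1 = 0) (ht : t ∈ T)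
    {a : ℝ → E × E} {a' : E × E} (ha : HasDerivAt a a' t) (hmem : ∀ᶠ s in 𝓝 t, a s ∈ ℓ s) :
    (M t a').1 = -(M t (a t)).2 := by
  have h1 := (ContinuousLinearMap.fst ℝ E E).hasFDerivAt.comp_hasDerivAt t
    ((h.hasDerivAt t ht).clm_apply ha)
  have h2 := (h1.congr_of_eventuallyEq (f₁ := fun _ => (0 : E)) ?_).unique
    (hasDerivAt_const t (0 : E))
  · simp only [ContinuousLinearMap.comp_apply, ContinuousLinearMap.coe_fst', Prod.fst_add,
      h.fst_apply t ht] at h2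
    exact eq_neg_of_add_eq_zero_right h2
  · filter_upwards [hmem, h.mem_nhds ht] with s hs hsT using ((hℓ s hsT _).1 hs).symm

lemma mem_inverse_vertical (hℓ : ∀ s ∈ T, ∀ X, X ∈ ℓ s ↔ (M s X).1 = 0) (ht : t ∈ T) (e : E) :
    (M t).inverse (0, e) ∈ ℓ t := by
  rw [hℓ t ht, h.apply_inverse ht]

/-- Holds for every section, not only for a chosen one, and so settles the arbitrary choices in
`wronskian` and `fundamentalEndomorphism`. -/
lemma deriv_section (hℓ : ∀ s ∈ T, ∀ X, X ∈ ℓ s ↔ (M s X).1 = 0) (ht : t ∈ T)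
    {a : ℝ → E × E} (ha : IsSectionNear ℓ t a) :
    (M t (deriv a t)).1 = -(M t (a t)).2 := by
  obtain ⟨J, hJ, htJ, haJ, hmem⟩ := ha
  refine h.fst_deriv_of_section hℓ ht ?_ (Filter.eventually_of_mem (hJ.mem_nhds htJ) hmem)
  exact ((haJ.contDiffAt (hJ.mem_nhds htJ)).differentiableAt (by simp)).hasDerivAt

variable [CompleteSpace E]

lemma contDiffAt_inverse (ht : t ∈ T) : ContDiffAt ℝ ∞ (fun s => (M s).inverse) t := by
  obtain ⟨e, he⟩ := h.isInvertible t ht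
  have : ContDiffAt ℝ ∞ ContinuousLinearMap.inverse (M t) := by
    rw [← he]; exact contDiffAt_map_inverse e
  exact this.comp t (h.contDiffOn.contDiffAt (h.mem_nhds ht))

/-- Differentiate M⁻¹ M = id and cancel M on the right. -/
lemma hasDerivAt_inverse (ht : t ∈ T) :
    HasDerivAt (fun s => (M s).inverse) (-((M t).inverse.comp (A t))) t := by
  have h1 := ((h.contDiffAt_inverse ht).differentiableAt (by simp)).hasDerivAt
  have h2 := h1.clm_comp (h.hasDerivAt t ht)
  have h3 := (h2.congr_of_eventuallyEq
    (f₁ := fun _ => ContinuousLinearMap.id ℝ (E × E)) ?_).unique (hasDerivAt_const t _)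
  · convert! h1 using 1
    have h4 := congrArg (fun B : E × E →L[ℝ] E × E => B.comp (M t).inverse) h3
    simp only [ContinuousLinearMap.add_comp, ContinuousLinearMap.comp_assoc, h.comp_inverse ht,
      ContinuousLinearMap.comp_id, ContinuousLinearMap.zero_comp] at h4
    exact (eq_neg_of_add_eq_zero_left h4).symm
  · filter_upwards [h.mem_nhds ht] with s hs using (h.inverse_comp hs).symm

lemma isSectionNear_inverse_vertical (hℓ : ∀ s ∈ T, ∀ X, X ∈ ℓ s ↔ (M s X).1 = 0) (ht : t ∈ T)
    (e : E) : IsSectionNear ℓ t (fun s => (M s).inverse (0, e)) :=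
  ⟨T, h.isOpen, ht, fun _ hs =>
    ((h.contDiffAt_inverse hs).clm_apply contDiffAt_const).contDiffWithinAt,
    fun _ hs => h.mem_inverse_vertical hℓ hs e⟩

/-- The Wronskian of the curve. -/
lemma wronskian_eq (hℓ : ∀ s ∈ T, ∀ X, X ∈ ℓ s ↔ (M s X).1 = 0) {Ω : E × E → E × E → ℝ}
    {x : E × E} {c : E → ℝ} (hΩ : ∀ Y, Ω x Y = c Y.1) (e : E) :
    wronskian Ω ℓ 0 x (0, e) = c (-e) := by
  have hex : ∃ b : ℝ → E × E, IsSectionNear ℓ 0 b ∧ b 0 = (0, e) :=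
    ⟨_, h.isSectionNear_inverse_vertical hℓ h.zero_mem e, by simp [h.inverse_zero]⟩
  obtain ⟨h1, h2⟩ := Classical.epsilon_spec hex
  have h3 := h.deriv_section hℓ h.zero_mem h1
  rw [h2, h.apply_zero] at h3
  -- The form sees only the first component of ḃ(0), which is −e whatever section b was chosen.
  rw [wronskian, hΩ]
  exact congrArg c h3

/-- Pull a constant basis of the vertical space back by M. Fanning amounts to a block-triangular
independence check after applying M. -/
lemma exists_fanningFrame [FiniteDimensional ℝ E] (hℓ : ∀ s ∈ T, ∀ X, X ∈ ℓ s ↔ (M s X).1 = 0)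
    (ht : t ∈ T) : ∃ (n : ℕ) (a : Fin n → ℝ → E × E), IsFrameNear ℓ t a ∧
      IsFanningFrameAt t a := by
  set b := Module.finBasis ℝ E with hb
  have hinj : ∀ s ∈ T, Function.Injective (M s).inverse := fun s hs X Y hXY => by
    rw [← h.apply_inverse hs X, hXY, h.apply_inverse hs]
  have hlin : LinearIndependent ℝ fun i => ((0, b i) : E × E) :=
    b.linearIndependent.map' (LinearMap.inr ℝ E E) (LinearMap.ker_eq_bot.2 LinearMap.inr_injective)
  refine ⟨_, fun i s => (M s).inverse (0, b i), ⟨T, h.isOpen, ht, fun i s hs =>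
    ((h.contDiffAt_inverse hs).clm_apply contDiffAt_const).contDiffWithinAt, fun s hs => ⟨?_, ?_⟩⟩,
    ?_⟩
  · exact hlin.map' (M s).inverse.toLinearMap (LinearMap.ker_eq_bot.2 (hinj s hs))
  · apply le_antisymm
    · rw [Submodule.span_le]
      rintro _ ⟨i, rfl⟩
      exact h.mem_inverse_vertical hℓ hs _
    · intro X hX
      have hX' : X = (M s).inverse (0, (M s X).2) := by
        rw [← (hℓ s hs X).1 hX, Prod.mk.eta, h.inverse_apply hs]
      rw [hX', ← b.sum_repr (M s X).2]
      have : ((0, ∑ i, b.repr (M s X).2 i • b i) : E × E) =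
          ∑ i, b.repr (M s X).2 i • ((0, b i) : E × E) := by
        simp [Prod.ext_iff, Prod.fst_sum, Prod.snd_sum]
      rw [this, map_sum]
      refine Submodule.sum_mem _ fun i _ => ?_
      rw [map_smul]
      exact Submodule.smul_mem _ _ (Submodule.subset_span ⟨i, rfl⟩)
  -- M sends the frame to (0, bᵢ) and its derivatives to (−bᵢ, ∗). The first components kill the
  -- coefficients of the derivatives, and the second components then kill the others.
  · have hsec : ∀ i, M t (deriv (fun s => (M s).inverse (0, b i)) t) = (-b i,
        (M t (deriv (fun s => (M s).inverse (0, b i)) t)).2) := fun i => by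
      refine Prod.ext ?_ rfl
      rw [h.deriv_section hℓ ht (h.isSectionNear_inverse_vertical hℓ ht _), h.apply_inverse ht]
    have hli : LinearIndependent ℝ (Sum.elim (fun i => (M t).inverse (0, b i))
        (fun i => deriv (fun s => (M s).inverse (0, b i)) t)) := by
      rw [Fintype.linearIndependent_iff]
      intro g hg
      rw [Fintype.sum_sum_type] at hg
      have hg' := congrArg (M t) hg
      simp only [Sum.elim_inl, Sum.elim_inr, map_add, map_sum, map_smul, h.apply_inverse ht,
        map_zero] at hg'
      have h1 : ∀ i, g (Sum.inr i) = 0 := by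
        have := congrArg Prod.fst hg'
        simp only [Prod.fst_add, Prod.fst_sum, Prod.smul_fst, smul_zero, Finset.sum_const_zero,
          zero_add, Prod.fst_zero] at this
        refine fun i => Fintype.linearIndependent_iff.1 b.linearIndependent
          (fun i => g (Sum.inr i)) ?_ i
        rw [← neg_eq_zero, ← Finset.sum_neg_distrib, ← this]
        refine Finset.sum_congr rfl fun i _ => ?_
        rw [hsec i, smul_neg]
      have h2 : ∀ i, g (Sum.inl i) = 0 := by
        have := congrArg Prod.snd hg'
        simp only [h1, zero_smul, Finset.sum_const_zero, add_zero, Prod.snd_sum, Prod.smul_snd,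
          Prod.snd_zero] at this
        exact Fintype.linearIndependent_iff.1 b.linearIndependent _ this
      rintro (i | i)
      exacts [h2 i, h1 i]
    refine ⟨hli, ?_⟩
    apply hli.span_eq_top_of_card_eq_finrank'
    simp [Module.finrank_prod]

lemma isFanningAt [FiniteDimensional ℝ E] (hℓ : ∀ s ∈ T, ∀ X, X ∈ ℓ s ↔ (M s X).1 = 0)
    (ht : t ∈ T) : IsFanningAt ℓ t := h.exists_fanningFrame hℓ ht

omit [CompleteSpace E] in
-- If M a = (0, e), then M ȧ = (−e, ∗) and J M ȧ = (0, −e) = −M a: this is where the minus sign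
-- originates.
lemma neg_conj_section (hℓ : ∀ s ∈ T, ∀ X, X ∈ ℓ s ↔ (M s X).1 = 0) (ht : t ∈ T)
    {a : ℝ → E × E} (ha : IsSectionNear ℓ t a) :
    (-((M t).inverse.comp ((coordTangent E).comp (M t)))) (a t) = 0 ∧
      (-((M t).inverse.comp ((coordTangent E).comp (M t)))) (deriv a t) = a t := by
  have h1 := h.deriv_section hℓ ht ha
  obtain ⟨J, hJ, htJ, haJ, hmem⟩ := ha
  have h0 := (hℓ t ht _).1 (hmem t htJ)
  have h00 : ((0 : E), (0 : E)) = 0 := rfl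
  constructor
  · simp [h0, h00]
  · simp only [neg_apply, ContinuousLinearMap.comp_apply, coordTangent_apply, h1]
    rw [← map_neg, Prod.neg_mk, neg_zero, neg_neg, ← h0, Prod.mk.eta, h.inverse_apply ht]

/-- The candidate −M⁻¹ J M meets the defining conditions for every frame, and those conditions fix
an endomorphism on a spanning family. The endomorphism is therefore independent of the frame picked
by the choice operator. -/
lemma fundamentalEndomorphism_eq [FiniteDimensional ℝ E]
    (hℓ : ∀ s ∈ T, ∀ X, X ∈ ℓ s ↔ (M s X).1 = 0) (ht : t ∈ T) :
    fundamentalEndomorphism ℓ t = -((M t).inverse.comp ((coordTangent E).comp (M t))) := by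
  have hsec : ∀ {n : ℕ} {a : Fin n → ℝ → E × E}, IsFrameNear ℓ t a → ∀ i,
      IsSectionNear ℓ t (a i) := by
    rintro n a ⟨J, hJ, htJ, ha, hs⟩ i
    refine ⟨J, hJ, htJ, ha i, fun s hsJ => ?_⟩
    rw [← (hs s hsJ).2]
    exact Submodule.subset_span ⟨i, rfl⟩
  have hex : ∃ B, IsFundamentalEndomorphismAt ℓ t B := by
    obtain ⟨n, a, ha, hf⟩ := h.exists_fanningFrame hℓ ht
    exact ⟨_, n, a, ha, hf, fun i => h.neg_conj_section hℓ ht (hsec ha i)⟩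
  obtain ⟨n, a, ha, hf, hB⟩ := Classical.epsilon_spec hex
  have hfe : Classical.epsilon (IsFundamentalEndomorphismAt ℓ t) =
    fundamentalEndomorphism ℓ t := rfl
  rw [hfe] at hB
  apply ContinuousLinearMap.coe_injective
  refine LinearMap.ext_on_range hf.2 ?_
  rintro (i | i)
  · exact (hB i).1.trans (h.neg_conj_section hℓ ht (hsec ha i)).1.symm
  · exact (hB i).2.trans (h.neg_conj_section hℓ ht (hsec ha i)).2.symm

lemma hasDerivAt_neg_conj (ht : t ∈ T) :
    HasDerivAt (fun s => -((M s).inverse.comp ((coordTangent E).comp (M s))))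
      ((M t).inverse.comp (((A t).comp (coordTangent E) - (coordTangent E).comp (A t)).comp
        (M t))) t := by
  have h1 := ((h.hasDerivAt_inverse ht).clm_comp
    ((hasDerivAt_const t (coordTangent E)).clm_comp (h.hasDerivAt t ht))).neg
  convert! h1 using 1
  ext X <;> simp [sub_eq_neg_add]

/-- The Jacobi endomorphism of the curve. -/
lemma jacobiEndomorphism_apply [FiniteDimensional ℝ E]
    (hℓ : ∀ s ∈ T, ∀ X, X ∈ ℓ s ↔ (M s X).1 = 0) {A' : E × E →L[ℝ] E × E}
    (hA : HasDerivAt A A' 0) (e : E) :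
    jacobiEndomorphism ℓ 0 (0, e) = (0, (1 / 2 : ℝ) • (A' (0, e)).2 - (A 0 (e, 0)).2
      - (1 / 4 : ℝ) • (A 0 (0, (A 0 (0, e)).2)).2) := by
  -- The formula for 𝐅̇ is required on a neighbourhood of 0, since it is differentiated once more.
  have h1 : deriv (fundamentalEndomorphism ℓ) =ᶠ[𝓝 0] fun t => (M t).inverse.comp
      (((A t).comp (coordTangent E) - (coordTangent E).comp (A t)).comp (M t)) := by
    filter_upwards [h.mem_nhds h.zero_mem] with t ht
    refine ((h.hasDerivAt_neg_conj ht).congr_of_eventuallyEq ?_).deriv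
    filter_upwards [h.mem_nhds ht] with s hs using h.fundamentalEndomorphism_eq hℓ hs
  have h2 := (h.hasDerivAt_inverse h.zero_mem).clm_comp
    (((hA.clm_comp (hasDerivAt_const 0 (coordTangent E))).sub
      ((hasDerivAt_const 0 (coordTangent E)).clm_comp hA)).clm_comp
      (h.hasDerivAt 0 h.zero_mem))
  have h3 := (h2.congr_of_eventuallyEq h1).deriv
  -- The first component of A(t) X is X₂ at all times near 0, so Ȧ(0) takes vertical values.
  have h4 : ∀ X, (A' X).1 = 0 := by
    intro X
    have := (ContinuousLinearMap.fst ℝ E E).hasFDerivAt.comp_hasDerivAt 0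
      (hA.clm_apply (hasDerivAt_const 0 X))
    have := (this.congr_of_eventuallyEq (f₁ := fun _ => X.2) ?_).unique
      (hasDerivAt_const 0 X.2)
    · simpa using this
    · filter_upwards [h.mem_nhds h.zero_mem] with s hs using (h.fst_apply s hs X).symm
  have h5 : ∀ X, A 0 X = (X.2, (A 0 X).2) := fun X =>
    Prod.ext (h.fst_apply 0 h.zero_mem X) rfl
  -- 𝐅̈(0) = Ȧ J − J Ȧ + [AJ − JA, A] at t = 0, where J Ȧ = 0. On (0, e) it gives (2e, ∂ᵧf e) when
  -- A(0) = DS; a second application kills the first component.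
  have h6 : ∀ X, deriv (deriv (fundamentalEndomorphism ℓ)) 0 X =
      ((2 : ℝ) • X.2 - (A 0 (0, X.1)).2, (A' (0, X.1)).2 - (2 : ℝ) • (A 0 (X.1, 0)).2
        - (A 0 (0, (A 0 (0, X.1)).2)).2 + (A 0 (0, X.2)).2) := by
    intro X
    have hadd : ∀ a b, A 0 (a, b) = (b, (A 0 (a, 0)).2 + (A 0 (0, b)).2) := fun a b => by
      refine Prod.ext (h.fst_apply 0 h.zero_mem _) ?_
      rw [← Prod.snd_add, ← map_add]; simp
    have hsub : ∀ b c, (A 0 (0, b - c)).2 = (A 0 (0, b)).2 - (A 0 (0, c)).2 := fun b c => by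
      rw [← Prod.snd_sub, ← map_sub]; simp
    have hJ : (coordTangent E).comp A' = 0 := by
      ext X <;> simp [h4]
    obtain ⟨x, y⟩ := X
    have h00 : (A 0 (0, 0)).2 = 0 := by
      have : ((0 : E), (0 : E)) = 0 := rfl
      rw [this, map_zero]; rfl
    rw [h3, hJ]
    simp only [ContinuousLinearMap.inverse_id, h.apply_zero, ContinuousLinearMap.comp_id,
      ContinuousLinearMap.id_comp, ContinuousLinearMap.neg_comp, add_apply, neg_apply, sub_apply,
      ContinuousLinearMap.comp_apply, coordTangent_apply, Pi.sub_apply, hadd x y,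
      ContinuousLinearMap.zero_comp, ContinuousLinearMap.comp_zero, add_zero, sub_zero]
    rw [hadd 0 x, hadd 0 y, h00, Prod.mk_sub_mk, hadd, sub_zero, zero_add, zero_add, hsub]
    refine Prod.ext ?_ ?_
    · simp only [Prod.fst_add, Prod.fst_neg, Prod.fst_sub, h4]
      module
    · simp only [Prod.snd_add, Prod.snd_neg, Prod.snd_sub, h.fst_apply 0 h.zero_mem]
      module
  have h7 : ∀ c : ℝ, ∀ x, (A 0 (0, c • x)).2 = c • (A 0 (0, x)).2 := fun c x => by
    rw [← Prod.smul_snd, ← map_smul]; simp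
  have h8 : ∀ x, (A 0 ((2 : ℝ) • x, 0)).2 = (2 : ℝ) • (A 0 (x, 0)).2 := fun x => by
    rw [← Prod.smul_snd, ← map_smul]; simp
  have h9 : (A' (0, (2 : ℝ) • e)).2 = (2 : ℝ) • (A' (0, e)).2 := by
    rw [← Prod.smul_snd, ← map_smul]; simp
  have h00 : ((0 : E), (0 : E)) = 0 := rfl
  rw [jacobiEndomorphism, smul_apply, ContinuousLinearMap.comp_apply, h6 (0, e), h6]
  refine Prod.ext ?_ ?_
  · simp only [h00, map_zero, Prod.snd_zero, Prod.smul_fst, sub_zero, zero_add,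
      smul_zero, h7]
    module
  · simp only [h00, map_zero, Prod.snd_zero, Prod.smul_snd, sub_zero, zero_add,
      smul_zero, h7, h8, h9]
    module

end IsLinearizedFlow

/-- The variational equation: symmetry of the second derivative of Ψ lets the time derivative of
D_pΨ be computed as D_p of ∂ₜΨ = S ∘ Ψ. -/
lemma exists_isLinearizedFlow [CompleteSpace E] {W : Set (ℝ × (E × E))} {O : Set (E × E)}
    {Ψ : ℝ × (E × E) → E × E} {S : E × E → E × E} {p₀ : E × E} {T₁ : Set ℝ}
    (hW : IsOpen W) (hp₀ : (0, p₀) ∈ W) (hΨ : ContDiffOn ℝ ∞ Ψ W) (hO : IsOpen O)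
    (hΨO : MapsTo Ψ W O) (hS : ContDiffOn ℝ ∞ S O) (hS₁ : ∀ q ∈ O, (S q).1 = q.2)
    (hΨ₀ : ∀ p, (0, p) ∈ W → Ψ (0, p) = p)
    (hΨ' : ∀ t p, (t, p) ∈ W → HasDerivAt (fun s => Ψ (s, p)) (S (Ψ (t, p))) t)
    (hT₁ : T₁ ∈ 𝓝 0) :
    ∃ T ⊆ T₁, IsLinearizedFlow T (fun t => fderiv ℝ (fun p => Ψ (t, p)) p₀)
      (fun t => fderiv ℝ S (Ψ (t, p₀))) := by
  have hd : ∀ z ∈ W, HasFDerivAt Ψ (fderiv ℝ Ψ z) z := fun z hz =>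
    ((hΨ.contDiffAt (hW.mem_nhds hz)).differentiableAt (by simp)).hasFDerivAt
  have hd' : ∀ z ∈ W, ContDiffAt ℝ ∞ (fderiv ℝ Ψ) z := fun z hz =>
    (hΨ.contDiffAt (hW.mem_nhds hz)).fderiv_right (by simp)
  have hdd : ∀ z ∈ W, HasFDerivAt (fderiv ℝ Ψ) (fderiv ℝ (fderiv ℝ Ψ) z) z := fun z hz =>
    ((hd' z hz).differentiableAt (by simp)).hasFDerivAt
  have hSd : ∀ q ∈ O, HasFDerivAt S (fderiv ℝ S q) q := fun q hq =>
    ((hS.contDiffAt (hO.mem_nhds hq)).differentiableAt (by simp)).hasFDerivAt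
  have hpart : ∀ t p, (t, p) ∈ W → fderiv ℝ (fun p => Ψ (t, p)) p =
      (fderiv ℝ Ψ (t, p)).comp (ContinuousLinearMap.inr ℝ ℝ (E × E)) := fun t p h =>
    ((hd _ h).comp p (hasFDerivAt_prodMk_right t p)).fderiv
  have htime : ∀ z ∈ W, fderiv ℝ Ψ z (1, 0) = S (Ψ z) := by
    rintro ⟨t, p⟩ hz
    have h1 : HasDerivAt (fun s : ℝ => (s, p)) ((1 : ℝ), (0 : E × E)) t :=
      (hasDerivAt_id t).prodMk (hasDerivAt_const t p)
    exact ((hd _ hz).comp_hasDerivAt t h1).unique (hΨ' t p hz)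
  have hmixed : ∀ z ∈ W, ∀ X, fderiv ℝ (fderiv ℝ Ψ) z (1, 0) (0, X) =
      fderiv ℝ S (Ψ z) (fderiv ℝ Ψ z (0, X)) := by
    intro z hz X
    rw [((hΨ.contDiffAt (hW.mem_nhds hz)).isSymmSndFDerivAt minSmoothness_two_le_infty).eq]
    have h1 := (hdd z hz).clm_apply (hasFDerivAt_const ((1, 0) : ℝ × (E × E)) z)
    have h2 := (h1.congr_of_eventuallyEq (f₁ := fun y => S (Ψ y)) ?_).unique
      ((hSd _ (hΨO hz)).comp z (hd z hz))
    · simpa using congrArg (fun B : ℝ × (E × E) →L[ℝ] E × E => B (0, X)) h2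
    · filter_upwards [hW.mem_nhds hz] with y hy using (htime y hy).symm
  have hcont : Continuous fun t : ℝ => (t, p₀) := by fun_prop
  have hT₀ : IsOpen {t : ℝ | (t, p₀) ∈ W} := hW.preimage hcont
  have hcd : ContDiffOn ℝ ∞ (fun t => fderiv ℝ (fun p => Ψ (t, p)) p₀) {t : ℝ | (t, p₀) ∈ W} := by
    have : ContDiffOn ℝ ∞ (fun t => (fderiv ℝ Ψ (t, p₀)).comp
        (ContinuousLinearMap.inr ℝ ℝ (E × E))) {t : ℝ | (t, p₀) ∈ W} := fun t ht =>
      (((hd' _ ht).comp t (contDiffAt_id.prodMk contDiffAt_const)).clm_comp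
        contDiffAt_const).contDiffWithinAt
    exact this.congr fun t ht => hpart t p₀ ht
  have hzero : fderiv ℝ (fun p => Ψ (0, p)) p₀ = ContinuousLinearMap.id ℝ (E × E) := by
    have : (fun p => Ψ (0, p)) =ᶠ[𝓝 p₀] id := by
      filter_upwards [(hW.preimage (f := fun p : E × E => ((0 : ℝ), p))
        (by fun_prop)).mem_nhds hp₀] with p hp using hΨ₀ p hp
    rw [this.fderiv_eq, fderiv_id]
  -- Invertible maps form a neighbourhood of the identity, which is the value at t = 0; T is shrunk
  -- to such times.
  have hinv : ∀ᶠ t in 𝓝 (0 : ℝ), (fderiv ℝ (fun p => Ψ (t, p)) p₀).IsInvertible := by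
    have h1 := (hcd.continuousOn.continuousAt (hT₀.mem_nhds hp₀)).eventually
      (p := fun B => B.IsInvertible)
    refine h1 ?_
    have := (ContinuousLinearEquiv.refl ℝ (E × E)).nhds
    change ∀ᶠ B in 𝓝 (fderiv ℝ (fun p => Ψ (0, p)) p₀), B.IsInvertible
    rw [hzero]
    exact this
  obtain ⟨T, hTs, hT, h0T⟩ := mem_nhds_iff.1
    (Filter.inter_mem hT₁ (Filter.inter_mem (hT₀.mem_nhds hp₀) hinv))
  refine ⟨T, fun t ht => (hTs ht).1, hT, h0T, hcd.mono fun t ht => (hTs ht).2.1, hzero, ?_,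
    fun t ht => (hTs ht).2.2, ?_⟩
  · intro t ht
    have htW : (t, p₀) ∈ W := (hTs ht).2.1
    have h1 : HasDerivAt (fun s : ℝ => (s, p₀)) ((1 : ℝ), (0 : E × E)) t :=
      (hasDerivAt_id t).prodMk (hasDerivAt_const t p₀)
    have h2 : HasDerivAt (fun s => fderiv ℝ Ψ (s, p₀)) (fderiv ℝ (fderiv ℝ Ψ) (t, p₀) (1, 0)) t :=
      (hdd _ htW).comp_hasDerivAt t h1
    have h3 : HasDerivAt (fun s => (fderiv ℝ Ψ (s, p₀)).comp (ContinuousLinearMap.inr ℝ ℝ (E × E)))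
        ((fderiv ℝ (fderiv ℝ Ψ) (t, p₀) (1, 0)).comp (ContinuousLinearMap.inr ℝ ℝ (E × E))) t :=
      ((ContinuousLinearMap.compL ℝ (E × E) (ℝ × (E × E)) (E × E)).flip
        (ContinuousLinearMap.inr ℝ ℝ (E × E))).hasFDerivAt.comp_hasDerivAt t h2
    have h4 : (fderiv ℝ (fderiv ℝ Ψ) (t, p₀) (1, 0)).comp (ContinuousLinearMap.inr ℝ ℝ (E × E)) =
        (fderiv ℝ S (Ψ (t, p₀))).comp (fderiv ℝ (fun p => Ψ (t, p)) p₀) := by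
      refine ContinuousLinearMap.ext fun X => ?_
      rw [hpart t p₀ htW]
      exact hmixed _ htW X
    rw [h4] at h3
    refine h3.congr_of_eventuallyEq ?_
    · filter_upwards [hT₀.mem_nhds htW] with s hs using hpart s p₀ hs
  · intro t ht X
    have htO := hΨO (hTs ht).2.1
    have h1 := (ContinuousLinearMap.fst ℝ E E).hasFDerivAt.comp _ (hSd _ htO)
    have h2 := (h1.congr_of_eventuallyEq (f₁ := fun q => q.2) ?_).unique
      (ContinuousLinearMap.snd ℝ E E).hasFDerivAt
    · simpa using congrArg (fun B : E × E →L[ℝ] E => B X) h2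
    · filter_upwards [hO.mem_nhds htO] with q hq using (hS₁ q hq).symm

end LinearizedFlow

/-! ### The preferred charts of `TM` and their differentials. -/

section Charts

variable {E : Type*} [NormedAddCommGroup E] [NormedSpace ℝ E]
  {M : Type*} [TopologicalSpace M] [ChartedSpace E M] [IsManifold 𝓘(ℝ, E) ∞ M]

/-- The differential at `w` of the preferred chart of `TM` at `v`. -/
def chartDeriv (v w : TangentBundle 𝓘(ℝ, E) M) : E × E →L[ℝ] E × E :=
  mfderiv 𝓘(ℝ, E).tangent 𝓘(ℝ, E × E) (extChartAt 𝓘(ℝ, E).tangent v) w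

/-- The differential at `p` of the inverse of the preferred chart of `TM` at `v`. -/
def chartSymmDeriv (v : TangentBundle 𝓘(ℝ, E) M) (p : E × E) : E × E →L[ℝ] E × E :=
  mfderiv 𝓘(ℝ, E × E) 𝓘(ℝ, E).tangent (extChartAt 𝓘(ℝ, E).tangent v).symm p

/-- The differential at `x` of the preferred chart of `M` at `π(v)`. -/
def fibreDeriv (v : TangentBundle 𝓘(ℝ, E) M) (x : M) : E →L[ℝ] E :=
  mfderiv 𝓘(ℝ, E) 𝓘(ℝ, E) (extChartAt 𝓘(ℝ, E) v.proj) x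

variable {v w : TangentBundle 𝓘(ℝ, E) M} {p : E × E}

lemma mem_source_iff : w ∈ (extChartAt 𝓘(ℝ, E).tangent v).source ↔
    w.proj ∈ (extChartAt 𝓘(ℝ, E) v.proj).source := by
  simp

/-- The chart of `TM` is linear on fibres because it is the differential of the chart of M; every
fibrewise computation below uses this. -/
lemma extChartAt_tangent_apply {x : M} (hx : x ∈ (extChartAt 𝓘(ℝ, E) v.proj).source)
    (y : TangentSpace 𝓘(ℝ, E) x) :
    extChartAt 𝓘(ℝ, E).tangent v ⟨x, y⟩ = (extChartAt 𝓘(ℝ, E) v.proj x, fibreDeriv v x y) := by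
  have hx' : x ∈ (chartAt E v.proj).source := by simpa using hx
  have h1 : fibreDeriv v x =
      (trivializationAt E (TangentSpace 𝓘(ℝ, E)) v.proj).continuousLinearMapAt ℝ x :=
    (TangentBundle.continuousLinearMapAt_trivializationAt hx').symm
  rw [h1]
  refine Prod.ext rfl ?_
  exact (congrFun ((trivializationAt E (TangentSpace 𝓘(ℝ, E)) v.proj).coe_linearMapAt_of_mem
    (R := ℝ) hx') y).symm

lemma isInvertible_fibreDeriv {x : M} (hx : x ∈ (extChartAt 𝓘(ℝ, E) v.proj).source) :
    (fibreDeriv v x).IsInvertible :=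
  isInvertible_mfderiv_extChartAt hx

lemma fibreDeriv_self : fibreDeriv v v.proj = ContinuousLinearMap.id ℝ E :=
  mfderiv_extChartAt_self (I := 𝓘(ℝ, E)) (x := v.proj)

lemma hasMFDerivAt_chart (hw : w ∈ (extChartAt 𝓘(ℝ, E).tangent v).source) :
    HasMFDerivAt 𝓘(ℝ, E).tangent 𝓘(ℝ, E × E) (extChartAt 𝓘(ℝ, E).tangent v) w
      (chartDeriv v w) :=
  (mdifferentiableAt_extChartAt (by simpa using hw)).hasMFDerivAt

lemma contMDiffAt_chart (hw : w ∈ (extChartAt 𝓘(ℝ, E).tangent v).source) :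
    ContMDiffAt 𝓘(ℝ, E).tangent 𝓘(ℝ, E × E) ∞ (extChartAt 𝓘(ℝ, E).tangent v) w :=
  contMDiffAt_extChartAt' (by simpa using hw)

lemma target_mem_nhds (hp : p ∈ (extChartAt 𝓘(ℝ, E).tangent v).target) :
    (extChartAt 𝓘(ℝ, E).tangent v).target ∈ 𝓝 p :=
  extChartAt_target_mem_nhds' hp

lemma contMDiffAt_chart_symm (hp : p ∈ (extChartAt 𝓘(ℝ, E).tangent v).target) :
    ContMDiffAt 𝓘(ℝ, E × E) 𝓘(ℝ, E).tangent ∞ (extChartAt 𝓘(ℝ, E).tangent v).symm p :=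
  (contMDiffOn_extChartAt_symm v).contMDiffAt (target_mem_nhds hp)

lemma hasMFDerivAt_chart_symm (hp : p ∈ (extChartAt 𝓘(ℝ, E).tangent v).target) :
    HasMFDerivAt 𝓘(ℝ, E × E) 𝓘(ℝ, E).tangent (extChartAt 𝓘(ℝ, E).tangent v).symm p
      (chartSymmDeriv v p) :=
  ((contMDiffAt_chart_symm hp).mdifferentiableAt (by simp)).hasMFDerivAt

lemma chartDeriv_self : chartDeriv v v = ContinuousLinearMap.id ℝ (E × E) :=
  mfderiv_extChartAt_self (I := 𝓘(ℝ, E).tangent) (x := v)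

lemma chartDeriv_comp_symm (hp : p ∈ (extChartAt 𝓘(ℝ, E).tangent v).target) :
    (chartDeriv v ((extChartAt 𝓘(ℝ, E).tangent v).symm p)).comp (chartSymmDeriv v p) =
      ContinuousLinearMap.id ℝ (E × E) := by
  have h1 := (hasMFDerivAt_chart ((extChartAt 𝓘(ℝ, E).tangent v).map_target hp)).comp p
    (hasMFDerivAt_chart_symm hp)
  have h1' : HasFDerivAt (extChartAt 𝓘(ℝ, E).tangent v ∘ (extChartAt 𝓘(ℝ, E).tangent v).symm)
    ((chartDeriv v ((extChartAt 𝓘(ℝ, E).tangent v).symm p)).comp (chartSymmDeriv v p)) p :=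
    h1.hasFDerivAt
  have h2 := (h1'.congr_of_eventuallyEq (f₁ := id) ?_).unique (hasFDerivAt_id p)
  · exact h2
  · filter_upwards [target_mem_nhds hp] with q hq
    exact ((extChartAt 𝓘(ℝ, E).tangent v).right_inv hq).symm

lemma isInvertible_chartDeriv (hw : w ∈ (extChartAt 𝓘(ℝ, E).tangent v).source) :
    (chartDeriv v w).IsInvertible :=
  isInvertible_mfderiv_extChartAt hw

lemma chartDeriv_injective (hw : w ∈ (extChartAt 𝓘(ℝ, E).tangent v).source) :
    Function.Injective (chartDeriv v w) := by
  obtain ⟨e, he⟩ := isInvertible_chartDeriv hw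
  rw [← he]; exact e.injective

lemma chartDeriv_surjective (hw : w ∈ (extChartAt 𝓘(ℝ, E).tangent v).source) :
    Function.Surjective (chartDeriv v w) := by
  obtain ⟨e, he⟩ := isInvertible_chartDeriv hw
  rw [← he]; exact e.surjective

lemma fibreDeriv_injective {x : M} (hx : x ∈ (extChartAt 𝓘(ℝ, E) v.proj).source) :
    Function.Injective (fibreDeriv v x) := by
  obtain ⟨e, he⟩ := isInvertible_fibreDeriv hx
  rw [← he]; exact e.injective

lemma fibreDeriv_surjective {x : M} (hx : x ∈ (extChartAt 𝓘(ℝ, E) v.proj).source) :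
    Function.Surjective (fibreDeriv v x) := by
  obtain ⟨e, he⟩ := isInvertible_fibreDeriv hx
  rw [← he]; exact e.surjective

lemma fibreDeriv_dproj (hw : w ∈ (extChartAt 𝓘(ℝ, E).tangent v).source)
    (X : TangentSpace 𝓘(ℝ, E).tangent w) :
    fibreDeriv v w.proj (dproj w X) = (chartDeriv v w X).1 := by
  have hw' := mem_source_iff.1 hw
  have h1 : HasMFDerivAt 𝓘(ℝ, E).tangent 𝓘(ℝ, E)
      (TotalSpace.proj : TangentBundle 𝓘(ℝ, E) M → M) w (dproj w) :=
    ((contMDiff_proj (n := 1) (TangentSpace 𝓘(ℝ, E) : M → Type _)).mdifferentiable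
      (by simp) w).hasMFDerivAt
  have h2 : HasMFDerivAt 𝓘(ℝ, E) 𝓘(ℝ, E) (extChartAt 𝓘(ℝ, E) v.proj) w.proj
      (fibreDeriv v w.proj : E →L[ℝ] E) :=
    (mdifferentiableAt_extChartAt (by simpa using hw')).hasMFDerivAt
  have h3 := h2.comp w h1
  have h4 : HasMFDerivAt 𝓘(ℝ, E × E) 𝓘(ℝ, E) (Prod.fst : E × E → E)
      (extChartAt 𝓘(ℝ, E).tangent v w) (ContinuousLinearMap.fst ℝ E E) :=
    (ContinuousLinearMap.fst ℝ E E).hasFDerivAt.hasMFDerivAt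
  have h5 := h4.comp w (hasMFDerivAt_chart hw)
  have h6 := hasMFDerivAt_unique h3 h5
  exact congrArg (fun B : E × E →L[ℝ] E => B X) h6

lemma mem_verticalSpace_iff (hw : w ∈ (extChartAt 𝓘(ℝ, E).tangent v).source)
    (X : TangentSpace 𝓘(ℝ, E).tangent w) :
    X ∈ verticalSpace w ↔ (chartDeriv v w X).1 = 0 := by
  rw [← fibreDeriv_dproj hw]
  have : X ∈ verticalSpace w ↔ dproj w X = 0 := LinearMap.mem_ker
  rw [this]
  constructor
  · intro h; rw [h]; exact map_zero (fibreDeriv v w.proj)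
  · intro h
    exact fibreDeriv_injective (mem_source_iff.1 hw) (h.trans (map_zero (fibreDeriv v w.proj)).symm)

/-- The curve w + t u stays in one fibre, on which the chart is linear, so it is read as a straight
line with velocity (0, `fibreDeriv` u). -/
lemma chartDeriv_verticalLift (hw : w ∈ (extChartAt 𝓘(ℝ, E).tangent v).source)
    (u : TangentSpace 𝓘(ℝ, E) w.proj) :
    chartDeriv v w (verticalLift w u) = (0, fibreDeriv v w.proj u) := by
  have hw' := mem_source_iff.1 hw
  set φ := extChartAt 𝓘(ℝ, E).tangent v with hφ
  have hfib : ∀ t : ℝ, φ (⟨w.proj, w.2 + t • u⟩ : TangentBundle 𝓘(ℝ, E) M) =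
      (extChartAt 𝓘(ℝ, E) v.proj w.proj,
        fibreDeriv v w.proj w.2 + t • fibreDeriv v w.proj u) := fun t => by
    rw [hφ, extChartAt_tangent_apply hw']
    refine Prod.ext rfl ?_
    exact ((fibreDeriv v w.proj).map_add w.2 (t • (show E from u))).trans
      (congrArg _ ((fibreDeriv v w.proj).map_smul t u))
  have hsrc : ∀ t : ℝ, (⟨w.proj, w.2 + t • u⟩ : TangentBundle 𝓘(ℝ, E) M) ∈ φ.source := fun t =>
    mem_source_iff.2 hw'
  have hline : HasDerivAt (fun t : ℝ => (extChartAt 𝓘(ℝ, E) v.proj w.proj,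
        fibreDeriv v w.proj w.2 + t • fibreDeriv v w.proj u)) (0, fibreDeriv v w.proj u) 0 := by
    have h1 : HasDerivAt (fun t : ℝ => fibreDeriv v w.proj w.2 + t • fibreDeriv v w.proj u)
        (fibreDeriv v w.proj u) 0 := by
      simpa using ((hasDerivAt_id (0 : ℝ)).smul_const (fibreDeriv v w.proj u)).const_add
        (fibreDeriv v w.proj w.2)
    exact (hasDerivAt_const (0 : ℝ) _).prodMk h1
  -- Differentiability must be secured before the chain rule, as `mfderiv` is 0 at a point of
  -- non-differentiability.
  have hcurve : MDifferentiableAt 𝓘(ℝ, ℝ) 𝓘(ℝ, E).tangent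
      (fun t : ℝ => (⟨w.proj, w.2 + t • u⟩ : TangentBundle 𝓘(ℝ, E) M)) 0 := by
    have h1 : (fun t : ℝ => (⟨w.proj, w.2 + t • u⟩ : TangentBundle 𝓘(ℝ, E) M)) =
        φ.symm ∘ fun t : ℝ => (extChartAt 𝓘(ℝ, E) v.proj w.proj,
        fibreDeriv v w.proj w.2 + t • fibreDeriv v w.proj u) := by
      funext t
      rw [Function.comp_apply, ← hfib t, φ.left_inv (hsrc t)]
    rw [h1]
    refine MDifferentiableAt.comp (I' := 𝓘(ℝ, E × E)) _ ?_
      hline.differentiableAt.mdifferentiableAt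
    rw [← hfib 0]
    exact (hasMFDerivAt_chart_symm (φ.map_source (hsrc 0))).mdifferentiableAt
  have hw0 : (⟨w.proj, w.2 + (0 : ℝ) • u⟩ : TangentBundle 𝓘(ℝ, E) M) = w := by
    rw [zero_smul, add_zero]
  have h2 : HasMFDerivAt 𝓘(ℝ, E).tangent 𝓘(ℝ, E × E) φ
      (⟨w.proj, w.2 + (0 : ℝ) • u⟩ : TangentBundle 𝓘(ℝ, E) M) (chartDeriv v w) := by
    rw [hw0]; exact hasMFDerivAt_chart hw
  have h3 : HasFDerivAt (φ ∘ fun t : ℝ => (⟨w.proj, w.2 + t • u⟩ : TangentBundle 𝓘(ℝ, E) M))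
      ((chartDeriv v w).comp (show ℝ →L[ℝ] E × E from mfderiv 𝓘(ℝ, ℝ) 𝓘(ℝ, E).tangent
        (fun t : ℝ => (⟨w.proj, w.2 + t • u⟩ : TangentBundle 𝓘(ℝ, E) M)) 0)) 0 :=
    (h2.comp (0 : ℝ) hcurve.hasMFDerivAt).hasFDerivAt
  have h4 := h3.congr_of_eventuallyEq (f₁ := fun t : ℝ => (extChartAt 𝓘(ℝ, E) v.proj w.proj,
        fibreDeriv v w.proj w.2 + t • fibreDeriv v w.proj u))
        (Filter.Eventually.of_forall fun t => (hfib t).symm)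
  have h5 := h4.unique hline.hasFDerivAt
  have h6 := congrArg (fun B : ℝ →L[ℝ] E × E => B 1) h5
  refine Eq.trans ?_ (h6.trans ?_)
  · rfl
  · simp

lemma chartDeriv_almostTangent (hw : w ∈ (extChartAt 𝓘(ℝ, E).tangent v).source)
    (X : TangentSpace 𝓘(ℝ, E).tangent w) :
    chartDeriv v w (almostTangent w X) = coordTangent E (chartDeriv v w X) := by
  rw [almostTangent, chartDeriv_verticalLift hw, coordTangent_apply, fibreDeriv_dproj hw]

end Charts

/-! ### The Finsler energy, the symplectic form and the spray in a chart. -/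

section Energy

variable {E : Type*} [NormedAddCommGroup E] [NormedSpace ℝ E]
  {M : Type*} [TopologicalSpace M] [ChartedSpace E M] [IsManifold 𝓘(ℝ, E) ∞ M]

/-- The energy of `F` read in the preferred chart of `TM` at `v`. -/
def coordEnergy (F : TangentBundle 𝓘(ℝ, E) M → ℝ) (v : TangentBundle 𝓘(ℝ, E) M) (p : E × E) : ℝ :=
  energy F ((extChartAt 𝓘(ℝ, E).tangent v).symm p)

/-- The image of `TM \ 0` in the preferred chart of `TM` at `v`. -/
def chartDomain (v : TangentBundle 𝓘(ℝ, E) M) : Set (E × E) :=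
  (extChartAt 𝓘(ℝ, E).tangent v).target ∩ {p | p.2 ≠ 0}

variable {F : TangentBundle 𝓘(ℝ, E) M → ℝ} {v w : TangentBundle 𝓘(ℝ, E) M} {p : E × E}

lemma coordEnergy_chart (hw : w ∈ (extChartAt 𝓘(ℝ, E).tangent v).source) :
    coordEnergy F v (extChartAt 𝓘(ℝ, E).tangent v w) = energy F w := by
  rw [coordEnergy, (extChartAt 𝓘(ℝ, E).tangent v).left_inv hw]

lemma snd_chart (hw : w ∈ (extChartAt 𝓘(ℝ, E).tangent v).source) :
    (extChartAt 𝓘(ℝ, E).tangent v w).2 = fibreDeriv v w.proj w.2 :=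
  congrArg Prod.snd (extChartAt_tangent_apply (mem_source_iff.1 hw) w.2)

lemma snd_chart_self : (extChartAt 𝓘(ℝ, E).tangent v v).2 = v.2 := by
  rw [snd_chart (mem_extChartAt_source v), fibreDeriv_self]; rfl

lemma chart_mem_chartDomain_iff (hw : w ∈ (extChartAt 𝓘(ℝ, E).tangent v).source) :
    extChartAt 𝓘(ℝ, E).tangent v w ∈ chartDomain v ↔ w ∈ puncturedTangentBundle E M := by
  have h1 : extChartAt 𝓘(ℝ, E).tangent v w ∈ chartDomain v ↔ fibreDeriv v w.proj w.2 ≠ 0 := by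
    rw [← snd_chart hw]
    exact ⟨fun h => h.2, fun h => ⟨(extChartAt 𝓘(ℝ, E).tangent v).map_source hw, h⟩⟩
  rw [h1]
  refine not_congr ⟨fun h => ?_, fun h => ?_⟩
  · exact fibreDeriv_injective (mem_source_iff.1 hw) (h.trans (map_zero (fibreDeriv v w.proj)).symm)
  · exact (congrArg (fibreDeriv v w.proj) h).trans (map_zero _)

lemma chart_symm_mem_punctured (hp : p ∈ chartDomain v) :
    (extChartAt 𝓘(ℝ, E).tangent v).symm p ∈ puncturedTangentBundle E M := by
  rw [← chart_mem_chartDomain_iff ((extChartAt 𝓘(ℝ, E).tangent v).map_target hp.1),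
    (extChartAt 𝓘(ℝ, E).tangent v).right_inv hp.1]
  exact hp

lemma isOpen_chartDomain : IsOpen (chartDomain v) :=
  (isOpen_extChartAt_target v).inter (isOpen_ne.preimage continuous_snd)

lemma contDiffOn_coordEnergy (hF : IsFinslerMetric F) :
    ContDiffOn ℝ ∞ (coordEnergy F v) (chartDomain v) := by
  have h1 : ContMDiffOn 𝓘(ℝ, E × E) 𝓘(ℝ, ℝ) ∞
      (F ∘ (extChartAt 𝓘(ℝ, E).tangent v).symm) (chartDomain v) :=
    hF.smooth.comp ((contMDiffOn_extChartAt_symm v).mono inter_subset_left)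
      fun p hp => chart_symm_mem_punctured hp
  exact contDiffOn_const.mul (h1.contDiffOn.pow 2)

section Fibre

variable (hF : IsFinslerMetric F) (hw : w ∈ (extChartAt 𝓘(ℝ, E).tangent v).source)
include hF hw

/-- In the chart the fibre through w is y ↦ (x, T y) with T linear, so a fibre derivative is a
vertical partial derivative of `coordEnergy`. -/
lemma hasFDerivAt_energy_fibre {y : E} (hy : y ≠ 0) :
    HasFDerivAt (fun y : E => energy F ⟨w.proj, y⟩)
      ((fderiv ℝ (coordEnergy F v) ((extChartAt 𝓘(ℝ, E).tangent v w).1, fibreDeriv v w.proj y)).comp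
        ((ContinuousLinearMap.inr ℝ E E).comp (fibreDeriv v w.proj))) y := by
  have hw' := mem_source_iff.1 hw
  have hφ : ∀ y : E, extChartAt 𝓘(ℝ, E).tangent v (⟨w.proj, y⟩ : TangentBundle 𝓘(ℝ, E) M) =
      ((extChartAt 𝓘(ℝ, E).tangent v w).1, fibreDeriv v w.proj y) :=
    fun y => extChartAt_tangent_apply hw' y
  have hsrc : ∀ y : E, (⟨w.proj, y⟩ : TangentBundle 𝓘(ℝ, E) M) ∈
      (extChartAt 𝓘(ℝ, E).tangent v).source := fun y => mem_source_iff.2 hw'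
  have h1 : (fun y : E => energy F ⟨w.proj, y⟩) = fun y : E => coordEnergy F v
      ((extChartAt 𝓘(ℝ, E).tangent v w).1, fibreDeriv v w.proj y) := by
    funext y
    rw [← hφ y, coordEnergy_chart (hsrc y)]
  rw [h1]
  have hmem : ((extChartAt 𝓘(ℝ, E).tangent v w).1, fibreDeriv v w.proj y) ∈ chartDomain v := by
    rw [← hφ y, chart_mem_chartDomain_iff (hsrc y)]
    exact hy
  have h2 : HasFDerivAt (coordEnergy F v) _
      ((extChartAt 𝓘(ℝ, E).tangent v w).1, fibreDeriv v w.proj y) :=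
    (((contDiffOn_coordEnergy hF).contDiffAt (isOpen_chartDomain.mem_nhds hmem)).differentiableAt
      (by simp)).hasFDerivAt
  exact h2.comp y ((hasFDerivAt_prodMk_right _ _).comp y (fibreDeriv v w.proj).hasFDerivAt)

lemma legendre_apply (hw₀ : w ∈ puncturedTangentBundle E M) (u : TangentSpace 𝓘(ℝ, E) w.proj) :
    legendre F w u = fderiv ℝ (coordEnergy F v) (extChartAt 𝓘(ℝ, E).tangent v w)
      (0, fibreDeriv v w.proj u) := by
  have h1 := (hasFDerivAt_energy_fibre hF hw (y := w.2) hw₀).fderiv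
  rw [← snd_chart hw] at h1
  exact congrArg (fun B : E →L[ℝ] ℝ => B u) h1

lemma hasFDerivAt_fderiv_energy_fibre {y : E} (hy : y ≠ 0) :
    HasFDerivAt (fderiv ℝ fun y : E => energy F ⟨w.proj, y⟩)
      (((ContinuousLinearMap.compL ℝ E (E × E) ℝ).flip
        ((ContinuousLinearMap.inr ℝ E E).comp (fibreDeriv v w.proj))).comp
        ((fderiv ℝ (fderiv ℝ (coordEnergy F v)) ((extChartAt 𝓘(ℝ, E).tangent v w).1,
          fibreDeriv v w.proj y)).comp
        ((ContinuousLinearMap.inr ℝ E E).comp (fibreDeriv v w.proj)))) y := by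
  set B : E →L[ℝ] E × E := (ContinuousLinearMap.inr ℝ E E).comp (fibreDeriv v w.proj) with hB
  have hw' := mem_source_iff.1 hw
  have hmem : ((extChartAt 𝓘(ℝ, E).tangent v w).1, fibreDeriv v w.proj y) ∈ chartDomain v := by
    have hφ : extChartAt 𝓘(ℝ, E).tangent v (⟨w.proj, y⟩ : TangentBundle 𝓘(ℝ, E) M) =
      ((extChartAt 𝓘(ℝ, E).tangent v w).1, fibreDeriv v w.proj y) := extChartAt_tangent_apply hw' y
    rw [← hφ]
    exact (chart_mem_chartDomain_iff (w := ⟨w.proj, y⟩) (mem_source_iff.2 hw')).2 hy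
  have h1 : fderiv ℝ (fun y : E => energy F ⟨w.proj, y⟩) =ᶠ[𝓝 y] fun y =>
      (fderiv ℝ (coordEnergy F v) ((extChartAt 𝓘(ℝ, E).tangent v w).1,
        fibreDeriv v w.proj y)).comp B := by
    filter_upwards [isOpen_ne.mem_nhds hy] with y hy using (hasFDerivAt_energy_fibre hF hw hy).fderiv
  have h2 : HasFDerivAt (fderiv ℝ (coordEnergy F v)) _
      ((extChartAt 𝓘(ℝ, E).tangent v w).1, fibreDeriv v w.proj y) :=
    ((((contDiffOn_coordEnergy hF).contDiffAt
      (isOpen_chartDomain.mem_nhds hmem)).fderiv_right (m := 1)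
      (by exact WithTop.coe_le_coe.2 le_top)).differentiableAt (by simp)).hasFDerivAt
  have h3 := h2.comp y ((hasFDerivAt_prodMk_right (𝕜 := ℝ) (extChartAt 𝓘(ℝ, E).tangent v w).1
      (fibreDeriv v w.proj y)).comp y (fibreDeriv v w.proj).hasFDerivAt)
  exact (((ContinuousLinearMap.compL ℝ E (E × E) ℝ).flip B).hasFDerivAt.comp y
    h3).congr_of_eventuallyEq h1

lemma fundamentalTensor_apply (hw₀ : w ∈ puncturedTangentBundle E M)
    (u₁ u₂ : TangentSpace 𝓘(ℝ, E) w.proj) :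
    fundamentalTensor F w u₁ u₂ = fderiv ℝ (fderiv ℝ (coordEnergy F v))
      (extChartAt 𝓘(ℝ, E).tangent v w) (0, fibreDeriv v w.proj u₁) (0, fibreDeriv v w.proj u₂) := by
  have h1 := (hasFDerivAt_fderiv_energy_fibre hF hw (y := w.2) hw₀).fderiv
  rw [← snd_chart hw] at h1
  exact congrArg (fun B : E →L[ℝ] E →L[ℝ] ℝ => B u₁ u₂) h1

end Fibre

lemma isCoordEnergy (hF : IsFinslerMetric F) : IsCoordEnergy (chartDomain v) (coordEnergy F v) := by
  have hsmul : ∀ p ∈ (extChartAt 𝓘(ℝ, E).tangent v).target, ∀ c : ℝ,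
      ∃ q : TangentBundle 𝓘(ℝ, E) M, q ∈ (extChartAt 𝓘(ℝ, E).tangent v).source ∧
        extChartAt 𝓘(ℝ, E).tangent v q = (p.1, c • p.2) ∧
        q = ⟨((extChartAt 𝓘(ℝ, E).tangent v).symm p).proj,
          c • ((extChartAt 𝓘(ℝ, E).tangent v).symm p).2⟩ := by
    intro p hp c
    have hsrc := (extChartAt 𝓘(ℝ, E).tangent v).map_target hp
    refine ⟨⟨((extChartAt 𝓘(ℝ, E).tangent v).symm p).proj,
      c • ((extChartAt 𝓘(ℝ, E).tangent v).symm p).2⟩,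
      mem_source_iff.2 (mem_source_iff.1 hsrc), ?_, rfl⟩
    rw [extChartAt_tangent_apply (mem_source_iff.1 hsrc)]
    have h1 := (extChartAt 𝓘(ℝ, E).tangent v).right_inv hp
    have h2 := congrArg Prod.fst h1
    refine Prod.ext h2 ?_
    refine ((fibreDeriv v _).map_smul c _).trans ?_
    rw [← snd_chart hsrc, h1]
  refine ⟨isOpen_chartDomain, contDiffOn_coordEnergy hF, ?_, ?_, ?_⟩
  · intro p hp c hc
    obtain ⟨q, hq, hq', -⟩ := hsmul p hp.1 c
    refine ⟨?_, smul_ne_zero hc.ne' hp.2⟩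
    rw [← hq']
    exact (extChartAt 𝓘(ℝ, E).tangent v).map_source hq
  · intro p hp c hc
    obtain ⟨q, hq, hq', hq''⟩ := hsmul p hp.1 c
    rw [← hq', coordEnergy_chart hq, hq'', energy, hF.homogeneous _ _ _ hc.le, coordEnergy, energy]
    ring
  · intro p hp u hu
    have hsrc := (extChartAt 𝓘(ℝ, E).tangent v).map_target hp.1
    obtain ⟨u', rfl⟩ := fibreDeriv_surjective (mem_source_iff.1 hsrc) u
    have hu' : u' ≠ 0 := by rintro rfl; exact hu (map_zero _)
    have h1 := hF.posDef _ (chart_symm_mem_punctured hp) u' hu'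
    have h2 := fundamentalTensor_apply hF hsrc (chart_symm_mem_punctured hp) u' u'
    rw [(extChartAt 𝓘(ℝ, E).tangent v).right_inv hp.1] at h2
    exact h1.trans_eq h2

/-- This is α = ∂ᵧL dx: the Legendre transform gives ∂ᵧL, and `coordTangent` moves dx into the
vertical slot. -/
lemma formInChart_alphaForm (hF : IsFinslerMetric F) (hp : p ∈ chartDomain v) :
    formInChart (alphaForm F) v p = (fderiv ℝ (coordEnergy F v) p).comp (coordTangent E) := by
  have hsrc := (extChartAt 𝓘(ℝ, E).tangent v).map_target hp.1
  refine ContinuousLinearMap.ext fun X => ?_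
  have h1 : formInChart (alphaForm F) v p X =
      legendre F ((extChartAt 𝓘(ℝ, E).tangent v).symm p)
        (dproj _ (chartSymmDeriv v p X)) := rfl
  have h2 : chartDeriv v ((extChartAt 𝓘(ℝ, E).tangent v).symm p) (chartSymmDeriv v p X) = X :=
    congrArg (fun B : E × E →L[ℝ] E × E => B X) (chartDeriv_comp_symm hp.1)
  rw [h1, legendre_apply hF hsrc (chart_symm_mem_punctured hp),
    (extChartAt 𝓘(ℝ, E).tangent v).right_inv hp.1, ContinuousLinearMap.comp_apply,
    coordTangent_apply]
  exact congrArg (fun Y : E => fderiv ℝ (coordEnergy F v) p (0, Y))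
    ((fibreDeriv_dproj hsrc _).trans (congrArg Prod.fst h2))

/-- The exterior derivative of a 1-form can be computed in any chart. -/
lemma extDerivForm_eq
    {α : ∀ w : TangentBundle 𝓘(ℝ, E) M, TangentSpace 𝓘(ℝ, E).tangent w →L[ℝ] ℝ}
    (hw : w ∈ (extChartAt 𝓘(ℝ, E).tangent v).source)
    (hα : DifferentiableAt ℝ (formInChart α v) (extChartAt 𝓘(ℝ, E).tangent v w))
    (X Y : TangentSpace 𝓘(ℝ, E).tangent w) :
    extDerivForm α w X Y =
      fderiv ℝ (formInChart α v) (extChartAt 𝓘(ℝ, E).tangent v w)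
        (chartDeriv v w X) (chartDeriv v w Y) -
      fderiv ℝ (formInChart α v) (extChartAt 𝓘(ℝ, E).tangent v w)
        (chartDeriv v w Y) (chartDeriv v w X) := by
  set φv := extChartAt 𝓘(ℝ, E).tangent v with hφv
  set φw := extChartAt 𝓘(ℝ, E).tangent w with hφw
  have hww : w ∈ φw.source := mem_extChartAt_source w
  set q₀ := φw w with hq₀
  have hq₀t : q₀ ∈ φw.target := φw.map_source hww
  have hinv : φw.symm q₀ = w := φw.left_inv hww
  set τ : E × E → E × E := φv ∘ φw.symm with hτ
  have hτq₀ : τ q₀ = φv w := by rw [hτ, Function.comp_apply, hinv]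
  have hnear : ∀ᶠ q in 𝓝 q₀, q ∈ φw.target ∧ φw.symm q ∈ φv.source := by
    refine (show ∀ᶠ q in 𝓝 q₀, q ∈ φw.target from target_mem_nhds hq₀t).and ?_
    have hc : ContinuousAt φw.symm q₀ := (contMDiffAt_chart_symm hq₀t).continuousAt
    refine hc ?_
    rw [hinv]
    exact (isOpen_extChartAt_source v).mem_nhds hw
  have hτs : ContDiffAt ℝ ∞ τ q₀ := by
    have h1 : ContMDiffAt 𝓘(ℝ, E).tangent 𝓘(ℝ, E × E) ∞ φv (φw.symm q₀) :=
      contMDiffAt_chart (by rw [hinv]; exact hw)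
    exact (h1.comp q₀ (contMDiffAt_chart_symm hq₀t)).contDiffAt
  have hτd : HasFDerivAt τ (fderiv ℝ τ q₀) q₀ := (hτs.differentiableAt (by simp)).hasFDerivAt
  have hτdd : HasFDerivAt (fderiv ℝ τ) (fderiv ℝ (fderiv ℝ τ) q₀) q₀ :=
    ((hτs.fderiv_right (m := 1) (by exact WithTop.coe_le_coe.2 le_top)).differentiableAt
      (by simp)).hasFDerivAt
  have hτ' : ∀ q, q ∈ φw.target → φw.symm q ∈ φv.source →
      fderiv ℝ τ q = (chartDeriv v (φw.symm q)).comp (chartSymmDeriv w q) := fun q h1 h2 => by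
    have h3 : HasFDerivAt τ ((chartDeriv v (φw.symm q)).comp (chartSymmDeriv w q)) q :=
      ((hasMFDerivAt_chart h2).comp q (hasMFDerivAt_chart_symm h1)).hasFDerivAt
    exact h3.fderiv
  -- The expression of α in the chart at w is the pull-back, by the transition map τ, of its
  -- expression in the chart at v.
  have hpull : formInChart α w =ᶠ[𝓝 q₀] fun q => (formInChart α v (τ q)).comp (fderiv ℝ τ q) := by
    filter_upwards [hnear] with q hq
    have h1 : φv.symm (τ q) = φw.symm q := φv.left_inv hq.2
    have h2 : (chartDeriv v (φv.symm (τ q))).comp (chartSymmDeriv v (τ q)) =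
      ContinuousLinearMap.id ℝ (E × E) := chartDeriv_comp_symm (φv.map_source hq.2)
    rw [hτ' q hq.1 hq.2]
    refine ContinuousLinearMap.ext fun Z => ?_
    have h3 : chartSymmDeriv v (τ q) (chartDeriv v (φw.symm q) (chartSymmDeriv w q Z)) =
        chartSymmDeriv w q Z := by
      apply chartDeriv_injective (v := v) hq.2
      have h4 := congrArg (fun B : E × E →L[ℝ] E × E =>
        B (chartDeriv v (φw.symm q) (chartSymmDeriv w q Z))) h2
      rw [h1] at h4
      exact h4
    have h5 : formInChart α w q Z = (α (φw.symm q) : E × E →L[ℝ] ℝ) (chartSymmDeriv w q Z) := rfl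
    have h6 : (formInChart α v (τ q)).comp ((chartDeriv v (φw.symm q)).comp (chartSymmDeriv w q)) Z
        = (α (φv.symm (τ q)) : E × E →L[ℝ] ℝ)
          (chartSymmDeriv v (τ q) (chartDeriv v (φw.symm q) (chartSymmDeriv w q Z))) := rfl
    rw [h5, h6, h3, h1]
  have hα' : HasFDerivAt (formInChart α v) (fderiv ℝ (formInChart α v) (φv w)) (τ q₀) := by
    rw [hτq₀]; exact hα.hasFDerivAt
  have hself : chartDeriv w w = ContinuousLinearMap.id ℝ (E × E) := chartDeriv_self
  have hdτ : fderiv ℝ τ q₀ = chartDeriv v w := by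
    have h1 := hτ' q₀ hq₀t (by rw [hinv]; exact hw)
    have h2 : (chartDeriv w (φw.symm q₀)).comp (chartSymmDeriv w q₀) =
      ContinuousLinearMap.id ℝ (E × E) := chartDeriv_comp_symm hq₀t
    rw [hinv, hself, ContinuousLinearMap.id_comp] at h2
    rw [h1, h2, hinv, ContinuousLinearMap.comp_id]
  -- Differentiating the pull-back adds a term with the second derivative of τ. It is symmetric in A
  -- and B and disappears on antisymmetrizing.
  have hmain : ∀ A B : E × E, fderiv ℝ (formInChart α w) q₀ A B =
      fderiv ℝ (formInChart α v) (φv w) (chartDeriv v w A) (chartDeriv v w B) +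
      formInChart α v (φv w) (fderiv ℝ (fderiv ℝ τ) q₀ A B) := by
    intro A B
    have h0 : (fun q => formInChart α w q B) =ᶠ[𝓝 q₀]
        fun q => formInChart α v (τ q) (fderiv ℝ τ q B) := by
      filter_upwards [hpull] with q hq
      rw [hq]; rfl
    have h1 := (hα'.comp q₀ hτd).clm_apply (hτdd.clm_apply (hasFDerivAt_const B q₀))
    have h2 := h1.congr_of_eventuallyEq h0
    have hd : DifferentiableAt ℝ (formInChart α w) q₀ :=
      ((hα'.comp q₀ hτd).clm_comp hτdd).differentiableAt.congr_of_eventuallyEq hpull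
    have h3 := hd.hasFDerivAt.clm_apply (hasFDerivAt_const B q₀)
    have h4 := congrArg (fun C : E × E →L[ℝ] ℝ => C A) (h3.unique h2)
    simp only [Function.comp_apply, add_apply, ContinuousLinearMap.comp_apply,
      ContinuousLinearMap.flip_apply, zero_apply, map_zero, zero_add, hdτ, hτq₀] at h4
    rw [h4]; ring
  have hsymm := (hτs.isSymmSndFDerivAt minSmoothness_two_le_infty).eq
  have hX : extDerivForm α w X Y = fderiv ℝ (formInChart α w) q₀ (chartDeriv w w X)
      (chartDeriv w w Y) - fderiv ℝ (formInChart α w) q₀ (chartDeriv w w Y)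
      (chartDeriv w w X) := rfl
  have key : ∀ A B : E × E,
      fderiv ℝ (formInChart α w) q₀ A B - fderiv ℝ (formInChart α w) q₀ B A =
      fderiv ℝ (formInChart α v) (φv w) (chartDeriv v w A) (chartDeriv v w B) -
      fderiv ℝ (formInChart α v) (φv w) (chartDeriv v w B) (chartDeriv v w A) := fun A B => by
    rw [hmain, hmain, hsymm A B]; ring
  rw [hX, hself]
  exact key X Y

section Spray

variable (hF : IsFinslerMetric F) (hw : w ∈ (extChartAt 𝓘(ℝ, E).tangent v).source)
  (hw₀ : w ∈ puncturedTangentBundle E M)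
include hF hw hw₀

/-- The definition at w uses the chart at w. Passing to the fixed chart at v gives an expression
that varies smoothly with w. -/
lemma omegaForm_eq (X Y : TangentSpace 𝓘(ℝ, E).tangent w) :
    omegaForm F w X Y = coordOmega (coordEnergy F v) (extChartAt 𝓘(ℝ, E).tangent v w)
      (chartDeriv v w X) (chartDeriv v w Y) := by
  have hmem := (chart_mem_chartDomain_iff hw).2 hw₀
  have h1 : formInChart (alphaForm F) v =ᶠ[𝓝 (extChartAt 𝓘(ℝ, E).tangent v w)] fun p =>
      (fderiv ℝ (coordEnergy F v) p).comp (coordTangent E) := by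
    filter_upwards [isOpen_chartDomain.mem_nhds hmem] with p hp using formInChart_alphaForm hF hp
  have h2 := ((ContinuousLinearMap.compL ℝ (E × E) (E × E) ℝ).flip
    (coordTangent E)).hasFDerivAt.comp _ ((isCoordEnergy (v := v) hF).hasFDerivAt_fderiv hmem)
  have h3 : HasFDerivAt (formInChart (alphaForm F) v) _ _ := h2.congr_of_eventuallyEq h1
  rw [omegaForm, extDerivForm_eq hw h3.differentiableAt, h3.fderiv, coordOmega]
  simp

lemma mfderiv_energy (Y : TangentSpace 𝓘(ℝ, E).tangent w) :
    mfderiv 𝓘(ℝ, E).tangent 𝓘(ℝ, ℝ) (energy F) w Y =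
      fderiv ℝ (coordEnergy F v) (extChartAt 𝓘(ℝ, E).tangent v w) (chartDeriv v w Y) := by
  have hmem := (chart_mem_chartDomain_iff hw).2 hw₀
  have h1 := (((isCoordEnergy (v := v) hF).hasFDerivAt hmem).hasMFDerivAt).comp w
    (hasMFDerivAt_chart hw)
  have h2 : HasMFDerivAt 𝓘(ℝ, E).tangent 𝓘(ℝ, ℝ) (energy F) w _ :=
    h1.congr_of_eventuallyEq (by
      filter_upwards [(isOpen_extChartAt_source v).mem_nhds hw] with q hq using
        (coordEnergy_chart hq).symm)
  rw [h2.mfderiv]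
  rfl

/-- The geodesic spray in a chart. -/
lemma chartDeriv_geodesicSpray [FiniteDimensional ℝ E] :
    chartDeriv v w (geodesicSpray F w) = ((extChartAt 𝓘(ℝ, E).tangent v w).2,
      coordForce (coordEnergy F v) (extChartAt 𝓘(ℝ, E).tangent v w)) := by
  have hmem := (chart_mem_chartDomain_iff hw).2 hw₀
  have hiff : ∀ X : TangentSpace 𝓘(ℝ, E).tangent w, (∀ Y : TangentSpace 𝓘(ℝ, E).tangent w,
      omegaForm F w X Y = mfderiv 𝓘(ℝ, E).tangent 𝓘(ℝ, ℝ) (energy F) w Y) ↔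
      chartDeriv v w X = ((extChartAt 𝓘(ℝ, E).tangent v w).2,
      coordForce (coordEnergy F v) (extChartAt 𝓘(ℝ, E).tangent v w)) := by
    intro X
    rw [← (isCoordEnergy (v := v) hF).coordOmega_eq_iff hmem]
    constructor
    · intro h Y'
      obtain ⟨Y, rfl⟩ := chartDeriv_surjective hw Y'
      exact (omegaForm_eq hF hw hw₀ X Y).symm.trans ((h Y).trans (mfderiv_energy hF hw hw₀ Y))
    · intro h Y
      exact (omegaForm_eq hF hw hw₀ X Y).trans ((h _).trans (mfderiv_energy hF hw hw₀ Y).symm)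
  obtain ⟨X, hX⟩ := chartDeriv_surjective hw ((extChartAt 𝓘(ℝ, E).tangent v w).2,
      coordForce (coordEnergy F v) (extChartAt 𝓘(ℝ, E).tangent v w))
  have hex : ∃ X : TangentSpace 𝓘(ℝ, E).tangent w, ∀ Y : TangentSpace 𝓘(ℝ, E).tangent w,
      omegaForm F w X Y = mfderiv 𝓘(ℝ, E).tangent 𝓘(ℝ, ℝ) (energy F) w Y := ⟨X, (hiff X).2 hX⟩
  exact (hiff _).1 (Classical.epsilon_spec hex)

end Spray

end Energy

/-! ### Vector fields on `TM`, Lie brackets and horizontal lifts in a chart. -/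

section Fields

variable {E : Type*} [NormedAddCommGroup E] [NormedSpace ℝ E]
  {M : Type*} [TopologicalSpace M] [ChartedSpace E M] [IsManifold 𝓘(ℝ, E) ∞ M]

/-- A vector field on `TM`, read in the preferred chart at `v`. -/
def readField (v : TangentBundle 𝓘(ℝ, E) M)
    (V : ∀ w : TangentBundle 𝓘(ℝ, E) M, TangentSpace 𝓘(ℝ, E).tangent w) (p : E × E) : E × E :=
  chartDeriv v ((extChartAt 𝓘(ℝ, E).tangent v).symm p)
    (V ((extChartAt 𝓘(ℝ, E).tangent v).symm p))

variable {v w : TangentBundle 𝓘(ℝ, E) M} {p : E × E}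
  {V W : ∀ w : TangentBundle 𝓘(ℝ, E) M, TangentSpace 𝓘(ℝ, E).tangent w}

lemma readField_chart (hw : w ∈ (extChartAt 𝓘(ℝ, E).tangent v).source) :
    readField v V (extChartAt 𝓘(ℝ, E).tangent v w) = chartDeriv v w (V w) := by
  rw [readField, (extChartAt 𝓘(ℝ, E).tangent v).left_inv hw]

/-- A map to a normed space is differentiable iff its expression in a chart is. -/
lemma mdifferentiableAt_iff_comp_chart_symm {G : Type*} [NormedAddCommGroup G] [NormedSpace ℝ G]
    {g : TangentBundle 𝓘(ℝ, E) M → G} (hw : w ∈ (extChartAt 𝓘(ℝ, E).tangent v).source) :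
    MDifferentiableAt 𝓘(ℝ, E).tangent 𝓘(ℝ, G) g w ↔
      DifferentiableAt ℝ (g ∘ (extChartAt 𝓘(ℝ, E).tangent v).symm)
        (extChartAt 𝓘(ℝ, E).tangent v w) := by
  have hinv := (extChartAt 𝓘(ℝ, E).tangent v).left_inv hw
  constructor
  · intro h
    have h1 : MDifferentiableAt 𝓘(ℝ, E).tangent 𝓘(ℝ, G) g
        ((extChartAt 𝓘(ℝ, E).tangent v).symm (extChartAt 𝓘(ℝ, E).tangent v w)) := by rwa [hinv]
    exact (h1.comp _ (hasMFDerivAt_chart_symm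
      ((extChartAt 𝓘(ℝ, E).tangent v).map_source hw)).mdifferentiableAt).differentiableAt
  · intro h
    have h1 := h.mdifferentiableAt.comp w (hasMFDerivAt_chart hw).mdifferentiableAt
    refine h1.congr_of_eventuallyEq ?_
    filter_upwards [(isOpen_extChartAt_source v).mem_nhds hw] with q hq
    simp only [Function.comp_apply]
    rw [(extChartAt 𝓘(ℝ, E).tangent v).left_inv hq]

lemma trivializationAt_tangent_snd (hw : w ∈ (extChartAt 𝓘(ℝ, E).tangent v).source)
    (X : TangentSpace 𝓘(ℝ, E).tangent w) :
    (trivializationAt (E × E) (TangentSpace 𝓘(ℝ, E).tangent :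
      TangentBundle 𝓘(ℝ, E) M → Type _) v ⟨w, X⟩).2 = chartDeriv v w X := by
  have hw' : w ∈ (chartAt (ModelProd E E) v).source := by
    rwa [extChartAt_source] at hw
  have h1 : chartDeriv v w = (trivializationAt (E × E) (TangentSpace 𝓘(ℝ, E).tangent :
      TangentBundle 𝓘(ℝ, E) M → Type _) v).continuousLinearMapAt ℝ w :=
    (TangentBundle.continuousLinearMapAt_trivializationAt hw').symm
  rw [h1]
  exact (congrFun ((trivializationAt (E × E) (TangentSpace 𝓘(ℝ, E).tangent :
      TangentBundle 𝓘(ℝ, E) M → Type _) v).coe_linearMapAt_of_mem (R := ℝ) hw') X).symm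

lemma mdifferentiableAt_field_iff (hw : w ∈ (extChartAt 𝓘(ℝ, E).tangent v).source) :
    MDifferentiableAt 𝓘(ℝ, E).tangent 𝓘(ℝ, E).tangent.tangent
      (fun w => (⟨w, V w⟩ : TangentBundle 𝓘(ℝ, E).tangent (TangentBundle 𝓘(ℝ, E) M))) w ↔
      DifferentiableAt ℝ (readField v V) (extChartAt 𝓘(ℝ, E).tangent v w) := by
  have hw' : w ∈ (chartAt (ModelProd E E) v).source := by
    rwa [extChartAt_source] at hw
  rw [(trivializationAt (E × E) (TangentSpace 𝓘(ℝ, E).tangent :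
      TangentBundle 𝓘(ℝ, E) M → Type _) v).mdifferentiableAt_section_iff 𝓘(ℝ, E).tangent V hw',
    mdifferentiableAt_iff_comp_chart_symm hw]
  refine Filter.EventuallyEq.differentiableAt_iff ?_
  filter_upwards [target_mem_nhds ((extChartAt 𝓘(ℝ, E).tangent v).map_source hw)] with q hq
  exact trivializationAt_tangent_snd ((extChartAt 𝓘(ℝ, E).tangent v).map_target hq) _

lemma chartSymmDeriv_inverse (hp : p ∈ (extChartAt 𝓘(ℝ, E).tangent v).target) :
    (chartSymmDeriv v p).inverse = chartDeriv v ((extChartAt 𝓘(ℝ, E).tangent v).symm p) := by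
  obtain ⟨e, he⟩ := isInvertible_chartDeriv ((extChartAt 𝓘(ℝ, E).tangent v).map_target hp)
  have h1 := chartDeriv_comp_symm hp
  have h2 : chartSymmDeriv v p = e.symm := by
    refine ContinuousLinearMap.ext fun X => ?_
    apply e.injective
    rw [← he] at h1
    simpa using congrArg (fun B : E × E →L[ℝ] E × E => B X) h1
  rw [h2, ContinuousLinearMap.inverse_equiv, ← he]
  simp

/-- The Lie bracket of vector fields on `TM` in a chart. -/
lemma chartDeriv_mlieBracket [CompleteSpace E] (hw : w ∈ (extChartAt 𝓘(ℝ, E).tangent v).source)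
    (hV : DifferentiableAt ℝ (readField v V) (extChartAt 𝓘(ℝ, E).tangent v w))
    (hW : DifferentiableAt ℝ (readField v W) (extChartAt 𝓘(ℝ, E).tangent v w)) :
    chartDeriv v w (VectorField.mlieBracket 𝓘(ℝ, E).tangent V W w) =
      VectorField.lieBracket ℝ (readField v V) (readField v W)
        (extChartAt 𝓘(ℝ, E).tangent v w) := by
  obtain ⟨p, hp, rfl⟩ : ∃ p ∈ (extChartAt 𝓘(ℝ, E).tangent v).target,
      w = (extChartAt 𝓘(ℝ, E).tangent v).symm p :=
    ⟨_, (extChartAt 𝓘(ℝ, E).tangent v).map_source hw,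
      ((extChartAt 𝓘(ℝ, E).tangent v).left_inv hw).symm⟩
  rw [← mdifferentiableAt_field_iff hw] at hV hW
  rw [(extChartAt 𝓘(ℝ, E).tangent v).right_inv hp]
  have hpull : ∀ U : ∀ w : TangentBundle 𝓘(ℝ, E) M, TangentSpace 𝓘(ℝ, E).tangent w,
      ∀ q ∈ (extChartAt 𝓘(ℝ, E).tangent v).target,
      VectorField.mpullback 𝓘(ℝ, E × E) 𝓘(ℝ, E).tangent (extChartAt 𝓘(ℝ, E).tangent v).symm U q =
        readField v U q := fun U q hq =>
    congrArg (fun B : E × E →L[ℝ] E × E => B (U _)) (chartSymmDeriv_inverse hq)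
  have hev : ∀ U : ∀ w : TangentBundle 𝓘(ℝ, E) M, TangentSpace 𝓘(ℝ, E).tangent w,
      VectorField.mpullback 𝓘(ℝ, E × E) 𝓘(ℝ, E).tangent (extChartAt 𝓘(ℝ, E).tangent v).symm U
        =ᶠ[𝓝 p] readField v U := fun U => by
    filter_upwards [target_mem_nhds hp] with q hq using hpull U q hq
  have : IsManifold 𝓘(ℝ, E).tangent (minSmoothness ℝ 2) (TangentBundle 𝓘(ℝ, E) M) :=
    IsManifold.of_le (n := ∞) minSmoothness_two_le_infty
  have h1 := VectorField.mpullback_mlieBracket (n := ∞) (I := 𝓘(ℝ, E × E)) hV hW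
    (contMDiffAt_chart_symm hp) minSmoothness_two_le_infty
  have h2 := hpull (VectorField.mlieBracket 𝓘(ℝ, E).tangent V W) p hp
  refine (h2.symm.trans h1).trans ?_
  rw [← VectorField.mlieBracketWithin_univ, VectorField.mlieBracketWithin_eq_lieBracketWithin]
  refine (congrFun VectorField.lieBracketWithin_univ p).trans ?_
  exact (hev V).lieBracket_vectorField_eq (hev W)

lemma differentiableAt_readField_extend (hw : w ∈ (extChartAt 𝓘(ℝ, E).tangent v).source)
    (X : TangentSpace 𝓘(ℝ, E).tangent w) :
    DifferentiableAt ℝ (readField v (FiberBundle.extend (E × E) X))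
      (extChartAt 𝓘(ℝ, E).tangent v w) := by
  rw [← mdifferentiableAt_field_iff hw]
  exact FiberBundle.mdifferentiableAt_extend 𝓘(ℝ, E).tangent (E × E) X

/-- `FiberBundle.extend` is constant in the trivialization at v, so extended vectors become constant
fields in the chart and their brackets vanish. -/
lemma readField_extend (X : TangentSpace 𝓘(ℝ, E).tangent v)
    (hp : p ∈ (extChartAt 𝓘(ℝ, E).tangent v).target) :
    readField v (FiberBundle.extend (E × E) X) p = X := by
  have hsrc := (extChartAt 𝓘(ℝ, E).tangent v).map_target hp
  have hsrc' : (extChartAt 𝓘(ℝ, E).tangent v).symm p ∈ (chartAt (ModelProd E E) v).source := by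
    rwa [extChartAt_source] at hsrc
  rw [readField, ← trivializationAt_tangent_snd hsrc]
  have h1 := (trivializationAt (E × E) (TangentSpace 𝓘(ℝ, E).tangent :
      TangentBundle 𝓘(ℝ, E) M → Type _) v).apply_mk_symm hsrc'
    ((trivializationAt (E × E) (TangentSpace 𝓘(ℝ, E).tangent :
      TangentBundle 𝓘(ℝ, E) M → Type _) v ⟨v, X⟩).2)
  refine (congrArg Prod.snd h1).trans ?_
  rw [trivializationAt_tangent_snd (mem_extChartAt_source v), chartDeriv_self]
  rfl

/-- The canonical connection of a second order differential equation in a chart. -/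
lemma chartDeriv_canonicalConnection [CompleteSpace E]
    {S : ∀ w : TangentBundle 𝓘(ℝ, E) M, TangentSpace 𝓘(ℝ, E).tangent w} {f : E × E → E}
    (hw : w ∈ (extChartAt 𝓘(ℝ, E).tangent v).source)
    (hS : readField v S =ᶠ[𝓝 (extChartAt 𝓘(ℝ, E).tangent v w)] fun p => (p.2, f p))
    (hf : DifferentiableAt ℝ f (extChartAt 𝓘(ℝ, E).tangent v w))
    (X : TangentSpace 𝓘(ℝ, E).tangent w) :
    chartDeriv v w (canonicalConnection S w X) = ((chartDeriv v w X).1,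
      fderiv ℝ f (extChartAt 𝓘(ℝ, E).tangent v w) (0, (chartDeriv v w X).1)
        - (chartDeriv v w X).2) := by
  set p := extChartAt 𝓘(ℝ, E).tangent v w with hp
  set Xe : ∀ w : TangentBundle 𝓘(ℝ, E) M, TangentSpace 𝓘(ℝ, E).tangent w :=
    FiberBundle.extend (E × E) X with hXe
  have hXd : HasFDerivAt (readField v Xe) (fderiv ℝ (readField v Xe) p) p :=
    (differentiableAt_readField_extend hw X).hasFDerivAt
  have hXp : readField v Xe p = chartDeriv v w X := by
    rw [hp, readField_chart hw, hXe, FiberBundle.extend_apply_self]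
  have hSd : HasFDerivAt (readField v S)
      ((ContinuousLinearMap.snd ℝ E E).prod (fderiv ℝ f p)) p :=
    ((ContinuousLinearMap.snd ℝ E E).hasFDerivAt.prodMk hf.hasFDerivAt).congr_of_eventuallyEq hS
  have hJe : readField v (fun w' => almostTangent w' (Xe w')) =ᶠ[𝓝 p]
      fun q => coordTangent E (readField v Xe q) := by
    filter_upwards [target_mem_nhds ((extChartAt 𝓘(ℝ, E).tangent v).map_source hw)] with q hq
    exact chartDeriv_almostTangent ((extChartAt 𝓘(ℝ, E).tangent v).map_target hq) _
  have hJd : HasFDerivAt (readField v (fun w' => almostTangent w' (Xe w')))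
      ((coordTangent E).comp (fderiv ℝ (readField v Xe) p)) p :=
    ((coordTangent E).hasFDerivAt.comp p hXd).congr_of_eventuallyEq hJe
  have h1 := chartDeriv_mlieBracket hw hSd.differentiableAt hJd.differentiableAt
  have h2 := chartDeriv_mlieBracket hw hSd.differentiableAt hXd.differentiableAt
  rw [← hp] at h1 h2
  have h3 : chartDeriv v w (almostTangent w (VectorField.mlieBracket 𝓘(ℝ, E).tangent S Xe w)) =
      coordTangent E (VectorField.lieBracket ℝ (readField v S) (readField v Xe) p) :=
    (chartDeriv_almostTangent hw _).trans (congrArg (coordTangent E) h2)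
  have h4 : chartDeriv v w (canonicalConnection S w X) =
      -(chartDeriv v w (VectorField.mlieBracket 𝓘(ℝ, E).tangent S
          (fun w' => almostTangent w' (Xe w')) w)
        - chartDeriv v w (almostTangent w (VectorField.mlieBracket 𝓘(ℝ, E).tangent S Xe w))) :=
    ((chartDeriv v w).map_neg _).trans (congrArg Neg.neg ((chartDeriv v w).map_sub _ _))
  -- The terms differentiating the extension of X cancel between the two brackets, leaving only DS
  -- and J.
  rw [h4, h1, h3, VectorField.lieBracket, VectorField.lieBracket, hSd.fderiv, hJd.fderiv,
    hJe.eq_of_nhds, hXp]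
  simp

lemma chartDeriv_verticalProjection [CompleteSpace E]
    {S : ∀ w : TangentBundle 𝓘(ℝ, E) M, TangentSpace 𝓘(ℝ, E).tangent w} {f : E × E → E}
    (hw : w ∈ (extChartAt 𝓘(ℝ, E).tangent v).source)
    (hS : readField v S =ᶠ[𝓝 (extChartAt 𝓘(ℝ, E).tangent v w)] fun p => (p.2, f p))
    (hf : DifferentiableAt ℝ f (extChartAt 𝓘(ℝ, E).tangent v w))
    (X : TangentSpace 𝓘(ℝ, E).tangent w) :
    chartDeriv v w (verticalProjection S w X) = (0, (chartDeriv v w X).2 -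
      (1 / 2 : ℝ) • fderiv ℝ f (extChartAt 𝓘(ℝ, E).tangent v w) (0, (chartDeriv v w X).1)) := by
  have h1 : chartDeriv v w (verticalProjection S w X) =
      (1 / 2 : ℝ) • (chartDeriv v w X - chartDeriv v w (canonicalConnection S w X)) :=
    ((chartDeriv v w).map_smul (1 / 2 : ℝ) _).trans
      (congrArg ((1 / 2 : ℝ) • ·) ((chartDeriv v w).map_sub _ _))
  rw [h1, chartDeriv_canonicalConnection hw hS hf]
  refine Prod.ext ?_ ?_
  · simp
  · simp only [Prod.smul_snd, Prod.snd_sub]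
    module

/-- The horizontal lift of `u`, read in the preferred chart. -/
lemma horizontalLift_eq [CompleteSpace E]
    {S : ∀ w : TangentBundle 𝓘(ℝ, E) M, TangentSpace 𝓘(ℝ, E).tangent w} {f : E × E → E}
    (hS : readField v S =ᶠ[𝓝 (extChartAt 𝓘(ℝ, E).tangent v v)] fun p => (p.2, f p))
    (hf : DifferentiableAt ℝ f (extChartAt 𝓘(ℝ, E).tangent v v)) (u : E) :
    horizontalLift S v u =
      (u, (1 / 2 : ℝ) • fderiv ℝ f (extChartAt 𝓘(ℝ, E).tangent v v) (0, u)) := by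
  set p₀ := extChartAt 𝓘(ℝ, E).tangent v v
  have hcan : ∀ X : E × E, canonicalConnection S v X = (X.1, fderiv ℝ f p₀ (0, X.1) - X.2) := by
    intro X
    have h1 := chartDeriv_canonicalConnection (mem_extChartAt_source v) hS hf X
    rw [chartDeriv_self] at h1
    exact h1
  have hpr : ∀ X : E × E, dproj v X = X.1 := by
    intro X
    have h1 := fibreDeriv_dproj (mem_extChartAt_source v) X
    rw [chartDeriv_self, fibreDeriv_self] at h1
    exact h1
  -- The fixed-point equation ∂ᵧf x − y = y has the single solution y = ½ ∂ᵧf x, which pins down the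
  -- vector chosen in `horizontalLift`.
  have hiff : ∀ X : E × E, (canonicalConnection S v X = X ∧ dproj v X = u) ↔
      X = (u, (1 / 2 : ℝ) • fderiv ℝ f p₀ (0, u)) := by
    rintro ⟨x, y⟩
    rw [hcan, hpr]
    constructor
    · rintro ⟨h1, rfl⟩
      have h2 : fderiv ℝ f p₀ (0, x) - y = y := congrArg Prod.snd h1
      refine Prod.ext rfl ?_
      rw [sub_eq_iff_eq_add] at h2
      simp only [h2]
      module
    · intro h
      obtain rfl : x = u := congrArg Prod.fst h
      obtain rfl : y = (1 / 2 : ℝ) • fderiv ℝ f p₀ (0, x) := congrArg Prod.snd h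
      refine ⟨Prod.ext rfl ?_, rfl⟩
      simp only
      module
  have hex : ∃ X : E × E, canonicalConnection S v X = X ∧ dproj v X = u := ⟨_, (hiff _).2 rfl⟩
  exact (hiff _).1 (Classical.epsilon_spec hex)

lemma readField_geodesicSpray [FiniteDimensional ℝ E] {F : TangentBundle 𝓘(ℝ, E) M → ℝ}
    (hF : IsFinslerMetric F) (hp : p ∈ chartDomain v) :
    readField v (geodesicSpray F) p = (p.2, coordForce (coordEnergy F v) p) := by
  rw [readField, chartDeriv_geodesicSpray hF ((extChartAt 𝓘(ℝ, E).tangent v).map_target hp.1)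
    (chart_symm_mem_punctured hp), (extChartAt 𝓘(ℝ, E).tangent v).right_inv hp.1]

lemma readField_geodesicSpray_eventuallyEq [FiniteDimensional ℝ E]
    {F : TangentBundle 𝓘(ℝ, E) M → ℝ} (hF : IsFinslerMetric F) (hp : p ∈ chartDomain v) :
    readField v (geodesicSpray F) =ᶠ[𝓝 p] fun p => (p.2, coordForce (coordEnergy F v) p) := by
  filter_upwards [isOpen_chartDomain.mem_nhds hp] with q hq using readField_geodesicSpray hF hq

end Fields

/-! ### Sections of the vertical bundle in a chart. -/

section Connection

variable {E : Type*} [NormedAddCommGroup E] [NormedSpace ℝ E]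
  {M : Type*} [TopologicalSpace M] [ChartedSpace E M] [IsManifold 𝓘(ℝ, E) ∞ M]

instance : ContMDiffVectorBundle ∞ E (VerticalBundle E M) 𝓘(ℝ, E).tangent :=
  let f : ContMDiffMap 𝓘(ℝ, E).tangent 𝓘(ℝ, E) (TangentBundle 𝓘(ℝ, E) M) M ∞ :=
    ⟨TotalSpace.proj, contMDiff_proj _⟩
  ContMDiffVectorBundle.pullback E (TangentSpace 𝓘(ℝ, E) : M → Type _) 𝓘(ℝ, E).tangent f

instance : ContMDiffVectorBundle 1 E (VerticalBundle E M) 𝓘(ℝ, E).tangent :=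
  let f : ContMDiffMap 𝓘(ℝ, E).tangent 𝓘(ℝ, E) (TangentBundle 𝓘(ℝ, E) M) M 1 :=
    ⟨TotalSpace.proj, contMDiff_proj _⟩
  ContMDiffVectorBundle.pullback E (TangentSpace 𝓘(ℝ, E) : M → Type _) 𝓘(ℝ, E).tangent f

/-- A section of the vertical bundle, read in the preferred chart at `v`. -/
def readSection (v : TangentBundle 𝓘(ℝ, E) M)
    (σ : ∀ w : TangentBundle 𝓘(ℝ, E) M, VerticalBundle E M w) (p : E × E) : E :=
  fibreDeriv v ((extChartAt 𝓘(ℝ, E).tangent v).symm p).proj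
    (σ ((extChartAt 𝓘(ℝ, E).tangent v).symm p))

variable {v w : TangentBundle 𝓘(ℝ, E) M} {p : E × E}
  {σ : ∀ w : TangentBundle 𝓘(ℝ, E) M, VerticalBundle E M w}

lemma readSection_chart (hw : w ∈ (extChartAt 𝓘(ℝ, E).tangent v).source) :
    readSection v σ (extChartAt 𝓘(ℝ, E).tangent v w) = fibreDeriv v w.proj (σ w) := by
  rw [readSection, (extChartAt 𝓘(ℝ, E).tangent v).left_inv hw]

lemma trivializationAt_vertical_snd (hw : w ∈ (extChartAt 𝓘(ℝ, E).tangent v).source)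
    (z : VerticalBundle E M w) :
    (trivializationAt E (VerticalBundle E M) v ⟨w, z⟩).2 = fibreDeriv v w.proj z := by
  have hx' : w.proj ∈ (chartAt E v.proj).source := by simpa using hw
  have h1 : fibreDeriv v w.proj =
      (trivializationAt E (TangentSpace 𝓘(ℝ, E)) v.proj).continuousLinearMapAt ℝ w.proj :=
    (TangentBundle.continuousLinearMapAt_trivializationAt hx').symm
  rw [h1]
  exact (congrFun ((trivializationAt E (TangentSpace 𝓘(ℝ, E)) v.proj).coe_linearMapAt_of_mem
    (R := ℝ) hx') z).symm

lemma mem_baseSet_vertical (hw : w ∈ (extChartAt 𝓘(ℝ, E).tangent v).source) :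
    w ∈ (trivializationAt E (VerticalBundle E M) v).baseSet := by
  have hx' : w.proj ∈ (chartAt E v.proj).source := by simpa using hw
  exact hx'

lemma mdifferentiableAt_section_iff (hw : w ∈ (extChartAt 𝓘(ℝ, E).tangent v).source) :
    MDifferentiableAt 𝓘(ℝ, E).tangent (𝓘(ℝ, E).tangent.prod 𝓘(ℝ, E))
      (fun w => (⟨w, σ w⟩ : TotalSpace E (VerticalBundle E M))) w ↔
      DifferentiableAt ℝ (readSection v σ) (extChartAt 𝓘(ℝ, E).tangent v w) := by
  rw [(trivializationAt E (VerticalBundle E M) v).mdifferentiableAt_section_iff 𝓘(ℝ, E).tangent σ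
    (mem_baseSet_vertical hw), mdifferentiableAt_iff_comp_chart_symm hw]
  refine Filter.EventuallyEq.differentiableAt_iff ?_
  filter_upwards [target_mem_nhds ((extChartAt 𝓘(ℝ, E).tangent v).map_source hw)] with q hq
  exact trivializationAt_vertical_snd ((extChartAt 𝓘(ℝ, E).tangent v).map_target hq) _

lemma readSection_extend (z : VerticalBundle E M v)
    (hp : p ∈ (extChartAt 𝓘(ℝ, E).tangent v).target) :
    readSection v (FiberBundle.extend E z) p = z := by
  have hsrc := (extChartAt 𝓘(ℝ, E).tangent v).map_target hp
  rw [readSection, ← trivializationAt_vertical_snd hsrc]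
  have h1 := (trivializationAt E (VerticalBundle E M) v).apply_mk_symm (mem_baseSet_vertical hsrc)
    ((trivializationAt E (VerticalBundle E M) v ⟨v, z⟩).2)
  refine (congrArg Prod.snd h1).trans ?_
  rw [trivializationAt_vertical_snd (mem_extChartAt_source v), fibreDeriv_self]
  rfl

lemma readSection_canonicalField (hp : p ∈ (extChartAt 𝓘(ℝ, E).tangent v).target) :
    readSection v canonicalField p = p.2 := by
  have h1 := snd_chart ((extChartAt 𝓘(ℝ, E).tangent v).map_target hp)
  rw [(extChartAt 𝓘(ℝ, E).tangent v).right_inv hp] at h1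
  exact h1.symm

end Connection

/-! ### Connection coefficients in a chart. -/

section Coefficients

variable {E : Type*} [NormedAddCommGroup E] [NormedSpace ℝ E]
  {M : Type*} [TopologicalSpace M] [ChartedSpace E M] [IsManifold 𝓘(ℝ, E) ∞ M]

/-- The derivative along `p ↦ B p (g p)`, for `B p` linear. -/
lemma fderiv_apply_of_isLinearMap {G E' : Type*} [NormedAddCommGroup G] [NormedSpace ℝ G]
    [NormedAddCommGroup E'] [NormedSpace ℝ E'] [FiniteDimensional ℝ E] {B : G → E → E'}
    {g : G → E} {p₀ : G} (hlin : ∀ᶠ p in 𝓝 p₀, IsLinearMap ℝ (B p))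
    (hd : ∀ z, DifferentiableAt ℝ (fun p => B p z) p₀) (hg : DifferentiableAt ℝ g p₀) (Y : G) :
    fderiv ℝ (fun p => B p (g p)) p₀ Y =
      fderiv ℝ (fun p => B p (g p₀)) p₀ Y + B p₀ (fderiv ℝ g p₀ Y) := by
  -- Linearity near p₀ and differentiability for each fixed argument are assembled, through a finite
  -- basis, into a differentiable family of continuous linear maps, to which the product rule
  -- applies.
  let b := Module.finBasis ℝ E
  let B' : G → E →L[ℝ] E' := fun p =>
    ∑ i, (b.coord i).toContinuousLinearMap.smulRight (B p (b i))
  have hB : ∀ᶠ p in 𝓝 p₀, ∀ z, B p z = B' p z := by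
    filter_upwards [hlin] with p hp z
    have h1 : hp.mk' (B p) z = hp.mk' (B p) (∑ i, b.coord i z • b i) := by
      congr 1; exact (b.sum_repr z).symm
    rw [map_sum] at h1
    simp only [map_smul] at h1
    simpa [B'] using h1
  have hBd : DifferentiableAt ℝ B' p₀ := by
    refine DifferentiableAt.fun_sum fun i _ => ?_
    exact ((ContinuousLinearMap.smulRightL ℝ E E'
      (b.coord i).toContinuousLinearMap).differentiableAt).comp p₀ (hd (b i))
  have h1 : (fun p => B p (g p)) =ᶠ[𝓝 p₀] fun p => B' p (g p) := hB.mono fun p hp => hp _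
  have h2 : (fun p => B p (g p₀)) =ᶠ[𝓝 p₀] fun p => B' p (g p₀) := hB.mono fun p hp => hp _
  rw [h1.fderiv_eq, h2.fderiv_eq, hB.self_of_nhds,
    (hBd.hasFDerivAt.clm_apply hg.hasFDerivAt).fderiv,
    (hBd.hasFDerivAt.clm_apply (hasFDerivAt_const (g p₀) p₀)).fderiv]
  simp [add_comm]

variable {v w : TangentBundle 𝓘(ℝ, E) M} {p : E × E}
  {σ : ∀ w : TangentBundle 𝓘(ℝ, E) M, VerticalBundle E M w}

lemma mfderiv_eq_fderiv_chart {G : Type*} [NormedAddCommGroup G] [NormedSpace ℝ G]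
    {g : TangentBundle 𝓘(ℝ, E) M → G} (hw : w ∈ (extChartAt 𝓘(ℝ, E).tangent v).source)
    (hg : MDifferentiableAt 𝓘(ℝ, E).tangent 𝓘(ℝ, G) g w) (Y : TangentSpace 𝓘(ℝ, E).tangent w) :
    mfderiv 𝓘(ℝ, E).tangent 𝓘(ℝ, G) g w Y =
      fderiv ℝ (g ∘ (extChartAt 𝓘(ℝ, E).tangent v).symm) (extChartAt 𝓘(ℝ, E).tangent v w)
        (chartDeriv v w Y) := by
  have h1 := ((mdifferentiableAt_iff_comp_chart_symm hw).1 hg).hasFDerivAt.hasMFDerivAt.comp w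
    (hasMFDerivAt_chart hw)
  have h2 : HasMFDerivAt 𝓘(ℝ, E).tangent 𝓘(ℝ, G) g w _ :=
    h1.congr_of_eventuallyEq (by
      filter_upwards [(isOpen_extChartAt_source v).mem_nhds hw] with q hq using
        congrArg g ((extChartAt 𝓘(ℝ, E).tangent v).left_inv hq).symm)
  rw [h2.mfderiv]
  rfl

variable {D : (∀ w : TangentBundle 𝓘(ℝ, E) M, VerticalBundle E M w) →
      ∀ w : TangentBundle 𝓘(ℝ, E) M,
        TangentSpace 𝓘(ℝ, E).tangent w →L[ℝ] VerticalBundle E M w}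

/-- The connection form of `D` in the trivialization given by the preferred chart at `v`. -/
def connectionCoeff (D : (∀ w : TangentBundle 𝓘(ℝ, E) M, VerticalBundle E M w) →
      ∀ w : TangentBundle 𝓘(ℝ, E) M,
        TangentSpace 𝓘(ℝ, E).tangent w →L[ℝ] VerticalBundle E M w)
    (v : TangentBundle 𝓘(ℝ, E) M) (p : E × E) (z : E) (X : E × E) : E :=
  readSection v (fun w => D (FiberBundle.extend E (show VerticalBundle E M v from z)) w
    (FiberBundle.extend (E × E) (show TangentSpace 𝓘(ℝ, E).tangent v from X) w)) p

lemma connectionCoeff_chart (hw : w ∈ (extChartAt 𝓘(ℝ, E).tangent v).source) (z : E)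
    (X : TangentSpace 𝓘(ℝ, E).tangent w) :
    connectionCoeff D v (extChartAt 𝓘(ℝ, E).tangent v w) z (chartDeriv v w X) =
      fibreDeriv v w.proj (D (FiberBundle.extend E (show VerticalBundle E M v from z)) w X) := by
  have h1 : FiberBundle.extend (E × E)
      (show TangentSpace 𝓘(ℝ, E).tangent v from chartDeriv v w X) w = X := by
    apply chartDeriv_injective hw
    rw [← readField_chart hw]
    exact readField_extend _ ((extChartAt 𝓘(ℝ, E).tangent v).map_source hw)
  rw [connectionCoeff, readSection_chart hw, h1]

lemma fderiv_readSection_add {σ' : ∀ w : TangentBundle 𝓘(ℝ, E) M, VerticalBundle E M w}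
    (hσ : DifferentiableAt ℝ (readSection v σ) p) (hσ' : DifferentiableAt ℝ (readSection v σ') p) :
    fderiv ℝ (readSection v (σ + σ')) p =
      fderiv ℝ (readSection v σ) p + fderiv ℝ (readSection v σ') p := by
  have h1 : readSection v (σ + σ') = readSection v σ + readSection v σ' := by
    funext q
    exact (fibreDeriv v ((extChartAt 𝓘(ℝ, E).tangent v).symm q).proj).map_add _ _
  rw [h1, fderiv_add hσ hσ']

lemma fderiv_readSection_smul {g : TangentBundle 𝓘(ℝ, E) M → ℝ}
    (hσ : DifferentiableAt ℝ (readSection v σ) p)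
    (hg : DifferentiableAt ℝ (g ∘ (extChartAt 𝓘(ℝ, E).tangent v).symm) p) :
    fderiv ℝ (readSection v (g • σ)) p =
      g ((extChartAt 𝓘(ℝ, E).tangent v).symm p) • fderiv ℝ (readSection v σ) p +
      (fderiv ℝ (g ∘ (extChartAt 𝓘(ℝ, E).tangent v).symm) p).smulRight (readSection v σ p) := by
  have h1 : readSection v (g • σ) =
      (g ∘ (extChartAt 𝓘(ℝ, E).tangent v).symm) • readSection v σ := by
    funext q
    exact (fibreDeriv v ((extChartAt 𝓘(ℝ, E).tangent v).symm q).proj).map_smul _ _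
  rw [h1, fderiv_smul hg hσ]
  rfl

lemma hasFDerivAt_readSection_extend (z : VerticalBundle E M v)
    (hp : p ∈ (extChartAt 𝓘(ℝ, E).tangent v).target) :
    HasFDerivAt (readSection v (FiberBundle.extend E z)) (0 : E × E →L[ℝ] E) p := by
  refine (hasFDerivAt_const (z : E) p).congr_of_eventuallyEq ?_
  filter_upwards [target_mem_nhds hp] with q hq using readSection_extend z hq

/-- The connection and the flat derivative of the chart obey the same Leibniz rule, so their
difference depends only on the value of the section at w. -/
lemma tensorialAt_connection_sub
    (hD : IsCovariantDerivativeOn (I := 𝓘(ℝ, E).tangent) E D (puncturedTangentBundle E M))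
    (hw : w ∈ (extChartAt 𝓘(ℝ, E).tangent v).source) (hw₀ : w ∈ puncturedTangentBundle E M)
    (X : TangentSpace 𝓘(ℝ, E).tangent w) :
    TensorialAt 𝓘(ℝ, E).tangent E
      (fun σ : (∀ w : TangentBundle 𝓘(ℝ, E) M, VerticalBundle E M w) =>
      fibreDeriv v w.proj (D σ w X) -
        fderiv ℝ (readSection v σ) (extChartAt 𝓘(ℝ, E).tangent v w) (chartDeriv v w X)) w := by
  constructor
  · intro g σ hg hσ
    have h1 := congrArg (fun B : E × E →L[ℝ] E => fibreDeriv v w.proj (B X))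
      (hD.leibniz hσ hg hw₀)
    rw [mdifferentiableAt_section_iff hw] at hσ
    have h2 := mfderiv_eq_fderiv_chart hw hg X
    rw [mdifferentiableAt_iff_comp_chart_symm hw] at hg
    have h3 := fderiv_readSection_smul hσ hg
    rw [(extChartAt 𝓘(ℝ, E).tangent v).left_inv hw, readSection_chart hw] at h3
    have h4 : fibreDeriv v w.proj (D (g • σ) w X) = g w • fibreDeriv v w.proj (D σ w X) +
        (fderiv ℝ (g ∘ (extChartAt 𝓘(ℝ, E).tangent v).symm) (extChartAt 𝓘(ℝ, E).tangent v w)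
          (chartDeriv v w X)) • fibreDeriv v w.proj (σ w) := by
      rw [← h2]
      refine h1.trans (((fibreDeriv v w.proj).map_add _ _).trans ?_)
      exact congrArg₂ (· + ·) ((fibreDeriv v w.proj).map_smul _ _)
        ((fibreDeriv v w.proj).map_smul _ _)
    simp only [h4, h3, add_apply, smul_apply, ContinuousLinearMap.smulRight_apply]
    module
  · intro σ σ' hσ hσ'
    have h1 := congrArg (fun B : E × E →L[ℝ] E => fibreDeriv v w.proj (B X))
      (hD.add hσ hσ' hw₀)
    rw [mdifferentiableAt_section_iff hw] at hσ hσ'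
    have h3 := fderiv_readSection_add hσ hσ'
    have h4 : fibreDeriv v w.proj (D (σ + σ') w X) = fibreDeriv v w.proj (D σ w X) +
        fibreDeriv v w.proj (D σ' w X) := h1.trans ((fibreDeriv v w.proj).map_add _ _)
    simp only [h4, h3, add_apply]
    abel

variable [FiniteDimensional ℝ E]

/-- A connection on the vertical bundle in a chart. -/
lemma fibreDeriv_connection
    (hD : IsCovariantDerivativeOn (I := 𝓘(ℝ, E).tangent) E D (puncturedTangentBundle E M))
    (hw : w ∈ (extChartAt 𝓘(ℝ, E).tangent v).source) (hw₀ : w ∈ puncturedTangentBundle E M)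
    (hσ : DifferentiableAt ℝ (readSection v σ) (extChartAt 𝓘(ℝ, E).tangent v w))
    (X : TangentSpace 𝓘(ℝ, E).tangent w) :
    fibreDeriv v w.proj (D σ w X) =
      fderiv ℝ (readSection v σ) (extChartAt 𝓘(ℝ, E).tangent v w) (chartDeriv v w X) +
      connectionCoeff D v (extChartAt 𝓘(ℝ, E).tangent v w) (fibreDeriv v w.proj (σ w))
        (chartDeriv v w X) := by
  have hp := (extChartAt 𝓘(ℝ, E).tangent v).map_source hw
  set z : VerticalBundle E M v := fibreDeriv v w.proj (σ w) with hz
  have h0 := hasFDerivAt_readSection_extend z hp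
  have h1 : FiberBundle.extend E z w = σ w := by
    apply fibreDeriv_injective (mem_source_iff.1 hw)
    exact (readSection_chart (σ := FiberBundle.extend E z) hw).symm.trans (readSection_extend z hp)
  -- The section is compared with the chart-constant section of equal value at w, whose flat
  -- derivative is zero.
  have h2 := (tensorialAt_connection_sub hD hw hw₀ X).pointwise
    ((mdifferentiableAt_section_iff hw).2 hσ)
    ((mdifferentiableAt_section_iff hw).2 h0.differentiableAt) h1.symm
  rw [h0.fderiv, zero_apply, sub_zero, sub_eq_iff_eq_add'] at h2
  rw [h2]
  exact congrArg _ (connectionCoeff_chart hw z X).symm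

lemma isLinearMap_connectionCoeff
    (hD : IsCovariantDerivativeOn (I := 𝓘(ℝ, E).tangent) E D (puncturedTangentBundle E M))
    (hp : p ∈ chartDomain v) (X : E × E) :
    IsLinearMap ℝ fun z => connectionCoeff D v p z X := by
  obtain ⟨w, hw, rfl⟩ : ∃ w ∈ (extChartAt 𝓘(ℝ, E).tangent v).source,
      extChartAt 𝓘(ℝ, E).tangent v w = p :=
    ⟨_, (extChartAt 𝓘(ℝ, E).tangent v).map_target hp.1,
      (extChartAt 𝓘(ℝ, E).tangent v).right_inv hp.1⟩
  have hw₀ := (chart_mem_chartDomain_iff hw).1 hp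
  obtain ⟨X, rfl⟩ := chartDeriv_surjective hw X
  have hd := fun z : VerticalBundle E M v => hasFDerivAt_readSection_extend z hp.1
  have hm := fun z : VerticalBundle E M v =>
    (mdifferentiableAt_section_iff hw).2 (hd z).differentiableAt
  have hv : ∀ z : VerticalBundle E M v, fibreDeriv v w.proj (FiberBundle.extend E z w) = z :=
    fun z => (readSection_chart (σ := FiberBundle.extend E z) hw).symm.trans
      (readSection_extend z hp.1)
  constructor
  · intro z z'
    have h1 := fibreDeriv_connection hD hw hw₀ (σ := FiberBundle.extend E
      (show VerticalBundle E M v from z) + FiberBundle.extend E (show VerticalBundle E M v from z'))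
      ((mdifferentiableAt_section_iff hw).1 (mdifferentiableAt_add_section (hm z) (hm z'))) X
    have h2 := congrArg (fun B : E × E →L[ℝ] E => fibreDeriv v w.proj (B X))
      (hD.add (hm z) (hm z') hw₀)
    have h3 : fibreDeriv v w.proj ((FiberBundle.extend E
      (show VerticalBundle E M v from z) + FiberBundle.extend E
      (show VerticalBundle E M v from z')) w) = z + z' :=
      ((fibreDeriv v w.proj).map_add _ _).trans (congrArg₂ (· + ·) (hv z) (hv z'))
    rw [fderiv_readSection_add (hd z).differentiableAt (hd z').differentiableAt, (hd z).fderiv,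
      (hd z').fderiv, add_zero, zero_apply, zero_add, h3] at h1
    refine h1.symm.trans (h2.trans (((fibreDeriv v w.proj).map_add _ _).trans ?_))
    exact congrArg₂ (· + ·) (connectionCoeff_chart hw z X).symm (connectionCoeff_chart hw z' X).symm
  · intro c z
    have hc : MDifferentiableAt 𝓘(ℝ, E).tangent 𝓘(ℝ, ℝ)
        (fun _ : TangentBundle 𝓘(ℝ, E) M => c) w := mdifferentiableAt_const
    have h1 := fibreDeriv_connection hD hw hw₀ (σ := (fun _ : TangentBundle 𝓘(ℝ, E) M => c) •
      FiberBundle.extend E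
      (show VerticalBundle E M v from z))
      ((mdifferentiableAt_section_iff hw).1 (hc.smul_section (hm z))) X
    have h2 := congrArg (fun B : E × E →L[ℝ] E => fibreDeriv v w.proj (B X))
      (hD.smul_const c (hm z) hw₀)
    have h3 : fibreDeriv v w.proj (((fun _ : TangentBundle 𝓘(ℝ, E) M => c) •
      FiberBundle.extend E
      (show VerticalBundle E M v from z)) w) = c • z :=
      ((fibreDeriv v w.proj).map_smul _ _).trans (congrArg (c • ·) (hv z))
    have h5 : fderiv ℝ ((fun _ : TangentBundle 𝓘(ℝ, E) M => c) ∘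
      (extChartAt 𝓘(ℝ, E).tangent v).symm) (extChartAt 𝓘(ℝ, E).tangent v w) = 0 :=
      (hasFDerivAt_const c _).fderiv
    rw [fderiv_readSection_smul (hd z).differentiableAt (differentiableAt_const c),
      (hd z).fderiv, h5, h3] at h1
    simp only [smul_zero, zero_apply, ContinuousLinearMap.smulRight_apply, zero_smul,
      zero_add] at h1
    refine h1.symm.trans (h2.trans (((fibreDeriv v w.proj).map_smul _ _).trans ?_))
    exact congrArg (c • ·) (connectionCoeff_chart hw z X).symm

/-- C is read as (x, y) ↦ y, with flat derivative X₂, while P_𝒱(X) is read as X₂ − ½ ∂ᵧf X₁; the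
coefficient is the difference. -/
lemma connectionCoeff_canonicalField
    {S : ∀ w : TangentBundle 𝓘(ℝ, E) M, TangentSpace 𝓘(ℝ, E).tangent w} {f : E × E → E}
    (hD : IsSprayConnection S D) (hp : p ∈ chartDomain v)
    (hS : readField v S =ᶠ[𝓝 p] fun p => (p.2, f p))
    (hf : DifferentiableAt ℝ f p) (X : E × E) :
    connectionCoeff D v p p.2 X = -((1 / 2 : ℝ) • fderiv ℝ f p (0, X.1)) := by
  have : CompleteSpace E := FiniteDimensional.complete ℝ E
  obtain ⟨w, hw, rfl⟩ : ∃ w ∈ (extChartAt 𝓘(ℝ, E).tangent v).source,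
      extChartAt 𝓘(ℝ, E).tangent v w = p :=
    ⟨_, (extChartAt 𝓘(ℝ, E).tangent v).map_target hp.1,
      (extChartAt 𝓘(ℝ, E).tangent v).right_inv hp.1⟩
  have hw₀ := (chart_mem_chartDomain_iff hw).1 hp
  obtain ⟨X, rfl⟩ := chartDeriv_surjective hw X
  have hd : HasFDerivAt (readSection v canonicalField) (ContinuousLinearMap.snd ℝ E E)
      (extChartAt 𝓘(ℝ, E).tangent v w) := by
    refine (ContinuousLinearMap.snd ℝ E E).hasFDerivAt.congr_of_eventuallyEq ?_
    filter_upwards [target_mem_nhds hp.1] with q hq using readSection_canonicalField hq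
  have h1 := fibreDeriv_connection hD.isCovariantDerivativeOn hw hw₀ hd.differentiableAt X
  have h2 := congrArg (chartDeriv v w) (hD.lift w hw₀ X)
  have h3 := (chartDeriv_verticalLift hw _).symm.trans
    (h2.trans (chartDeriv_verticalProjection hw hS hf X))
  have h4 := congrArg Prod.snd h3
  rw [hd.fderiv] at h1
  have h5 := h1.symm.trans h4
  rw [snd_chart hw]
  exact add_left_cancel (h5.trans (sub_eq_add_neg _ _))

end Coefficients

/-! ### The curvature endomorphism of a spray connection. -/

section Curvature

variable {E : Type*} [NormedAddCommGroup E] [NormedSpace ℝ E]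
  {M : Type*} [TopologicalSpace M] [ChartedSpace E M] [IsManifold 𝓘(ℝ, E) ∞ M]
  {v : TangentBundle 𝓘(ℝ, E) M}
  {D : (∀ w : TangentBundle 𝓘(ℝ, E) M, VerticalBundle E M w) →
      ∀ w : TangentBundle 𝓘(ℝ, E) M,
        TangentSpace 𝓘(ℝ, E).tangent w →L[ℝ] VerticalBundle E M w}

lemma differentiableAt_connectionCoeff
    {S : ∀ w : TangentBundle 𝓘(ℝ, E) M, TangentSpace 𝓘(ℝ, E).tangent w}
    (hD : IsSprayConnection S D) (hv : v ∈ puncturedTangentBundle E M) (z : E) (X : E × E) :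
    DifferentiableAt ℝ (fun p => connectionCoeff D v p z X)
      (extChartAt 𝓘(ℝ, E).tangent v v) := by
  have hsrc := mem_extChartAt_source (I := 𝓘(ℝ, E).tangent) v
  obtain ⟨s, hs, hσ⟩ := FiberBundle.exists_contMDiffOn_extend (k := ∞) 𝓘(ℝ, E).tangent E
    (show VerticalBundle E M v from z)
  -- Smoothness of the connection is available only on open subsets of `TM \ 0`, so the
  -- neighbourhood is cut down to one.
  set U := interior s ∩ ((extChartAt 𝓘(ℝ, E).tangent v).source ∩
    extChartAt 𝓘(ℝ, E).tangent v ⁻¹' chartDomain v) with hU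
  have hUo : IsOpen U := isOpen_interior.inter
    ((continuousOn_extChartAt v).isOpen_inter_preimage (isOpen_extChartAt_source v)
      isOpen_chartDomain)
  have hUv : v ∈ U :=
    ⟨mem_interior_iff_mem_nhds.2 hs, hsrc, (chart_mem_chartDomain_iff hsrc).2 hv⟩
  have h1 := (hD.smooth U hUo fun w hw => (chart_mem_chartDomain_iff hw.2.1).1 hw.2.2).contMDiff
    (hσ.mono fun w hw => interior_subset hw.1)
  have h2 := (h1.contMDiffAt (hUo.mem_nhds hUv)).mdifferentiableAt (by simp)
  have h3 := h2.clm_bundle_apply (FiberBundle.mdifferentiableAt_extend 𝓘(ℝ, E).tangent (E × E)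
    (show TangentSpace 𝓘(ℝ, E).tangent v from X))
  exact (mdifferentiableAt_section_iff hsrc).1 h3

variable [FiniteDimensional ℝ E]

/-- The curvature of a connection on the vertical bundle in a chart. -/
lemma connectionCurvature_extend
    {S : ∀ w : TangentBundle 𝓘(ℝ, E) M, TangentSpace 𝓘(ℝ, E).tangent w}
    (hD : IsSprayConnection S D) (hv : v ∈ puncturedTangentBundle E M) (X Y : E × E) (z : E) :
    (connectionCurvature D
      (FiberBundle.extend (E × E) (show TangentSpace 𝓘(ℝ, E).tangent v from X))
      (FiberBundle.extend (E × E) (show TangentSpace 𝓘(ℝ, E).tangent v from Y))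
      (FiberBundle.extend E (show VerticalBundle E M v from z)) v : E) =
    -(fderiv ℝ (fun p => connectionCoeff D v p z Y) (extChartAt 𝓘(ℝ, E).tangent v v) X
      + connectionCoeff D v (extChartAt 𝓘(ℝ, E).tangent v v)
        (connectionCoeff D v (extChartAt 𝓘(ℝ, E).tangent v v) z Y) X
      - (fderiv ℝ (fun p => connectionCoeff D v p z X) (extChartAt 𝓘(ℝ, E).tangent v v) Y
      + connectionCoeff D v (extChartAt 𝓘(ℝ, E).tangent v v)
        (connectionCoeff D v (extChartAt 𝓘(ℝ, E).tangent v v) z X) Y)) := by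
  have hc : CompleteSpace E := FiniteDimensional.complete ℝ E
  have hsrc := mem_extChartAt_source (I := 𝓘(ℝ, E).tangent) v
  have ht := (extChartAt 𝓘(ℝ, E).tangent v).map_source hsrc
  set p₀ := extChartAt 𝓘(ℝ, E).tangent v v with hp₀
  set Xe : ∀ Z : E × E, ∀ w : TangentBundle 𝓘(ℝ, E) M, TangentSpace 𝓘(ℝ, E).tangent w := fun Z =>
    FiberBundle.extend (E × E) (show TangentSpace 𝓘(ℝ, E).tangent v from Z) with hXe
  set Ze : ∀ w : TangentBundle 𝓘(ℝ, E) M, VerticalBundle E M w :=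
    FiberBundle.extend E (show VerticalBundle E M v from z) with hZe
  have hconst : ∀ Z : E × E, readField v (Xe Z) =ᶠ[𝓝 p₀] fun _ => Z := fun Z => by
    filter_upwards [target_mem_nhds ht] with q hq using readField_extend _ hq
  have hbr : VectorField.mlieBracket 𝓘(ℝ, E).tangent (Xe X) (Xe Y) v = 0 := by
    have h1 := chartDeriv_mlieBracket hsrc (differentiableAt_readField_extend hsrc X)
      (differentiableAt_readField_extend hsrc Y)
    have h2 : VectorField.lieBracket ℝ (readField v (Xe X)) (readField v (Xe Y)) p₀ = 0 := by
      rw [(hconst X).lieBracket_vectorField_eq (hconst Y)]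
      simp [VectorField.lieBracket]
    exact chartDeriv_injective hsrc ((h1.trans h2).trans (map_zero (chartDeriv v v)).symm)
  have hcov : ∀ A B : E × E, (D (fun w => D Ze w (Xe A w)) v (Xe B v) : E) =
      fderiv ℝ (fun p => connectionCoeff D v p z A) p₀ B +
        connectionCoeff D v p₀ (connectionCoeff D v p₀ z A) B := by
    intro A B
    have h1 := fibreDeriv_connection hD.isCovariantDerivativeOn hsrc hv
      (σ := fun w => D Ze w (Xe A w)) (differentiableAt_connectionCoeff hD hv z A) (Xe B v)
    have h2 : Xe B v = B := FiberBundle.extend_apply_self (E × E)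
      (show TangentSpace 𝓘(ℝ, E).tangent v from B)
    have h3 : fibreDeriv v v.proj (D Ze v (Xe A v)) = connectionCoeff D v p₀ z A :=
      (readSection_chart (σ := fun w => D Ze w (Xe A w)) hsrc).symm
    rw [h3, chartDeriv_self, fibreDeriv_self] at h1
    rw [h2] at h1 ⊢
    exact h1
  have h1 : (connectionCurvature D (Xe X) (Xe Y) Ze v : E) =
      (D Ze v (VectorField.mlieBracket 𝓘(ℝ, E).tangent (Xe X) (Xe Y) v) : E) -
      ((D (fun w => D Ze w (Xe Y w)) v (Xe X v) : E) -
        (D (fun w => D Ze w (Xe X w)) v (Xe Y v) : E)) := rfl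
  rw [h1, hcov, hcov, hbr]
  exact (congrArg (· - _) (map_zero (D Ze v))).trans (zero_sub _)

/-- The curvature endomorphism of the geodesic spray. -/
lemma curvatureEndomorphism_eq {F : TangentBundle 𝓘(ℝ, E) M → ℝ} (hF : IsFinslerMetric F)
    (hD : IsSprayConnection (geodesicSpray F) D) (hv : v ∈ puncturedTangentBundle E M) (u : E) :
    curvatureEndomorphism (geodesicSpray F) D v u =
      coordCurvature (coordForce (coordEnergy F v)) (extChartAt 𝓘(ℝ, E).tangent v v) u := by
  have hc : CompleteSpace E := FiniteDimensional.complete ℝ E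
  have hsrc := mem_extChartAt_source (I := 𝓘(ℝ, E).tangent) v
  have hp₀ := (chart_mem_chartDomain_iff hsrc).2 hv
  have hL := isCoordEnergy (v := v) hF
  have hy := snd_chart_self (v := v)
  set p₀ := extChartAt 𝓘(ℝ, E).tangent v v
  set f := coordForce (coordEnergy F v) with hf
  have hS : ∀ p ∈ chartDomain v, readField v (geodesicSpray F) =ᶠ[𝓝 p] fun p => (p.2, f p) :=
    fun p hp => readField_geodesicSpray_eventuallyEq hF hp
  have hA : ∀ p ∈ chartDomain v, ∀ X, connectionCoeff D v p p.2 X =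
      -((1 / 2 : ℝ) • fderiv ℝ f p (0, X.1)) := fun p hp X =>
    connectionCoeff_canonicalField hD hp (hS p hp) (hL.differentiableAt_coordForce hp) X
  have hlin : ∀ X, ∀ᶠ p in 𝓝 p₀, IsLinearMap ℝ fun z => connectionCoeff D v p z X := fun X => by
    filter_upwards [isOpen_chartDomain.mem_nhds hp₀] with p hp using
      isLinearMap_connectionCoeff hD.isCovariantDerivativeOn hp X
  -- Differentiating p ↦ Γ(p, y, X) = −½ ∂ᵧf X₁ along Y: the derivative of Γ with z frozen and the
  -- variation Γ(p₀, Y₂, X) of z = y are known only through their sum.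
  have hder : ∀ X Y, fderiv ℝ (fun p => connectionCoeff D v p p₀.2 X) p₀ Y +
      connectionCoeff D v p₀ Y.2 X = -((1 / 2 : ℝ) • fderiv ℝ (fderiv ℝ f) p₀ Y (0, X.1)) := by
    intro X Y
    have h1 := fderiv_apply_of_isLinearMap (B := fun p z => connectionCoeff D v p z X)
      (g := Prod.snd) (hlin X) (fun z => differentiableAt_connectionCoeff hD hv z X)
      differentiableAt_snd Y
    have h2 : (fun p => connectionCoeff D v p p.2 X) =ᶠ[𝓝 p₀] fun p =>
        -((1 / 2 : ℝ) • fderiv ℝ f p (0, X.1)) := by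
      filter_upwards [isOpen_chartDomain.mem_nhds hp₀] with p hp using hA p hp X
    have h3 : HasFDerivAt (fun p => -((1 / 2 : ℝ) • fderiv ℝ f p (0, X.1))) _ p₀ :=
      (((hL.hasFDerivAt_fderiv_coordForce hp₀).clm_apply
      (hasFDerivAt_const ((0, X.1) : E × E) p₀)).const_smul (1 / 2 : ℝ)).neg
    rw [h2.fderiv_eq, h3.fderiv] at h1
    simp [fderiv_snd] at h1
    simpa using h1.symm
  have hhor : ∀ u : E, horizontalLift (geodesicSpray F) v u =
      (u, (1 / 2 : ℝ) • fderiv ℝ f p₀ (0, u)) := fun u =>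
    horizontalLift_eq (hS p₀ hp₀) (hL.differentiableAt_coordForce hp₀) u
  have h0 : curvatureEndomorphism (geodesicSpray F) D v u =
    (connectionCurvature D
      (FiberBundle.extend (E × E) (horizontalLift (geodesicSpray F) v v.2))
      (FiberBundle.extend (E × E) (horizontalLift (geodesicSpray F) v u))
      (FiberBundle.extend E (canonicalField v)) v : E) := rfl
  have hneg : ∀ (z : E) (X : E × E), connectionCoeff D v p₀ (-z) X =
      -connectionCoeff D v p₀ z X := fun z X => by
    have h1 := ((hlin X).self_of_nhds).map_smul (-1) z
    simpa using h1
  -- For horizontal X and Y, Γ(y, X) = −X₂ and Γ(y, Y) = −Y₂. The unknown terms Γ(X₂, Y) and Γ(Y₂,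
  -- X) then occur twice with opposite signs and cancel.
  have key : ∀ X Y : E × E, X = (p₀.2, (1 / 2 : ℝ) • fderiv ℝ f p₀ (0, p₀.2)) →
      Y = (u, (1 / 2 : ℝ) • fderiv ℝ f p₀ (0, u)) →
      -(fderiv ℝ (fun p => connectionCoeff D v p p₀.2 Y) p₀ X
      + connectionCoeff D v p₀ (connectionCoeff D v p₀ p₀.2 Y) X
      - (fderiv ℝ (fun p => connectionCoeff D v p p₀.2 X) p₀ Y
      + connectionCoeff D v p₀ (connectionCoeff D v p₀ p₀.2 X) Y)) = coordCurvature f p₀ u := by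
    intro X Y hX hY
    have e1 := eq_sub_of_add_eq (hder X Y)
    have e2 := eq_sub_of_add_eq (hder Y X)
    have e3 : connectionCoeff D v p₀ p₀.2 X = -X.2 := by rw [hA p₀ hp₀ X, hX]
    have e4 : connectionCoeff D v p₀ p₀.2 Y = -Y.2 := by rw [hA p₀ hp₀ Y, hY]
    -- The horizontal lift of y is the spray itself, since ½ ∂ᵧf y = f by Euler's relation.
    have e5 : X = (p₀.2, f p₀) := by
      rw [hX, hL.fderiv_coordForce_vertical hp₀, smul_smul, ← hf]
      norm_num
    have e6 : X.1 = p₀.2 := congrArg Prod.fst hX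
    have e7 : Y.1 = u := congrArg Prod.fst hY
    rw [e3, e4, hneg, hneg, e1, e2, ← hL.fderiv_fderiv_coordForce_horizontal hp₀, e6, e7, ← hf,
      ← e5, ← hY]
    module
  have hlift : (horizontalLift (geodesicSpray F) v v.2 : E × E) =
      (p₀.2, (1 / 2 : ℝ) • fderiv ℝ f p₀ (0, p₀.2)) := by
    rw [hy]; exact hhor v.2
  have hcan : (canonicalField v : E) = p₀.2 := hy.symm
  refine h0.trans ((connectionCurvature_extend hD hv _ _ _).trans ?_)
  rw [hcan]
  exact key _ _ hlift (hhor u)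

end Curvature

/-! ### The geodesic flow and the Jacobi curve in a chart. -/

section FlowInChart

variable {E : Type*} [NormedAddCommGroup E] [NormedSpace ℝ E]
  {M : Type*} [TopologicalSpace M] [ChartedSpace E M] [IsManifold 𝓘(ℝ, E) ∞ M]
  {v : TangentBundle 𝓘(ℝ, E) M}
  {Φ : ℝ → TangentBundle 𝓘(ℝ, E) M → TangentBundle 𝓘(ℝ, E) M}

lemma chartSymmDeriv_self :
    chartSymmDeriv v (extChartAt 𝓘(ℝ, E).tangent v v) = ContinuousLinearMap.id ℝ (E × E) := by
  have h1 := chartDeriv_comp_symm (mem_extChartAt_target (I := 𝓘(ℝ, E).tangent) v)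
  rw [(extChartAt 𝓘(ℝ, E).tangent v).left_inv (mem_extChartAt_source v), chartDeriv_self,
    ContinuousLinearMap.id_comp] at h1
  exact h1

/-- The Jacobi curve in terms of the differential of the flow in a chart. -/
lemma mem_jacobiCurve_iff {t : ℝ}
    (hd : MDifferentiableAt 𝓘(ℝ, E).tangent 𝓘(ℝ, E).tangent (Φ t) v)
    (ht : Φ t v ∈ (extChartAt 𝓘(ℝ, E).tangent v).source) (X : E × E) :
    X ∈ jacobiCurve Φ v t ↔
      (fderiv ℝ (fun p => extChartAt 𝓘(ℝ, E).tangent v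
        (Φ t ((extChartAt 𝓘(ℝ, E).tangent v).symm p))) (extChartAt 𝓘(ℝ, E).tangent v v) X).1 = 0 := by
  set p₀ := extChartAt 𝓘(ℝ, E).tangent v v
  have hp₀ : p₀ ∈ (extChartAt 𝓘(ℝ, E).tangent v).target := mem_extChartAt_target v
  have hinv : (extChartAt 𝓘(ℝ, E).tangent v).symm p₀ = v :=
    (extChartAt 𝓘(ℝ, E).tangent v).left_inv (mem_extChartAt_source v)
  have h1 : HasMFDerivAt 𝓘(ℝ, E).tangent 𝓘(ℝ, E × E)
      (extChartAt 𝓘(ℝ, E).tangent v ∘ Φ t) ((extChartAt 𝓘(ℝ, E).tangent v).symm p₀)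
      ((chartDeriv v (Φ t v)).comp (show E × E →L[ℝ] E × E from
        mfderiv 𝓘(ℝ, E).tangent 𝓘(ℝ, E).tangent (Φ t) v)) := by
    rw [hinv]
    exact (hasMFDerivAt_chart ht).comp v hd.hasMFDerivAt
  have h2' : HasFDerivAt ((extChartAt 𝓘(ℝ, E).tangent v ∘ Φ t) ∘
      (extChartAt 𝓘(ℝ, E).tangent v).symm) (((chartDeriv v (Φ t v)).comp
      (show E × E →L[ℝ] E × E from mfderiv 𝓘(ℝ, E).tangent 𝓘(ℝ, E).tangent (Φ t) v)).comp
      (chartSymmDeriv v p₀)) p₀ := (h1.comp p₀ (hasMFDerivAt_chart_symm hp₀)).hasFDerivAt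
  have h2 := h2'.fderiv
  rw [chartSymmDeriv_self] at h2
  have h3 : X ∈ jacobiCurve Φ v t ↔
      mfderiv 𝓘(ℝ, E).tangent 𝓘(ℝ, E).tangent (Φ t) v X ∈ verticalSpace (Φ t v) := Iff.rfl
  rw [h3, mem_verticalSpace_iff ht]
  have h4 := congrArg (fun B : E × E →L[ℝ] E × E => (B X).1) h2
  rw [← eq_comm (a := (0 : E)), ← eq_comm (a := (0 : E))]
  exact ⟨fun h => h.trans h4.symm, fun h => h.trans h4⟩

variable [FiniteDimensional ℝ E] {F : TangentBundle 𝓘(ℝ, E) M → ℝ}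

/-- The differential of the geodesic flow in a chart. -/
lemma exists_linearizedFlow_jacobiCurve (hF : IsFinslerMetric F)
    (hv : v ∈ puncturedTangentBundle E M) (hΦ : IsLocalFlowNear (geodesicSpray F) v Φ) :
    ∃ (T : Set ℝ) (N A : ℝ → E × E →L[ℝ] E × E), IsLinearizedFlow T N A ∧
      (∀ t ∈ T, ∀ X, X ∈ jacobiCurve Φ v t ↔ (N t X).1 = 0) ∧
      (∀ X, (A 0 X).2 = fderiv ℝ (coordForce (coordEnergy F v))
        (extChartAt 𝓘(ℝ, E).tangent v v) X) ∧
      ∃ A', HasDerivAt A A' 0 ∧ ∀ X, (A' X).2 =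
        fderiv ℝ (fderiv ℝ (coordForce (coordEnergy F v))) (extChartAt 𝓘(ℝ, E).tangent v v)
          ((extChartAt 𝓘(ℝ, E).tangent v v).2, coordForce (coordEnergy F v)
            (extChartAt 𝓘(ℝ, E).tangent v v)) X := by
  have : CompleteSpace E := FiniteDimensional.complete ℝ E
  obtain ⟨ε, hε, U, hU, hvU, hsm, hflow⟩ := hΦ
  have hsrc := mem_extChartAt_source (I := 𝓘(ℝ, E).tangent) v
  have hp₀ := (chart_mem_chartDomain_iff hsrc).2 hv
  have hL := isCoordEnergy (v := v) hF
  set φ := extChartAt 𝓘(ℝ, E).tangent v with hφ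
  set p₀ := φ v with hp₀'
  have hinv : φ.symm p₀ = v := φ.left_inv hsrc
  set f := coordForce (coordEnergy F v) with hf
  have h0 : (0 : ℝ) ∈ Ioo (-ε) ε := ⟨neg_lt_zero.2 hε, hε⟩
  set W₀ : Set (ℝ × (E × E)) := Ioo (-ε) ε ×ˢ (φ.target ∩ φ.symm ⁻¹' U) with hW₀
  have hW₀o : IsOpen W₀ := isOpen_Ioo.prod
    ((contMDiffOn_extChartAt_symm (n := ∞) v).continuousOn.isOpen_inter_preimage
      (isOpen_extChartAt_target v) hU)
  have hG : ContMDiffOn 𝓘(ℝ, ℝ × (E × E)) 𝓘(ℝ, E).tangent ∞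
      (fun z : ℝ × (E × E) => Φ z.1 (φ.symm z.2)) W₀ := by
    have h1 : ContMDiffOn 𝓘(ℝ, ℝ × (E × E)) 𝓘(ℝ, ℝ) ∞ (Prod.fst : ℝ × (E × E) → ℝ) W₀ :=
      contDiff_fst.contMDiff.contMDiffOn
    have h2 : ContMDiffOn 𝓘(ℝ, ℝ × (E × E)) 𝓘(ℝ, E × E) ∞ (Prod.snd : ℝ × (E × E) → E × E) W₀ :=
      contDiff_snd.contMDiff.contMDiffOn
    exact hsm.comp (h1.prodMk ((contMDiffOn_extChartAt_symm v).comp h2 fun z hz => hz.2.1))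
      fun z hz => ⟨hz.1, hz.2.2⟩
  -- Restricting to times and points whose orbit position still lies in the chart domain lets the
  -- flow be read there as Ψ.
  set W : Set (ℝ × (E × E)) := W₀ ∩ (fun z : ℝ × (E × E) => Φ z.1 (φ.symm z.2)) ⁻¹' φ.source
    with hW
  have hWo : IsOpen W := hG.continuousOn.isOpen_inter_preimage hW₀o (isOpen_extChartAt_source v)
  set Ψ : ℝ × (E × E) → E × E := fun z => φ (Φ z.1 (φ.symm z.2)) with hΨdef
  have hΨ : ContDiffOn ℝ ∞ Ψ W := by
    have h1 := (contMDiffOn_extChartAt (n := ∞) (I := 𝓘(ℝ, E).tangent) (x := v)).comp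
      (hG.mono (t := W) inter_subset_left) fun z hz => by
        have := hz.2
        rwa [mem_preimage, hφ, extChartAt_source] at this
    exact h1.contDiffOn
  have hW0 : (0, p₀) ∈ W := by
    have h1 : φ.symm p₀ ∈ U := by rwa [hinv]
    refine ⟨⟨h0, hp₀.1, h1⟩, ?_⟩
    rw [mem_preimage, (hflow _ h1).1, hinv]
    exact hsrc
  have hS : ContDiffOn ℝ ∞ (fun p : E × E => (p.2, f p)) (chartDomain v) := fun p hp =>
    (contDiffAt_snd.prodMk (hL.contDiffAt_coordForce hp)).contDiffWithinAt
  have hT₁ : {t : ℝ | (t, p₀) ∈ W} ∈ 𝓝 (0 : ℝ) :=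
    (hWo.preimage (Continuous.prodMk_left p₀)).mem_nhds hW0
  have hΨO : MapsTo Ψ W (chartDomain v) := fun z hz =>
    (chart_mem_chartDomain_iff hz.2).2 ((hflow _ hz.1.2.2).2.1 _ hz.1.1)
  have hΨ₀ : ∀ p, (0, p) ∈ W → Ψ (0, p) = p := fun p hp => by
    simp only [hΨdef]
    rw [(hflow _ hp.1.2.2).1, φ.right_inv hp.1.2.1]
  have hΨ' : ∀ t p, (t, p) ∈ W →
      HasDerivAt (fun s => Ψ (s, p)) ((Ψ (t, p)).2, f (Ψ (t, p))) t := by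
    intro t p hp
    have h1 := ((hflow _ hp.1.2.2).2.2 t hp.1.1).hasMFDerivAt (isOpen_Ioo.mem_nhds hp.1.1)
    have h2 : HasFDerivAt (fun s => Ψ (s, p)) ((chartDeriv v (Φ t (φ.symm p))).comp
        ((1 : ℝ →L[ℝ] ℝ).smulRight (show E × E from geodesicSpray F (Φ t (φ.symm p))))) t :=
      ((hasMFDerivAt_chart hp.2).comp t h1).hasFDerivAt
    have h3 := chartDeriv_geodesicSpray hF hp.2 ((hflow _ hp.1.2.2).2.1 _ hp.1.1)
    refine h2.hasDerivAt.congr_deriv (Eq.trans ?_ h3)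
    exact congrArg (chartDeriv v _) (one_smul ℝ _)
  obtain ⟨T, hT, hN⟩ := exists_isLinearizedFlow hWo hW0 hΨ isOpen_chartDomain hΨO hS
    (fun _ _ => rfl) hΨ₀ hΨ' hT₁
  have hSd : ∀ q ∈ chartDomain v, fderiv ℝ (fun p : E × E => (p.2, f p)) q =
      (ContinuousLinearMap.snd ℝ E E).prod (fderiv ℝ f q) := fun q hq =>
    (hasFDerivAt_snd.prodMk (hL.hasFDerivAt_coordForce hq)).fderiv
  have hS0 : Ψ (0, p₀) = p₀ := hΨ₀ p₀ hW0
  refine ⟨T, _, _, hN, ?_, ?_, ?_⟩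
  · intro t ht X
    have htW : (t, p₀) ∈ W := hT ht
    refine mem_jacobiCurve_iff ?_ ?_ X
    · have h1 := (hsm.contMDiffAt ((isOpen_Ioo.prod hU).mem_nhds
        (show (t, v) ∈ _ from ⟨htW.1.1, hvU⟩))).mdifferentiableAt (by simp)
      exact h1.comp v (mdifferentiableAt_const.prodMk mdifferentiableAt_id)
    · have := htW.2
      rwa [mem_preimage, hinv] at this
  · intro X
    simp only [hS0, hSd p₀ hp₀]
    rfl
  · have h1 : HasFDerivAt (fderiv ℝ (fun p : E × E => (p.2, f p)))
        (fderiv ℝ (fderiv ℝ (fun p : E × E => (p.2, f p))) p₀) (Ψ (0, p₀)) := by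
      rw [hS0]
      exact (((hS.contDiffAt (isOpen_chartDomain.mem_nhds hp₀)).fderiv_right (m := 1)
        (by exact WithTop.coe_le_coe.2 le_top)).differentiableAt (by simp)).hasFDerivAt
    have h2 := h1.comp_hasDerivAt (0 : ℝ) (hΨ' 0 p₀ hW0)
    refine ⟨_, h2, fun X => ?_⟩
    -- The second component of DS(q) X is Df(q) X near p₀; differentiating this along the orbit
    -- evaluates the second component of Ȧ(0) X.
    have h3 : fderiv ℝ (fun q => (fderiv ℝ (fun p : E × E => (p.2, f p)) q X).2) p₀ =
        fderiv ℝ (fun q => fderiv ℝ f q X) p₀ := by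
      refine Filter.EventuallyEq.fderiv_eq ?_
      filter_upwards [isOpen_chartDomain.mem_nhds hp₀] with q hq
      rw [hSd q hq]; rfl
    rw [hS0] at h1 ⊢
    have h4 : HasFDerivAt (fun q => (fderiv ℝ (fun p : E × E => (p.2, f p)) q X).2) _ p₀ :=
      (h1.clm_apply (hasFDerivAt_const X p₀)).snd
    have h5 := (hL.hasFDerivAt_fderiv_coordForce hp₀).clm_apply (hasFDerivAt_const X p₀)
    rw [h4.fderiv, h5.fderiv] at h3
    have h6 := congrArg (fun B : E × E →L[ℝ] E => B (p₀.2, f p₀)) h3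
    simpa using h6

/-- The Jacobi endomorphism of the Jacobi curve in coordinates. -/
lemma jacobiCurve_coord (hF : IsFinslerMetric F)
    (hv : v ∈ puncturedTangentBundle E M) (hΦ : IsLocalFlowNear (geodesicSpray F) v Φ) :
    IsFanningAt (jacobiCurve Φ v) 0 ∧
      (∀ e, jacobiEndomorphism (jacobiCurve Φ v) 0 (0, e) =
        (0, coordCurvature (coordForce (coordEnergy F v)) (extChartAt 𝓘(ℝ, E).tangent v v) e)) ∧
      ∀ e₁ e₂, wronskian (V := E × E) (omegaForm F v) (jacobiCurve Φ v) 0 (0, e₁) (0, e₂) =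
        coordMetric (coordEnergy F v) (extChartAt 𝓘(ℝ, E).tangent v v) e₁ e₂ := by
  have hsrc := mem_extChartAt_source (I := 𝓘(ℝ, E).tangent) v
  obtain ⟨T, N, A, hN, hℓ, hA, A', hA', hA''⟩ := exists_linearizedFlow_jacobiCurve hF hv hΦ
  refine ⟨hN.isFanningAt hℓ hN.zero_mem, fun e => ?_, fun e₁ e₂ => ?_⟩
  · rw [hN.jacobiEndomorphism_apply hℓ hA', hA'', hA, hA, hA]
    rfl
  · have h1 : ∀ Y : E × E, omegaForm F v (show E × E from (0, e₁)) Y =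
        -fderiv ℝ (fderiv ℝ (coordEnergy F v)) (extChartAt 𝓘(ℝ, E).tangent v v)
          (0, e₁) (0, Y.1) := fun Y => by
      have h2 := omegaForm_eq hF hsrc hv (show E × E from (0, e₁)) Y
      rw [chartDeriv_self] at h2
      refine h2.trans ?_
      simp only [coordOmega, ContinuousLinearMap.id_apply]
      exact (congrArg (· - _) (map_zero _)).trans (zero_sub _)
    have h3 := hN.wronskian_eq hℓ (Ω := omegaForm F v) (x := (0, e₁)) (c := fun e =>
      -fderiv ℝ (fderiv ℝ (coordEnergy F v)) (extChartAt 𝓘(ℝ, E).tangent v v) (0, e₁) (0, e)) h1 e₂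
    refine h3.trans ?_
    have h5 : ((0, -e₂) : E × E) = -(0, e₂) := by simp
    rw [h5, map_neg, neg_neg]
    rfl

end FlowInChart

/-! ### The flag curvature for an edge orthogonal to the flagpole. -/

section FlagCurvature

variable {E : Type*} [NormedAddCommGroup E] [NormedSpace ℝ E]
  {M : Type*} [TopologicalSpace M] [ChartedSpace E M] [IsManifold 𝓘(ℝ, E) ∞ M]

/-- Two vectors spanning the same plane with `v` differ by a multiple of `v`, up to a factor. -/
lemma exists_eq_of_span_pair_eq {V : Type*} [AddCommGroup V] [Module ℝ V] {v u u' : V}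
    (hvu : LinearIndependent ℝ ![v, u])
    (h : Submodule.span ℝ {v, u} = Submodule.span ℝ {v, u'}) :
    ∃ α β : ℝ, α ≠ 0 ∧ u' = α • u + β • v := by
  have h1 : u' ∈ Submodule.span ℝ {v, u} := by
    rw [h]; exact Submodule.subset_span (by simp)
  have h2 : u ∈ Submodule.span ℝ {v, u'} := by
    rw [← h]; exact Submodule.subset_span (by simp)
  obtain ⟨β, α, rfl⟩ := Submodule.mem_span_pair.1 h1
  obtain ⟨δ, γ, h3⟩ := Submodule.mem_span_pair.1 h2
  refine ⟨α, β, ?_, add_comm _ _⟩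
  rintro rfl
  rw [LinearIndependent.pair_iff] at hvu
  -- If α = 0, then u' = β v, so u would be a multiple of v.
  have h4 := hvu (δ + γ * β) (-1) (by rw [← sub_eq_zero] at h3; rw [← h3]; module)
  norm_num at h4

lemma coordCurvature_add_smul (f : E × E → E) (p : E × E) (α β : ℝ) (u y : E) :
    coordCurvature f p (α • u + β • y) = α • coordCurvature f p u + β • coordCurvature f p y := by
  have h1 : ((0, α • u + β • y) : E × E) = α • (0, u) + β • (0, y) := by simp
  have h2 : ((α • u + β • y, 0) : E × E) = α • (u, 0) + β • (y, 0) := by simp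
  have h3 : ∀ a b : E, ((0, α • a + β • b) : E × E) = α • (0, a) + β • (0, b) := by simp
  simp only [coordCurvature, h1, h2, map_add, map_smul, h3]
  module

variable [FiniteDimensional ℝ E] {F : TangentBundle 𝓘(ℝ, E) M → ℝ} {v : TangentBundle 𝓘(ℝ, E) M}
  {D : (∀ w : TangentBundle 𝓘(ℝ, E) M, VerticalBundle E M w) →
      ∀ w : TangentBundle 𝓘(ℝ, E) M,
        TangentSpace 𝓘(ℝ, E).tangent w →L[ℝ] VerticalBundle E M w}

/-- The flag curvature of a flag with transverse edge orthogonal to the flagpole. -/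
lemma flagCurvature_eq (hF : IsFinslerMetric F) (hD : IsSprayConnection (geodesicSpray F) D)
    (hv : v ∈ puncturedTangentBundle E M) {u : E}
    (hvu : LinearIndependent ℝ ![(v.2 : E), u])
    (hort : fundamentalTensor F v v.2 u = 0) :
    flagCurvature F D v (Submodule.span ℝ {v.2, u}) =
      1 / F v ^ 2 * (coordMetric (coordEnergy F v) (extChartAt 𝓘(ℝ, E).tangent v v)
        (coordCurvature (coordForce (coordEnergy F v)) (extChartAt 𝓘(ℝ, E).tangent v v) u) u /
        coordMetric (coordEnergy F v) (extChartAt 𝓘(ℝ, E).tangent v v) u u) := by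
  have hsrc := mem_extChartAt_source (I := 𝓘(ℝ, E).tangent) v
  have hp₀ := (chart_mem_chartDomain_iff hsrc).2 hv
  have hL := isCoordEnergy (v := v) hF
  have hy := snd_chart_self (v := v)
  set p₀ := extChartAt 𝓘(ℝ, E).tangent v v
  set f := coordForce (coordEnergy F v)
  set L := coordEnergy F v with hLdef
  set g : E → E → ℝ := fun a b => fderiv ℝ (fderiv ℝ L) p₀ (0, a) (0, b) with hg
  have hgF : ∀ a b : E, fundamentalTensor F v a b = g a b := fun a b => by
    have h1 := fundamentalTensor_apply hF hsrc hv a b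
    rw [fibreDeriv_self] at h1
    exact h1
  have hgl : ∀ (a b : ℝ) (x y z : E), g (a • x + b • y) z = a * g x z + b * g y z := by
    intro a b x y z
    have h1 : ((0, a • x + b • y) : E × E) = a • (0, x) + b • (0, y) := by simp
    simp only [hg, h1, map_add, map_smul, add_apply, smul_apply, smul_eq_mul]
  have hgs : ∀ a b : E, g a b = g b a := fun a b => hL.symm hp₀ _ _
  have hgy : ∀ a : E, g a p₀.2 = fderiv ℝ L p₀ (0, a) := fun a => by
    rw [hgs]; exact (hL.fderiv_vertical_eq hp₀ a).symm
  have hyy : g p₀.2 p₀.2 = F v ^ 2 := by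
    rw [hgy, hL.fderiv_vertical hp₀, hLdef, coordEnergy_chart hsrc, energy]
    ring
  have hFv : F v ≠ 0 := fun h => hv ((hF.eq_zero_iff v).1 h)
  have hu : u ≠ 0 := fun h => by simpa using hvu.ne_zero (i := 1) h
  have huu : g u u ≠ 0 := (hL.posDef p₀ hp₀ u hu).ne'
  replace hort : g p₀.2 u = 0 := by
    rw [hy]; exact (hgF v.2 u).symm.trans hort
  -- The definition picks some u' completing v to a spanning pair of the plane; nothing else is
  -- known about u'.
  obtain ⟨u', hu', hval⟩ : ∃ u' : E, (Submodule.span ℝ {(v.2 : E), u} : Submodule ℝ E) =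
      Submodule.span ℝ {(v.2 : E), u'} ∧ flagCurvature F D v (Submodule.span ℝ {v.2, u}) =
      g (coordCurvature f p₀ u') u' / (g p₀.2 p₀.2 * g u' u' - g p₀.2 u' ^ 2) := by
    refine ⟨_, Classical.epsilon_spec (p := fun u' : E =>
      (Submodule.span ℝ {(v.2 : E), u} : Submodule ℝ E) = Submodule.span ℝ {(v.2 : E), u'})
      ⟨u, rfl⟩, ?_⟩
    have h1 : ∀ u' : E, fundamentalTensor F v (curvatureEndomorphism (geodesicSpray F) D v u') u' /
      (fundamentalTensor F v v.2 v.2 * fundamentalTensor F v u' u' - fundamentalTensor F v v.2 u' ^ 2)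
      = g (coordCurvature f p₀ u') u' / (g p₀.2 p₀.2 * g u' u' - g p₀.2 u' ^ 2) := fun u' => by
      rw [hy]
      exact congrArg₂ (· / ·) ((congrArg (fun x => fundamentalTensor F v x u')
        (curvatureEndomorphism_eq hF hD hv u')).trans (hgF _ _))
        (congrArg₂ (· - ·) (congrArg₂ (· * ·) (hgF _ _) (hgF _ _)) (congrArg (· ^ 2) (hgF _ _)))
    exact h1 _
  obtain ⟨α, β, hα, rfl⟩ : ∃ α β : ℝ, α ≠ 0 ∧ u' = α • u + β • p₀.2 := by
    rw [hy]; exact exists_eq_of_span_pair_eq (V := E) hvu hu'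
  have hgm : ∀ a b : E, coordMetric L p₀ a b = g a b := fun a b => rfl
  rw [hval, hgm, hgm, coordCurvature_add_smul, hL.coordCurvature_self hp₀, smul_zero, add_zero]
  -- With R(y) = 0 and R(u) orthogonal to y, replacing u by u' = α u + β y multiplies numerator and
  -- denominator alike by α².
  have hRy : g (coordCurvature f p₀ u) p₀.2 = 0 := by
    rw [hgy]; exact hL.fderiv_coordCurvature hp₀ u
  have e1 : ∀ x : E, g x (α • u + β • p₀.2) = α * g x u + β * g x p₀.2 := fun x => by
    rw [hgs, hgl, hgs u, hgs p₀.2]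
  have e2 : g (α • coordCurvature f p₀ u) (α • u + β • p₀.2) =
      α ^ 2 * g (coordCurvature f p₀ u) u := by
    have h1 := hgl α 0 (coordCurvature f p₀ u) 0
    simp only [zero_smul, add_zero, zero_mul] at h1
    rw [h1, e1, hRy]; ring
  have e3 : g u p₀.2 = 0 := by rw [hgs, hort]
  have e4 : F v ^ 2 * (α * (α * g u u + β * 0) + β * (α * 0 + β * F v ^ 2)) -
      (α * 0 + β * F v ^ 2) ^ 2 = F v ^ 2 * (α ^ 2 * g u u) := by ring
  rw [e2, hgl, e1, e1, hort, e3, hyy, e4]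
  field_simp

end FlagCurvature

end FinslerJacobi

end

/-! ### The theorem, assembled from the coordinate formulas at `v`. -/

theorem mainTheorem1 {E : Type*} [NormedAddCommGroup E] [NormedSpace ℝ E] [FiniteDimensional ℝ E]
    {M : Type*} [TopologicalSpace M] [T2Space M] [ChartedSpace E M] [IsManifold 𝓘(ℝ, E) ∞ M]
    (F : TangentBundle 𝓘(ℝ, E) M → ℝ) (hF : FinslerJacobi.IsFinslerMetric F)
    (D : (∀ w : TangentBundle 𝓘(ℝ, E) M, FinslerJacobi.VerticalBundle E M w) →
      ∀ w : TangentBundle 𝓘(ℝ, E) M,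
        TangentSpace 𝓘(ℝ, E).tangent w →L[ℝ] FinslerJacobi.VerticalBundle E M w)
    (hD : FinslerJacobi.IsSprayConnection (FinslerJacobi.geodesicSpray F) D)
    (v : TangentBundle 𝓘(ℝ, E) M) (u : TangentSpace 𝓘(ℝ, E) v.proj)
    (hvu : LinearIndependent ℝ ![v.2, u])
    (hort : FinslerJacobi.fundamentalTensor F v v.2 u = 0)
    (Φ : ℝ → TangentBundle 𝓘(ℝ, E) M → TangentBundle 𝓘(ℝ, E) M)
    (hΦ : FinslerJacobi.IsLocalFlowNear (FinslerJacobi.geodesicSpray F) v Φ)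
    (ℓ : ℝ → Submodule ℝ (E × E)) (hℓ : ℓ = FinslerJacobi.jacobiCurve Φ v)
    (W : E × E → E × E → ℝ)
    (hW : W = FinslerJacobi.wronskian (V := E × E) (FinslerJacobi.omegaForm F v) ℓ 0)
    (K : E × E →L[ℝ] E × E) (hK : K = FinslerJacobi.jacobiEndomorphism ℓ 0)
    (a : E × E) (ha : a = FinslerJacobi.verticalLift v u) :
    FinslerJacobi.IsFanningAt ℓ 0 ∧ W a a ≠ 0 ∧
      FinslerJacobi.flagCurvature F D v (Submodule.span ℝ {v.2, u}) =
        1 / F v ^ 2 * (W (K a) a / W a a) := by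
  have hv : v ∈ FinslerJacobi.puncturedTangentBundle E M := hvu.ne_zero (i := 0)
  have hu : u ≠ 0 := hvu.ne_zero (i := 1)
  have hsrc := mem_extChartAt_source (I := 𝓘(ℝ, E).tangent) v
  obtain ⟨h1, h2, h3⟩ := FinslerJacobi.jacobiCurve_coord hF hv hΦ
  have hWc : ∀ e₁ e₂ : E, W (0, e₁) (0, e₂) = FinslerJacobi.coordMetric
      (FinslerJacobi.coordEnergy F v) (extChartAt 𝓘(ℝ, E).tangent v v) e₁ e₂ := by
    rw [hW, hℓ]; exact h3
  -- At the centre of the preferred chart its differential is the identity, so the vertical lift of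
  -- u is literally (0, u) in `E × E`.
  obtain ⟨u₀, ha₀, rfl⟩ : ∃ u₀ : E, a = (0, u₀) ∧ u₀ = u := by
    have h4 := FinslerJacobi.chartDeriv_verticalLift hsrc u
    rw [FinslerJacobi.chartDeriv_self, FinslerJacobi.fibreDeriv_self] at h4
    exact ⟨u, ha.trans h4, rfl⟩
  have hKa : K a = (0, FinslerJacobi.coordCurvature (FinslerJacobi.coordForce
      (FinslerJacobi.coordEnergy F v)) (extChartAt 𝓘(ℝ, E).tangent v v) u₀) := by
    rw [hK, hℓ, ha₀]; exact h2 u₀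
  rw [hKa, ha₀, hWc, hWc, hℓ]
  exact ⟨h1, ((FinslerJacobi.isCoordEnergy hF).posDef _
    ((FinslerJacobi.chart_mem_chartDomain_iff hsrc).2 hv) u₀ hu).ne',
    FinslerJacobi.flagCurvature_eq hF hD hv hvu hort⟩
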